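/- **Setting.** Let $M$ be a smooth manifold, $E,F\to M$ smooth real vector bundles, $T$ a section of $E$ (components $T^a$), $R:F\to TM$ a bundle map (components $R^i_\alpha$), $P=(P^{ij})$ a bivector field on $M$. Let $\mathcal M=\Pi E\oplus\Pi F$ with coordinates $\phi^A=(x^i,\eta^a,c^\alpha)$ of parities $A=(0,1,1)$ and ghost numbers $(0,-1,1)$. Let $\mathcal N=\Pi T^*\mathcal M$, with canonical momenta $\phi^*_A=(x^*_i,\eta^*_a,c^*_\alpha)$ of parity $A+1$, ghost numbers $(1,2,0)$ and momentum degree $1$, and with its canonical odd Poisson bracket $(\cdot,\cdot)$, $(\phi^*_A,\phi^B)=\delta_A^B$. The coordinates $\eta^a,c^*_\alpha$ have resolution degree $1$, the other coordinates of $\mathcal N$ have resolution degree $0$. Let $\Pi T\mathcal N$ have the further coordinates $d\phi^A$ (parity $A+1$, ghost numbers $(-1,-2,0)$) and $d\phi^*_A$ (parity $A$, ghost numbers $(0,1,-1)$), and the even Poisson bracket $$\{F,G\}=(-1)^{A(F+1)}\Big(\tfrac{\partial F}{\partial d\phi^*_A}\tfrac{\partial G}{\partial\phi^A}+(-1)^F\tfrac{\partial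 F}{\partial d\phi^A}\tfrac{\partial G}{\partial\phi^*_A}\Big)-(-1)^{AF}\Big(\tfrac{\partial F}{\partial\phi^A}\tfrac{\partial G}{\partial d\phi^*_A}-(-1)^F\tfrac{\partial F}{\partial\phi^*_A}\tfrac{\partial G}{\partial d\phi^A}\Big).$$ Put $\Delta=(-1)^A d\phi^A d\phi^*_A$ and $\mathcal L=\{\phi^*=0=d\phi^*\}\cong\Pi T\mathcal M$. Functions on $\mathcal L$ carry the form degree, in which the $d\phi^A$ have degree $1$. The coordinates $d\phi^A$ transform so that the vector field $(-1)^Ad\phi^A\partial/\partial\phi^A$ is globally defined. A form on $M$, i.e. a function on $\Pi TM$, is identified with its pull-back to $\mathcal M$. Let $S=\sum_{k\ge1}S^k$ be a master function, a (formal) sum of functions $S^k$ on $\mathcal N$ of momentum degree $k$: $S$ is even, of ghost number $2$, $(S,S)=0$, and $S=T^a\eta^*_a+c^\alpha R^i_\alpha x^*_i+P^{ij}x^*_jx^*_i+(\text{terms of positive resolution degree})$. Let $V=\sum_{k\ge1}V^k$ be an odd function on $\mathcal N$ of ghost number $1$ with $(S,V)=0$ and $V=X^ix^*_i+(\text{terms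 of positive resolution degree})$, for a vector field $X$ on $M$. Put $\Psi=\{\Delta,S\}$, $\Gamma=\{\Delta,V\}$, and for functions $\omega,\tau$ on $\mathcal L$ $$\hat Q\omega=\{\Psi,\omega\}|_{\mathcal L},\quad [\omega,\tau]=\{\{\Psi,\omega\},\tau\}|_{\mathcal L},\quad \dot\omega=\{\Gamma,\omega\}|_{\mathcal L},\quad \mathcal L_V\omega=(-1)^V\dot\omega=-\dot\omega .$$ A $k$-form $\omega$ on $M$ is *projectible* if it has an extension $\tilde\omega$ to $\mathcal L$ (that is, $\tilde\omega|_{\Pi TM}=\omega$) of form degree $k$ and ghost number $-k$ with $\hat Q\tilde\omega=0$. A function on $\mathcal L$ of form degree $k$ and ghost number $l$ is *zero in cohomology* if it equals $\hat Q\tau$ for some function $\tau$ on $\mathcal L$ of form degree $k$ and ghost number $l-1$. The *weak Koszul bracket* of forms $\omega,\tau$ on $M$ is $[\omega,\tau]|_{\Pi TM}$. **Statement.** Let $\omega$ be a projectible $1$-form and $F$ a projectible function on $M$, with extensions $\tilde\omega,\tilde F$ as above, such that $\dot{\tilde\omega}=0$ and $\dot{\tilde F}=0$ in cohomology. Then the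 weak Koszul bracket $f=[\omega,F]|_{\Pi TM}$ is a projectible function on $M$: the function $[\tilde\omega,\tilde F]$ on $\mathcal L$ has form degree $0$ and ghost number $0$, restricts to $f$ on $\Pi TM$, and is a $\hat Q$-cocycle. Moreover $\mathcal L_V[\tilde\omega,\tilde F]=0$ in cohomology. In particular $f$ is a physical observable and an integral of the motion along $X$: in local coordinates of $M$ and local trivialisations of $E$ and $F$, the functions $R^i_\alpha\partial_if$ (for every $\alpha$) and $X^i\partial_if$ lie in the ideal of smooth functions generated by the $T^a$. -/

import Mathlib

open scoped Manifold ContDiff TensorProduct Bundle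

noncomputable section

namespace WeakKoszul

/-! ## Superdomains

`M` has local coordinates `x^i` (`i : Fin d`), `E` has fibre coordinates `η^a` (`a : Fin m`) and `F`
has fibre coordinates `c^α` (`α : Fin n`).  The coordinates of `𝓜 = ΠE ⊕ ΠF` are
`φ^A = (x^i, η^a, c^α)`, those of `𝓝 = ΠT*𝓜` are `(φ^A, φ*_A)` (canonical momenta), and those of
`ΠT𝓝` are `(φ^A, φ*_A, dφ^A, dφ*_A)`. -/

/-- The local model of `M`. -/
abbrev Model (d : ℕ) := EuclideanSpace ℝ (Fin d)

/-- The index `z` of a fibre coordinate of `𝓜`: `η^a` or `c^α`. -/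
abbrev FibIdx (m n : ℕ) := Fin m ⊕ Fin n

/-- The index `A` of a coordinate `φ^A` of `𝓜`: `x^i`, `η^a` or `c^α`. -/
abbrev Idx (d m n : ℕ) := Fin d ⊕ FibIdx m n

/-- Grassmann parity of `φ^A` (as a natural number, `0` or `1`). -/
def par {d m n : ℕ} : Idx d m n → ℕ
  | .inl _ => 0
  | .inr _ => 1

/-- The even coordinates of `ΠT𝓝` other than `x^i`: `η*_a`, `c*_α`, `dη^a`, `dc^α`, `dx*_i`. -/
inductive EvenGen (d m n : ℕ) where
  | etaMom (a : Fin m)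
  | cMom (α : Fin n)
  | etaVel (a : Fin m)
  | cVel (α : Fin n)
  | xCovel (i : Fin d)
  deriving DecidableEq, Fintype

/-- The odd coordinates of `ΠT𝓝`: `η^a`, `c^α`, `x*_i`, `dx^i`, `dη*_a`, `dc*_α`. -/
inductive OddGen (d m n : ℕ) where
  | eta (a : Fin m)
  | c (α : Fin n)
  | xMom (i : Fin d)
  | xVel (i : Fin d)
  | etaCovel (a : Fin m)
  | cCovel (α : Fin n)
  deriving DecidableEq, Fintype

/-- All coordinates of `ΠT𝓝` other than `x^i`. -/
abbrev FibGen (d m n : ℕ) := EvenGen d m n ⊕ OddGen d m n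

section coordinates
variable {d m n : ℕ}

/-- `η^a` and `c^α` -/
def fib : FibIdx m n → FibGen d m n
  | .inl a => .inr (.eta a)
  | .inr α => .inr (.c α)

/-- `φ*_A` -/
def mom : Idx d m n → FibGen d m n
  | .inl i => .inr (.xMom i)
  | .inr (.inl a) => .inl (.etaMom a)
  | .inr (.inr α) => .inl (.cMom α)

/-- `dφ^A` -/
def vel : Idx d m n → FibGen d m n
  | .inl i => .inr (.xVel i)
  | .inr (.inl a) => .inl (.etaVel a)
  | .inr (.inr α) => .inl (.cVel α)

/-- `dφ*_A` -/
def covel : Idx d m n → FibGen d m n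
  | .inl i => .inl (.xCovel i)
  | .inr (.inl a) => .inr (.etaCovel a)
  | .inr (.inr α) => .inr (.cCovel α)

/-- Ghost numbers. -/
def ghostWt : FibGen d m n → ℤ
  | .inl (.etaMom _) => 2
  | .inl (.cMom _) => 0
  | .inl (.etaVel _) => -2
  | .inl (.cVel _) => 0
  | .inl (.xCovel _) => 0
  | .inr (.eta _) => -1
  | .inr (.c _) => 1
  | .inr (.xMom _) => 1
  | .inr (.xVel _) => -1
  | .inr (.etaCovel _) => 1
  | .inr (.cCovel _) => -1

/-- Momentum degrees, on `𝓝`: the `φ*_A` have degree one. -/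
def momWt : FibGen d m n → ℤ
  | .inl (.etaMom _) => 1
  | .inl (.cMom _) => 1
  | .inr (.xMom _) => 1
  | _ => 0

/-- Form degrees, on `ΠT𝓜`: the `dφ^A` have degree one. -/
def formWt : FibGen d m n → ℤ
  | .inl (.etaVel _) => 1
  | .inl (.cVel _) => 1
  | .inr (.xVel _) => 1
  | _ => 0

/-- The coordinates that survive on `𝓛 = {φ* = 0 = dφ*} ≅ ΠT𝓜`. -/
def onL : FibGen d m n → Bool
  | .inl (.etaVel _) => true
  | .inl (.cVel _) => true
  | .inr (.eta _) => true
  | .inr (.c _) => true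
  | .inr (.xVel _) => true
  | _ => false

/-- The coordinates that survive on `ΠTM`: besides `x^i`, only `dx^i`. -/
def onTM : FibGen d m n → Bool
  | .inr (.xVel _) => true
  | _ => false

/-- The coordinates of resolution degree zero on `𝓝`: all but `η^a` and `c*_α`. -/
def resZero : FibGen d m n → Bool
  | .inr (.eta _) => false
  | .inl (.cMom _) => false
  | _ => true

end coordinates

/-- Polynomials in the coordinates of `ΠT𝓝` other than `x^i`, with real coefficients: the free
supercommutative algebra on these even and odd generators. -/
abbrev Fib (d m n : ℕ) :=
  MvPolynomial (EvenGen d m n) ℝ ⊗[ℝ] ExteriorAlgebra ℝ (OddGen d m n →₀ ℝ)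

section fibre
variable {d m n : ℕ}

/-- A generator as an element of the algebra. -/
def gen : FibGen d m n → Fib d m n
  | .inl g => MvPolynomial.X g ⊗ₜ 1
  | .inr g => 1 ⊗ₜ ExteriorAlgebra.ι ℝ (Finsupp.single g 1)

/-- The left partial derivative with respect to a generator. -/
def fibDeriv : FibGen d m n → (Fib d m n →ₗ[ℝ] Fib d m n)
  | .inl g => LinearMap.rTensor _ (MvPolynomial.pderiv g).toLinearMap
  | .inr g => LinearMap.lTensor _
      (CliffordAlgebra.contractLeft (Q := (0 : QuadraticForm ℝ (OddGen d m n →₀ ℝ)))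
        (Finsupp.lapply g))

/-- The parity involution `f ↦ (-1)^f f`. -/
def fibInvol : Fib d m n →ₐ[ℝ] Fib d m n :=
  Algebra.TensorProduct.map (AlgHom.id ℝ _)
    (CliffordAlgebra.involute (Q := (0 : QuadraticForm ℝ (OddGen d m n →₀ ℝ))))

/-- Put all generators outside `keep` equal to zero. -/
def fibRestrict (keep : FibGen d m n → Bool) : Fib d m n →ₐ[ℝ] Fib d m n :=
  Algebra.TensorProduct.map
    (MvPolynomial.aeval fun g => if keep (.inl g) then MvPolynomial.X g else 0)
    (ExteriorAlgebra.map (Finsupp.linearCombination ℝ fun g =>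
      if keep (.inr g) then Finsupp.single g (1 : ℝ) else 0))

end fibre

section base
variable {d : ℕ}

/-- Extension by zero of a function on `Ω`. -/
def extZero (Ω : TopologicalSpace.Opens (Model d)) (f : Ω → ℝ) : Model d → ℝ :=
  Function.extend Subtype.val f 0

theorem extZero_apply {Ω : TopologicalSpace.Opens (Model d)} (f : Ω → ℝ) {y : Model d}
    (hy : y ∈ Ω) : extZero Ω f y = f ⟨y, hy⟩ :=
  Subtype.val_injective.extend_apply f 0 ⟨y, hy⟩

/-- The ring `C^∞(Ω)` of an open set `Ω ⊆ ℝ^d`. -/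
def Smooth (Ω : TopologicalSpace.Opens (Model d)) : Subalgebra ℝ (Ω → ℝ) where
  carrier := {f | ContDiffOn ℝ ∞ (extZero Ω f) Ω}
  mul_mem' {f g} hf hg := (ContDiffOn.mul hf hg).congr fun y hy => by
    simp [extZero_apply _ hy]
  add_mem' {f g} hf hg := (ContDiffOn.add hf hg).congr fun y hy => by
    simp [extZero_apply _ hy]
  algebraMap_mem' r := (contDiffOn_const (c := r)).congr fun y hy => by
    simp [extZero_apply _ hy]

theorem smooth_contDiffOn {Ω : TopologicalSpace.Opens (Model d)} (f : Smooth Ω) :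
    ContDiffOn ℝ ∞ (extZero Ω f) Ω := f.2

theorem smooth_differentiableAt {Ω : TopologicalSpace.Opens (Model d)} (f : Smooth Ω) (y : Ω) :
    DifferentiableAt ℝ (extZero Ω f) y :=
  ((smooth_contDiffOn f).differentiableOn (by simp)).differentiableAt (Ω.isOpen.mem_nhds y.2)

/-- The partial derivative `∂/∂x^i` on `C^∞(Ω)`. -/
def baseDeriv (Ω : TopologicalSpace.Opens (Model d)) (i : Fin d) : Smooth Ω →ₗ[ℝ] Smooth Ω where
  toFun f := ⟨fun y => fderiv ℝ (extZero Ω f) y (EuclideanSpace.single i 1),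
    (((smooth_contDiffOn f).fderiv_of_isOpen (m := ∞) Ω.isOpen (by simp)).clm_apply
      contDiffOn_const).congr fun y hy => by rw [extZero_apply _ hy]⟩
  map_add' f g := by
    ext y
    have h : extZero Ω (f + g : Smooth Ω) =ᶠ[nhds y.1] extZero Ω f + extZero Ω g := by
      filter_upwards [Ω.isOpen.mem_nhds y.2] with z hz
      simp [extZero_apply _ hz]
    simp only [h.fderiv_eq, fderiv_add (smooth_differentiableAt f y) (smooth_differentiableAt g y)]
    rfl
  map_smul' r f := by
    ext y
    have h : extZero Ω (r • f : Smooth Ω) =ᶠ[nhds y.1] r • extZero Ω f := by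
      filter_upwards [Ω.isOpen.mem_nhds y.2] with z hz
      simp [extZero_apply _ hz]
    simp only [h.fderiv_eq, fderiv_const_smul (smooth_differentiableAt f y)]
    rfl

/-- Evaluation of smooth functions at a point. -/
def baseEval {Ω : TopologicalSpace.Opens (Model d)} (y : Ω) : Smooth Ω →ₗ[ℝ] ℝ :=
  (LinearMap.proj y).comp (Smooth Ω).val.toLinearMap

end base

/-- Functions on `ΠT𝓝` over a coordinate domain `Ω`, polynomial in the coordinates other than
`x^i`, with coefficients in `C^∞(Ω)`. -/
abbrev Loc (m n : ℕ) {d : ℕ} (Ω : TopologicalSpace.Opens (Model d)) := Smooth Ω ⊗[ℝ] Fib d m n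

section localCalculus
variable {d m n : ℕ} {Ω : TopologicalSpace.Opens (Model d)}

/-- A coordinate other than `x^i` as a local function. -/
def coord (g : FibGen d m n) : Loc m n Ω := 1 ⊗ₜ gen g

/-- Left partial derivative with respect to a coordinate other than `x^i`. -/
def pd (g : FibGen d m n) : Loc m n Ω →ₗ[ℝ] Loc m n Ω := LinearMap.lTensor _ (fibDeriv g)

/-- `∂/∂φ^A` -/
def pdPos : Idx d m n → (Loc m n Ω →ₗ[ℝ] Loc m n Ω)
  | .inl i => LinearMap.rTensor _ (baseDeriv Ω i)
  | .inr z => pd (fib z)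

/-- `(-1)^f f`, extended linearly. -/
def invol : Loc m n Ω →ₐ[ℝ] Loc m n Ω :=
  Algebra.TensorProduct.map (AlgHom.id ℝ _) fibInvol

/-- `(-1)^{kf} f`, extended linearly. -/
def twist (k : ℕ) (f : Loc m n Ω) : Loc m n Ω := (invol (m := m) (n := n) (Ω := Ω))^[k] f

/-- Put all coordinates outside `keep` equal to zero. -/
def restrict (keep : FibGen d m n → Bool) : Loc m n Ω →ₐ[ℝ] Loc m n Ω :=
  Algebra.TensorProduct.map (AlgHom.id ℝ _) (fibRestrict keep)

/-- The value of a local function at a point `y` of the base, a polynomial in the fibre. -/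
def evalAt (y : Ω) : Loc m n Ω →ₗ[ℝ] Fib d m n :=
  (TensorProduct.lid ℝ (Fib d m n)).toLinearMap ∘ₗ LinearMap.rTensor _ (baseEval y)

/-- `f` is homogeneous of weight `l` for the weights `wt` of the coordinates (eigenvalue of the
Euler vector field `∑ wt(g) g ∂/∂g`). -/
def IsHomog (wt : FibGen d m n → ℤ) (l : ℤ) (f : Loc m n Ω) : Prop :=
  ∑ g, (wt g : ℝ) • (coord g * pd g f) = (l : ℝ) • f

/-- `f` has ghost number `l`, and parity `l` modulo two. -/
def HasGhost (l : ℤ) (f : Loc m n Ω) : Prop :=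
  IsHomog ghostWt l f ∧ invol f = ((-1 : ℝ) ^ l) • f

/-- The even Poisson bracket on `ΠT𝓝`:
`{F,G} = (-1)^{A(F+1)} (∂F/∂dφ*_A ∂G/∂φ^A + (-1)^F ∂F/∂dφ^A ∂G/∂φ*_A)
  - (-1)^{AF} (∂F/∂φ^A ∂G/∂dφ*_A - (-1)^F ∂F/∂φ*_A ∂G/∂dφ^A)`, summed over `A`. -/
def evenBracket (F G : Loc m n Ω) : Loc m n Ω :=
  ∑ A : Idx d m n,
    (((-1 : ℝ) ^ par A) •
        (pd (covel A) (twist (par A) F) * pdPos A G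
          + pd (vel A) (twist (par A + 1) F) * pd (mom A) G)
      - (pdPos A (twist (par A) F) * pd (covel A) G
          - pd (mom A) (twist (par A + 1) F) * pd (vel A) G))

/-- The canonical odd Poisson bracket on `𝓝 = ΠT*𝓜`, with `(φ*_A, φ^B) = δ_A^B`:
`(F,G) = (-1)^{(A+1)(F+1)} ∂F/∂φ*_A ∂G/∂φ^A - (-1)^{A(F+1)} ∂F/∂φ^A ∂G/∂φ*_A`,
summed over `A`. -/
def oddBracket (F G : Loc m n Ω) : Loc m n Ω :=
  ∑ A : Idx d m n,
    (((-1 : ℝ) ^ (par A + 1)) • (pd (mom A) (twist (par A + 1) F) * pdPos A G)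
      - ((-1 : ℝ) ^ par A) • (pdPos A (twist (par A) F) * pd (mom A) G))

/-- Formal series in the momenta `(φ*, dφ*)`: a sequence `f` stands for `∑ f k`, where `f k` is the
component of momentum degree `k`. -/
abbrev Formal (m n : ℕ) {d : ℕ} (Ω : TopologicalSpace.Opens (Model d)) := ℕ → Loc m n Ω

/-- The series with the single component `f` in momentum degree `k`. -/
def single (k : ℕ) (f : Loc m n Ω) : Formal m n Ω := Pi.single k f

/-- The even bracket of formal series; it lowers the total momentum degree by one. -/
def evenBr (F G : Formal m n Ω) : Formal m n Ω := fun N =>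
  ∑ k ∈ Finset.HasAntidiagonal.antidiagonal (N + 1), evenBracket (F k.1) (G k.2)

/-- The odd bracket of formal series; it lowers the total momentum degree by one. -/
def oddBr (F G : Formal m n Ω) : Formal m n Ω := fun N =>
  ∑ k ∈ Finset.HasAntidiagonal.antidiagonal (N + 1), oddBracket (F k.1) (G k.2)

/-- The odd function `Δ = (-1)^A dφ^A dφ*_A`, of momentum degree one. -/
def Delta : Formal m n Ω :=
  single 1 (∑ A : Idx d m n, ((-1 : ℝ) ^ par A) • (coord (vel A) * coord (covel A)))

/-- The lift `{Δ, S}` of a function on `𝓝` to `ΠT𝓝`. -/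
def lift (S : Formal m n Ω) : Formal m n Ω := evenBr Delta S

/-- Restriction of a series to `𝓛`: all components of positive momentum degree vanish there. -/
def restrictL (F : Formal m n Ω) : Loc m n Ω := restrict onL (F 0)

/-- `{H, θ}|_𝓛` -/
def unary (H : Formal m n Ω) (θ : Loc m n Ω) : Loc m n Ω :=
  restrictL (evenBr H (single 0 θ))

/-- `{{H, θ}, τ}|_𝓛` -/
def binary (H : Formal m n Ω) (θ τ : Loc m n Ω) : Loc m n Ω :=
  restrictL (evenBr (evenBr H (single 0 θ)) (single 0 τ))

end localCalculus

/-! ## Globalisation over a manifold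

`M` is covered by the patches indexed by its points `p`: the preferred chart at `p`, and the
preferred local trivialisations of `E` and `F` at `p`. -/

section globalObjects
variable {d m n : ℕ} {M : Type*} [TopologicalSpace M] [ChartedSpace (Model d) M]
  (E : M → Type*) [TopologicalSpace (Bundle.TotalSpace (Model m) E)]
  [∀ x, TopologicalSpace (E x)] [FiberBundle (Model m) E]
  (F : M → Type*) [TopologicalSpace (Bundle.TotalSpace (Model n) F)]
  [∀ x, TopologicalSpace (F x)] [FiberBundle (Model n) F]

/-- The points of `M` covered by the patch `p`. -/
def patchSource (p : M) : Set M :=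
  (chartAt (Model d) p).source ∩
    ((trivializationAt (Model m) E p).baseSet ∩ (trivializationAt (Model n) F p).baseSet)

/-- The coordinate domain of the patch `p`. -/
def patch (p : M) : TopologicalSpace.Opens (Model d) where
  carrier := (chartAt (Model d) p).target ∩ (chartAt (Model d) p).symm ⁻¹'
    ((trivializationAt (Model m) E p).baseSet ∩ (trivializationAt (Model n) F p).baseSet)
  is_open' := (chartAt (Model d) p).isOpen_inter_preimage_symm
    ((trivializationAt (Model m) E p).open_baseSet.inter
      (trivializationAt (Model n) F p).open_baseSet)

/-- The coordinates in the patch `p` of a point of `M` covered by it. -/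
def toPatch (p : M) (x : patchSource (d := d) (m := m) (n := n) E F p) :
    patch (d := d) (m := m) (n := n) E F p :=
  ⟨chartAt (Model d) p x.1, (chartAt (Model d) p).map_source x.2.1, by
    simpa [(chartAt (Model d) p).left_inv x.2.1] using x.2.2⟩

/-- `∂x_q^j/∂x_p^i` at `x`. -/
def jac (p q : M) (x : M) (j i : Fin d) : ℝ :=
  fderiv ℝ (fun y => chartAt (Model d) q ((chartAt (Model d) p).symm y))
    (chartAt (Model d) p x) (EuclideanSpace.single i 1) j

variable [∀ x, AddCommGroup (E x)] [∀ x, Module ℝ (E x)] [VectorBundle ℝ (Model m) E]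
  [∀ x, AddCommGroup (F x)] [∀ x, Module ℝ (F x)] [VectorBundle ℝ (Model n) F]

/-- The transition matrix `g` of `E ⊕ F` at `x`, for which `z_q^b = ∑ g^b_a z_p^a`. -/
def trans (p q : M) (x : M) : FibIdx m n → FibIdx m n → ℝ
  | .inl b, .inl a => (trivializationAt (Model m) E p).coordChangeL ℝ
      (trivializationAt (Model m) E q) x (EuclideanSpace.single a 1) b
  | .inr b, .inr a => (trivializationAt (Model n) F p).coordChangeL ℝ
      (trivializationAt (Model n) F q) x (EuclideanSpace.single a 1) b
  | _, _ => 0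

/-- `∂g^b_a/∂x_p^i` at `x`, for the transition matrix `g = trans p q`. -/
def dtrans (p q : M) (x : M) (i : Fin d) (b a : FibIdx m n) : ℝ :=
  fderiv ℝ (fun y => trans E F p q ((chartAt (Model d) p).symm y) b a)
    (chartAt (Model d) p x) (EuclideanSpace.single i 1)

/-- `Θ` expresses the coordinates of `𝓝` and of `ΠT𝓜` in the patch `q` through those in the patch
`p`, over the point `x`.  The momenta transform by `φ*_B' = (∂φ^A/∂φ^B') φ*_A`, and the `dφ^A` in
such a way that the vector field `(-1)^A dφ^A ∂/∂φ^A` does not depend on the coordinates. -/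
structure IsCoordChange (p q : M) (x : M) (Θ : Fib d m n →ₐ[ℝ] Fib d m n) : Prop where
  fib : ∀ b, Θ (gen (fib b)) = ∑ a, trans E F p q x b a • gen (WeakKoszul.fib a)
  fibMom : ∀ b, Θ (gen (mom (.inr b))) = ∑ a, trans E F q p x a b • gen (mom (.inr a))
  baseMom : ∀ j, Θ (gen (mom (.inl j))) =
    ∑ i, jac q p x i j • gen (mom (.inl i))
      + ∑ a, ∑ b, ∑ c, (dtrans (d := d) E F q p x j a b * trans E F p q x b c) •
          (gen (WeakKoszul.fib c) * gen (mom (.inr a)))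
  baseVel : ∀ j, Θ (gen (vel (.inl j))) = ∑ i, jac p q x j i • gen (vel (.inl i))
  fibVel : ∀ b, Θ (gen (vel (.inr b))) =
    ∑ a, trans E F p q x b a • gen (vel (.inr a))
      - ∑ i, ∑ a, dtrans (d := d) E F p q x i b a •
          (gen (vel (.inl i)) * gen (WeakKoszul.fib a))

/-- Families of local expressions, one for each patch. -/
abbrev Fam (d m n : ℕ) {M : Type*} [TopologicalSpace M] [ChartedSpace (Model d) M]
    (E : M → Type*) [TopologicalSpace (Bundle.TotalSpace (Model m) E)]
    [∀ x, TopologicalSpace (E x)] [FiberBundle (Model m) E]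
    (F : M → Type*) [TopologicalSpace (Bundle.TotalSpace (Model n) F)]
    [∀ x, TopologicalSpace (F x)] [FiberBundle (Model n) F] :=
  ∀ p : M, Loc m n (patch (d := d) (m := m) (n := n) E F p)

/-- Families of local formal series in the momenta. -/
abbrev FormalFam (d m n : ℕ) {M : Type*} [TopologicalSpace M] [ChartedSpace (Model d) M]
    (E : M → Type*) [TopologicalSpace (Bundle.TotalSpace (Model m) E)]
    [∀ x, TopologicalSpace (E x)] [FiberBundle (Model m) E]
    (F : M → Type*) [TopologicalSpace (Bundle.TotalSpace (Model n) F)]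
    [∀ x, TopologicalSpace (F x)] [FiberBundle (Model n) F] :=
  ∀ p : M, Formal m n (patch (d := d) (m := m) (n := n) E F p)

variable {E F}

/-- The local expressions agree on overlaps. -/
def IsCompatible (f : Fam d m n E F) : Prop :=
  ∀ (p q x : M) (hp : x ∈ patchSource (d := d) (m := m) (n := n) E F p)
    (hq : x ∈ patchSource (d := d) (m := m) (n := n) E F q),
    ∃ Θ : Fib d m n →ₐ[ℝ] Fib d m n, IsCoordChange E F p q x Θ ∧
      evalAt (toPatch E F p ⟨x, hp⟩) (f p) = Θ (evalAt (toPatch E F q ⟨x, hq⟩) (f q))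

/-- `S = ∑ S^k` is a function on `𝓝`, where `S^k` has momentum degree `k`. -/
structure IsFunctionOnN (S : FormalFam d m n E F) : Prop where
  compatible : ∀ k, IsCompatible fun p => S p k
  momDegree : ∀ (p : M) (k : ℕ), IsHomog momWt k (S p k)
  noVel : ∀ p k A, pd (vel A) (S p k) = 0
  noCovel : ∀ p k A, pd (covel A) (S p k) = 0

/-- `θ` is a function on `𝓛 ≅ ΠT𝓜` of form degree `k` and ghost number `l`. -/
structure IsForm (k l : ℤ) (θ : Fam d m n E F) : Prop where
  compatible : IsCompatible θ
  noMom : ∀ p A, pd (mom A) (θ p) = 0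
  noCovel : ∀ p A, pd (covel A) (θ p) = 0
  formDegree : ∀ p, IsHomog formWt k (θ p)
  ghost : ∀ p, HasGhost l (θ p)

/-- The homological vector field `Q̂ = {Ψ, -}|_𝓛`, with `Ψ = {Δ, S}`. -/
def Qhat (S : FormalFam d m n E F) (θ : Fam d m n E F) : Fam d m n E F :=
  fun p => unary (lift (S p)) (θ p)

/-- The binary Koszul bracket `[θ, τ] = {{Ψ, θ}, τ}|_𝓛`, with `Ψ = {Δ, S}`. -/
def koszul (S : FormalFam d m n E F) (θ τ : Fam d m n E F) : Fam d m n E F :=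
  fun p => binary (lift (S p)) (θ p) (τ p)

/-- Restriction to `ΠTM` of functions on `𝓛`. A form on `M` is identified with its pull-back to
`𝓜`. -/
def restrictTM (θ : Fam d m n E F) : Fam d m n E F := fun p => restrict onTM (θ p)

/-- The weak Koszul bracket of forms on `M`: the restriction to `ΠTM` of the binary bracket. -/
def weakKoszul (S : FormalFam d m n E F) (θ τ : Fam d m n E F) : Fam d m n E F :=
  restrictTM (koszul S θ τ)

/-- The evolution `θ̇ = {Γ, θ}|_𝓛`, with `Γ = {Δ, V}`. -/
def evolution (V : FormalFam d m n E F) (θ : Fam d m n E F) : Fam d m n E F :=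
  fun p => unary (lift (V p)) (θ p)

/-- The Lie derivative `𝓛_V θ = (-1)^V θ̇` along the odd function `V`. -/
def lieDeriv (V : FormalFam d m n E F) (θ : Fam d m n E F) : Fam d m n E F :=
  fun p => -evolution V θ p

/-- `θ`, of form degree `k` and ghost number `l`, vanishes in `Q̂`-cohomology. -/
def IsExact (S : FormalFam d m n E F) (k l : ℤ) (θ : Fam d m n E F) : Prop :=
  ∃ τ : Fam d m n E F, IsForm k (l - 1) τ ∧ θ = Qhat S τ

/-- `θt` exhibits the `k`-form `θ` on `M` as projectible: it is an extension of `θ` to `𝓛`, of the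
form degree `k` and ghost number `-k` of a `k`-form on `M`, and a `Q̂`-cocycle. -/
structure IsProjectible (S : FormalFam d m n E F) (k : ℤ) (θ θt : Fam d m n E F) : Prop where
  isForm : IsForm k (-k) θt
  extends_form : restrictTM θt = θ
  cocycle : ∀ p, Qhat S θt p = 0

/-- The components `T^a` at `x` of a section of `E`, in the patch `p`. -/
def sectionComp (T : ∀ x, E x) (p x : M) (a : Fin m) : ℝ :=
  (trivializationAt (Model m) E p ⟨x, T x⟩).2 a

/-- The section of `F` over the patch `p` dual to the fibre coordinate `c^α`, at `x`. -/
def frame (p x : M) (α : Fin n) : F x :=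
  (trivializationAt (Model n) F p).symm x (EuclideanSpace.single α 1)

/-- The differential `dx^i` at `x` of a coordinate of the patch `p`. -/
def coordDiff (p x : M) (i : Fin d) : TangentSpace 𝓘(ℝ, Model d) x →L[ℝ] ℝ :=
  (EuclideanSpace.proj i : Model d →L[ℝ] ℝ).comp
    (mfderiv 𝓘(ℝ, Model d) 𝓘(ℝ, Model d) (chartAt (Model d) p) x)

/-- The components at `x` of a tangent vector, in the coordinates of the patch `p`. -/
def tangentComp (p x : M) (v : TangentSpace 𝓘(ℝ, Model d) x) (i : Fin d) : ℝ :=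
  coordDiff p x i v

/-- The components `R^i_α` at `x` of a bundle map `R : F → TM`, in the patch `p`. -/
def gaugeComp (R : ∀ x, F x →ₗ[ℝ] TangentSpace 𝓘(ℝ, Model d) x) (p x : M) (α : Fin n)
    (i : Fin d) : ℝ :=
  tangentComp p x (R x (frame p x α)) i

/-- `S` is a master function for the section `T` of `E`, the bundle map `R : F → TM` and the
bivector field `P` on `M`: a function on `𝓝`, even, of ghost number `2` and positive momentum
degree, with `(S, S) = 0` and
`S = T^a η*_a + c^α R^i_α x*_i + P^{ij} x*_j x*_i + (terms of positive resolution degree)`.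
(Ghost number `2` leaves no room for terms of resolution degree zero and momentum degree `≥ 3`;
the last two conditions make `T`, `R`, `P` smooth.) -/
structure IsMasterFunction (T : ∀ x, E x) (R : ∀ x, F x →ₗ[ℝ] TangentSpace 𝓘(ℝ, Model d) x)
    (P : ∀ x : M, (TangentSpace 𝓘(ℝ, Model d) x →L[ℝ] ℝ) →ₗ[ℝ]
      (TangentSpace 𝓘(ℝ, Model d) x →L[ℝ] ℝ) →ₗ[ℝ] ℝ)
    (S : FormalFam d m n E F) : Prop where
  isFunction : IsFunctionOnN S
  posDegree : ∀ p, S p 0 = 0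
  ghost : ∀ p k, HasGhost 2 (S p k)
  master : ∀ p, oddBr (S p) (S p) = 0
  boundary_one : ∀ (p x : M) (hx : x ∈ patchSource (d := d) (m := m) (n := n) E F p),
    evalAt (toPatch E F p ⟨x, hx⟩) (restrict resZero (S p 1)) =
      ∑ a, sectionComp T p x a • gen (mom (.inr (.inl a)))
        + ∑ α, ∑ i, gaugeComp R p x α i • (gen (WeakKoszul.fib (.inr α)) * gen (mom (.inl i)))
  boundary_two : ∀ (p x : M) (hx : x ∈ patchSource (d := d) (m := m) (n := n) E F p),
    evalAt (toPatch E F p ⟨x, hx⟩) (restrict resZero (S p 2)) =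
      ∑ i, ∑ j, P x (coordDiff p x i) (coordDiff p x j) •
        (gen (mom (.inl j)) * gen (mom (.inl i)))

/-- `V` is the function on `𝓝` attached to a projectible, weakly Poisson vector field `X` on `M`:
odd, of ghost number `1` and positive momentum degree, with `(S, V) = 0` and
`V = X^i x*_i + (terms of positive resolution degree)`. -/
structure IsEvolution (S : FormalFam d m n E F) (X : ∀ x : M, TangentSpace 𝓘(ℝ, Model d) x)
    (V : FormalFam d m n E F) : Prop where
  isFunction : IsFunctionOnN V
  posDegree : ∀ p, V p 0 = 0
  ghost : ∀ p k, HasGhost 1 (V p k)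
  master : ∀ p, oddBr (S p) (V p) = 0
  boundary : ∀ (p x : M) (hx : x ∈ patchSource (d := d) (m := m) (n := n) E F p),
    evalAt (toPatch E F p ⟨x, hx⟩) (restrict resZero (V p 1)) =
      ∑ i, tangentComp p x (X x) i • gen (mom (.inl i))

/-- The derivative of the function `f` on `M` along the vector field with components `Y^i` in the
patch `p` lies in the ideal generated by the `T^a` in `C^∞` of the patch. -/
def DerivInIdeal (T : ∀ x, E x) (f : Fam d m n E F) (p : M) (Y : M → Fin d → ℝ) : Prop :=
  ∃ g : Fin m → Smooth (patch (d := d) (m := m) (n := n) E F p),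
    ∀ (x : M) (hx : x ∈ patchSource (d := d) (m := m) (n := n) E F p),
      ∑ i, Y x i • evalAt (toPatch E F p ⟨x, hx⟩) (pdPos (.inl i) (f p)) =
        (∑ a, sectionComp T p x a * (g a).1 (toPatch E F p ⟨x, hx⟩)) • (1 : Fib d m n)

/-- The function `f` on `M` is a physical observable: `R_α f ∈ ⟨T^a⟩`. -/
def IsObservable (T : ∀ x, E x) (R : ∀ x, F x →ₗ[ℝ] TangentSpace 𝓘(ℝ, Model d) x)
    (f : Fam d m n E F) : Prop :=
  ∀ (p : M) (α : Fin n), DerivInIdeal T f p fun x => gaugeComp R p x α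

/-- The function `f` on `M` is an integral of the motion along `X`: `X f ∈ ⟨T^a⟩`. -/
def IsIntegralOfMotion (T : ∀ x, E x) (X : ∀ x : M, TangentSpace 𝓘(ℝ, Model d) x)
    (f : Fam d m n E F) : Prop :=
  ∀ p : M, DerivInIdeal T f p fun x => tangentComp p x (X x)

end globalObjects

end WeakKoszul

end

noncomputable section

namespace WeakKoszul

/-! ## Supercommutative algebras with supercommuting derivations -/

/-! Write `Ψₖ = {Δ, Sᵏ}` and `Γₖ = {Δ, Vᵏ}`. Since `{Δ, Δ} = 0`, bracketing with `Δ` squares to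
zero, and the odd bracket on `𝓝` is a derived bracket: `{{Δ, f}, g} = ±(f, g)` (`br_br_canonDelta`).
Hence `{Δ, (f, g)} = -{{Δ, f}, {Δ, g}}` (`br_lift_lift`), and the components of momentum degree two
of `(S, S) = 0` and `(S, V) = 0` become `{Ψ₁, Ψ₂} = 0` and `{Ψ₁, Γ₂} + {Ψ₂, Γ₁} = 0`. Counting
momenta shows that on `𝓛` the differential `Q̂` is `{Ψ₁, ·}`, the evolution is `{Γ₁, ·}` and the
Koszul bracket is `{{Ψ₂, ·}, ·}`, so no other component of the two series matters.

The cohomological claims now follow from the Jacobi identity (`jacobi`). The first relation makes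
the Koszul bracket of cocycles a cocycle (`br_br_br_eq_zero`). The second says that the evolution is
a derivation of the Koszul bracket up to the homotopy `{{Γ₂, ·}, ·}`; if both arguments are cocycles
with exact evolution, this yields an explicit primitive for the evolution of their bracket
(`br_derivation`).

The restriction to `ΠTM` does not depend on the extensions: ghost number plus form degree is a
grading in which `θ̃` and `F̃` have weight zero, `dx` has weight zero and `η, c, dη, dc` do not, so
the derivatives along the latter vanish on `ΠTM` (`restrict_onTM_pd`). Ghost number also isolates
the leading terms on the zero section. The coefficient of `c^α` in `Q̂f̃ = 0` reads `R^i_α ∂_i f =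
-T^b ∂_{c^α}∂_{η^b} f̃`, and the constant term of `𝓛_V f̃ = Q̂τ` reads `X^i ∂_i f = T^b ∂_{η^b} τ`.

It remains to see that the new functions on `𝓛`, given patch by patch, agree on overlaps. By
`br_br_lift`, bracketing with a one-form and then with a function is the action of the function `{a,
θ}` on `𝓝`. This turns everything into contractions of momentum derivatives with `∂θ/∂dφ` or
`∂f/∂φ`. In both contractions the inhomogeneous terms, which come from differentiating the
transition matrices, cancel (`IsInverse.contraction`), by differentiating `g g⁻¹ = 1`. -/

/-- A supercommutative real algebra (with parity involution `σ`) with a family of supercommuting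
left derivations `D g` of parity `deg g`. -/
structure SuperCalc (A : Type*) [Ring A] [Algebra ℝ A] (G : Type*) where
  σ : A →ₐ[ℝ] A
  deg : G → ℕ
  D : G → A →ₗ[ℝ] A
  invol_invol : ∀ a, σ (σ a) = a
  -- Splitting `b` into even and odd halves states the sign rule for all elements at once, so that
  -- it can be checked by induction on generators.
  comm : ∀ a b, (2 : ℝ) • (a * b) = (b + σ b) * a + (b - σ b) * σ a
  leibniz : ∀ g a b, D g (a * b) = D g a * b + σ^[deg g] a * D g b
  D_comm : ∀ g h a, D g (D h a) = (-1 : ℝ) ^ (deg g * deg h) • D h (D g a)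
  invol_D : ∀ g a, σ (D g a) = (-1 : ℝ) ^ deg g • D g (σ a)

theorem neg_one_pow_congr_even {a b : ℕ} (h : Even a ↔ Even b) : (-1 : ℝ) ^ a = (-1) ^ b := by
  rcases Nat.even_or_odd a with ha | ha
  · rw [ha.neg_one_pow, (h.1 ha).neg_one_pow]
  · rw [ha.neg_one_pow, Odd.neg_one_pow]
    rw [← Nat.not_even_iff_odd] at ha ⊢
    tauto

theorem neg_one_pow_congr_odd {a b : ℕ} (h : Even a ↔ ¬ Even b) :
    (-1 : ℝ) ^ a = -(-1) ^ b := by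
  rw [neg_one_pow_congr_even (a := a) (b := b + 1) (by simp [h, Nat.even_add_one]), pow_succ]
  simp

theorem second_order_sign (k l g h : ℕ) :
    (-1 : ℝ) ^ (g * l) * (-1) ^ (k * (l + g)) * (-1) ^ (h * k) *
        ((-1) ^ ((l + g) * (k + h)) * (-1) ^ (h * g)) =
      (-1) ^ (k * l) * (-1) ^ (h * k) * (-1) ^ (l * (k + h)) * (-1) ^ (g * l) := by
  simp only [← pow_add]
  apply neg_one_pow_congr_even
  by_cases hk : Even k <;> by_cases hl : Even l <;> by_cases hg : Even g <;>
    by_cases hh : Even h <;> simp [Nat.even_add, hk, hl, hg, hh, Nat.even_mul]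

namespace SuperCalc
variable {A : Type*} [Ring A] [Algebra ℝ A] {G : Type*} (C : SuperCalc A G)

/-- `a` has parity `k`. -/
def IsPar (k : ℕ) (a : A) : Prop := C.σ a = (-1 : ℝ) ^ k • a

variable {C}

theorem IsPar.congr {k l : ℕ} {a : A} (h : C.IsPar k a) (hkl : Even k ↔ Even l) :
    C.IsPar l a := by
  rw [IsPar, ← neg_one_pow_congr_even hkl]; exact h

theorem IsPar.iterate {k : ℕ} {a : A} (h : C.IsPar k a) (j : ℕ) :
    C.σ^[j] a = (-1 : ℝ) ^ (j * k) • a := by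
  induction j with
  | zero => simp
  | succ j ih =>
    rw [Function.iterate_succ_apply', ih, map_smul, h, smul_smul, ← pow_add]
    congr 2; ring

theorem IsPar.smul {k : ℕ} {a : A} (h : C.IsPar k a) (r : ℝ) : C.IsPar k (r • a) := by
  rw [IsPar, map_smul, h, smul_comm]

theorem IsPar.add {k : ℕ} {a b : A} (ha : C.IsPar k a) (hb : C.IsPar k b) :
    C.IsPar k (a + b) := by
  rw [IsPar, map_add, ha, hb, smul_add]

theorem IsPar.zero {k : ℕ} : C.IsPar k (0 : A) := by simp [IsPar]

theorem IsPar.sum {ι : Type*} {s : Finset ι} {k : ℕ} {a : ι → A}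
    (h : ∀ i ∈ s, C.IsPar k (a i)) : C.IsPar k (∑ i ∈ s, a i) := by
  rw [IsPar, map_sum, Finset.smul_sum]
  exact Finset.sum_congr rfl h

theorem IsPar.mul {k l : ℕ} {a b : A} (ha : C.IsPar k a) (hb : C.IsPar l b) :
    C.IsPar (k + l) (a * b) := by
  rw [IsPar, map_mul, ha, hb, smul_mul_smul_comm, pow_add]

theorem IsPar.D {k : ℕ} {a : A} (h : C.IsPar k a) (g : G) : C.IsPar (k + C.deg g) (C.D g a) := by
  rw [IsPar, C.invol_D, h, map_smul, smul_smul, pow_add, mul_comm]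

theorem IsPar.mul_comm {k l : ℕ} {a b : A} (ha : C.IsPar k a) (hb : C.IsPar l b) :
    a * b = (-1 : ℝ) ^ (k * l) • (b * a) := by
  have h := C.comm a b
  rw [ha, hb] at h
  have h2 : (2 : ℝ) • (a * b) = (2 : ℝ) • ((-1 : ℝ) ^ (k * l) • (b * a)) := by
    rw [h]
    rcases Nat.even_or_odd l with hl | hl
    · rw [hl.neg_one_pow, (hl.mul_left k).neg_one_pow]; simp [two_smul, add_mul]
    · rcases Nat.even_or_odd k with hk | hk
      · rw [hl.neg_one_pow, hk.neg_one_pow, (hk.mul_right l).neg_one_pow]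
        simp [two_smul, add_mul]
      · rw [hl.neg_one_pow, hk.neg_one_pow, (hk.mul hl).neg_one_pow]
        simp [two_smul, add_mul]
  exact smul_right_injective A (two_ne_zero' ℝ) h2

theorem D_mul {k : ℕ} {a : A} (ha : C.IsPar k a) (g : G) (b : A) :
    C.D g (a * b) = C.D g a * b + (-1 : ℝ) ^ (C.deg g * k) • (a * C.D g b) := by
  rw [C.leibniz, ha.iterate, smul_mul_assoc]

variable (C)

theorem D_one (g : G) : C.D g 1 = 0 := by
  have h := D_mul (C := C) (k := 0) (a := 1) (by simp [IsPar]) g 1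
  simpa using h

/-- Identities linear in an argument need only be checked on homogeneous elements. -/
theorem exists_even_odd (a : A) : ∃ b c, C.IsPar 0 b ∧ C.IsPar 1 c ∧ a = b + c := by
  refine ⟨(1 / 2 : ℝ) • (a + C.σ a), (1 / 2 : ℝ) • (a - C.σ a), ?_, ?_, ?_⟩
  · simp [IsPar, C.invol_invol, add_comm]
  · rw [IsPar, map_smul, map_sub, C.invol_invol]; module
  · module

end SuperCalc

/-! ### Constant even Poisson brackets and the Jacobi identity -/

/-- The data of a constant even Poisson bracket: coordinates are paired by the involution `star`. -/
structure SuperPoisson (A : Type*) [Ring A] [Algebra ℝ A] (G : Type*) extends SuperCalc A G where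
  star : G → G
  κ : G → ℝ
  star_star : ∀ g, star (star g) = g
  deg_star : ∀ g, deg (star g) = deg g
  -- This sign is what makes the bracket graded skew.
  κ_star : ∀ g, κ (star g) = (-1 : ℝ) ^ (deg g + 1) * κ g

namespace SuperPoisson
variable {A : Type*} [Ring A] [Algebra ℝ A] {G : Type*} [Fintype G] (C : SuperPoisson A G)

/-- The even Poisson bracket. -/
def br (a b : A) : A := ∑ g, C.κ g • (C.D (C.star g) (C.σ^[C.deg g] a) * C.D g b)

theorem br_add_right (a b c : A) : C.br a (b + c) = C.br a b + C.br a c := by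
  simp [br, mul_add, Finset.sum_add_distrib]

theorem br_smul_right (r : ℝ) (a b : A) : C.br a (r • b) = r • C.br a b := by
  simp [br, Finset.smul_sum, smul_comm r]

omit [Fintype G] in
theorem iterate_linear (j : ℕ) (r : ℝ) (a b : A) :
    C.σ^[j] (r • a + b) = r • C.σ^[j] a + C.σ^[j] b := by
  induction j with
  | zero => simp
  | succ j ih => simp [Function.iterate_succ_apply', ih]

theorem br_linear_left (r : ℝ) (a b c : A) : C.br (r • a + b) c = r • C.br a c + C.br b c := by
  simp only [br, iterate_linear, map_add, map_smul, add_mul, smul_add, Finset.sum_add_distrib,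
    Finset.smul_sum, smul_mul_assoc]
  congr 1
  exact Finset.sum_congr rfl fun g _ => smul_comm _ _ _

theorem br_zero_left (c : A) : C.br 0 c = 0 := by
  have := C.br_linear_left 1 0 0 c
  simpa using this

theorem br_zero_right (c : A) : C.br c 0 = 0 := by simp [br]

theorem br_add_left (a b c : A) : C.br (a + b) c = C.br a c + C.br b c := by
  simpa using C.br_linear_left 1 a b c

theorem br_smul_left (r : ℝ) (a c : A) : C.br (r • a) c = r • C.br a c := by
  simpa [br_zero_left] using C.br_linear_left r a 0 c

theorem br_neg_left (a c : A) : C.br (-a) c = -C.br a c := by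
  simpa using C.br_smul_left (-1) a c

theorem br_neg_right (a c : A) : C.br a (-c) = -C.br a c := by
  simpa using C.br_smul_right (-1) a c

theorem br_sum_right {ι : Type*} (s : Finset ι) (a : A) (b : ι → A) :
    C.br a (∑ i ∈ s, b i) = ∑ i ∈ s, C.br a (b i) := by
  classical
  induction s using Finset.induction_on with
  | empty => simp [br_zero_right]
  | insert i s hi ih => rw [Finset.sum_insert hi, Finset.sum_insert hi, br_add_right, ih]

variable {C}

theorem br_eq {k : ℕ} {a : A} (ha : C.IsPar k a) (b : A) :
    C.br a b = ∑ g, (C.κ g * (-1 : ℝ) ^ (C.deg g * k)) • (C.D (C.star g) a * C.D g b) := by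
  refine Finset.sum_congr rfl fun g _ => ?_
  rw [ha.iterate, map_smul, smul_mul_assoc, smul_smul]

theorem IsPar.br {k l : ℕ} {a b : A} (ha : C.IsPar k a) (hb : C.IsPar l b) :
    C.IsPar (k + l) (C.br a b) := by
  rw [br_eq ha]
  refine SuperCalc.IsPar.sum fun g _ => .smul ?_ _
  refine ((ha.D _).mul (hb.D g)).congr ?_
  rw [C.deg_star]; simp only [Nat.even_add]; tauto

/-- Reindexing the sum by `star` exchanges the two factors; `κ_star` and supercommutativity account
for the sign. -/
theorem br_skew {k l : ℕ} {a b : A} (ha : C.IsPar k a) (hb : C.IsPar l b) :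
    C.br a b = -((-1 : ℝ) ^ (k * l) • C.br b a) := by
  rw [br_eq ha, br_eq hb, Finset.smul_sum, ← Finset.sum_neg_distrib]
  refine Fintype.sum_equiv ⟨C.star, C.star, C.star_star, C.star_star⟩ _ _ fun g => ?_
  dsimp only [Equiv.coe_fn_mk]
  rw [C.star_star, C.deg_star, C.κ_star, (ha.D _).mul_comm (hb.D g), smul_smul, smul_smul, ← neg_smul]
  congr 1
  rw [C.deg_star]
  have : (-1 : ℝ) ^ (C.deg g * k) * (-1) ^ ((k + C.deg g) * (l + C.deg g)) =
      (-1) ^ (k * l) * (-1) ^ (C.deg g) * (-1) ^ (C.deg g * l) := by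
    simp only [← pow_add]
    apply neg_one_pow_congr_even
    simp only [Nat.even_add, Nat.even_mul]; tauto
  rw [pow_succ]
  linear_combination (C.κ g) * this

/-- The coefficients `κ` are constants, so a coordinate derivation sees only the two arguments. -/
theorem D_br {k : ℕ} {a : A} (ha : C.IsPar k a) (h : G) (b : A) :
    C.D h (C.br a b) = C.br (C.D h a) b + (-1 : ℝ) ^ (C.deg h * k) • C.br a (C.D h b) := by
  rw [br_eq ha, br_eq ha, br_eq (ha.D h), Finset.smul_sum, map_sum, ← Finset.sum_add_distrib]
  refine Finset.sum_congr rfl fun g _ => ?_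
  rw [map_smul, SuperCalc.D_mul (ha.D _), C.D_comm h (C.star g), C.D_comm h g, C.deg_star, smul_add,
    smul_mul_assoc, mul_smul_comm, smul_smul, smul_smul, smul_smul, smul_smul]
  congr 2
  · rw [mul_assoc, ← pow_add]; congr 1
    apply neg_one_pow_congr_even
    simp only [Nat.even_add, Nat.even_mul]; tauto
  · have : (-1 : ℝ) ^ (C.deg h * (k + C.deg g)) * (-1) ^ (C.deg h * C.deg g) =
        (-1) ^ (C.deg h * k) := by
      simp only [← pow_add]
      apply neg_one_pow_congr_even
      simp only [Nat.even_add, Nat.even_mul]; tauto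
    linear_combination (C.κ g * (-1) ^ (C.deg g * k)) * this

/-- Each summand is a left derivation in the second slot, and moving its coefficient `D (star g) a`
past `b` produces the same total sign for every `g`. -/
theorem br_mul {k l : ℕ} {a b : A} (ha : C.IsPar k a) (hb : C.IsPar l b) (c : A) :
    C.br a (b * c) = C.br a b * c + (-1 : ℝ) ^ (k * l) • (b * C.br a c) := by
  rw [br_eq ha, br_eq ha, br_eq ha, Finset.mul_sum, Finset.smul_sum, Finset.sum_mul,
    ← Finset.sum_add_distrib]
  refine Finset.sum_congr rfl fun g _ => ?_
  rw [SuperCalc.D_mul hb, mul_add, mul_smul_comm, ← mul_assoc, ← mul_assoc,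
    (ha.D (C.star g)).mul_comm hb, mul_smul_comm, smul_mul_assoc, smul_mul_assoc, smul_add,
    smul_smul, smul_smul, smul_smul, mul_assoc b]
  congr 2
  rw [mul_assoc, mul_assoc, ← pow_add, ← pow_add, mul_left_comm, ← pow_add, C.deg_star]; congr 1
  apply neg_one_pow_congr_even
  simp only [Nat.even_add, Nat.even_mul]; tauto

/-- The part of `{a, {b, c}}` with two derivatives on `c` is graded symmetric in `a` and `b`,
because the derivations supercommute; it therefore drops out of the Jacobi identity. -/
theorem br_br_second_order {k l : ℕ} {a b : A} (ha : C.IsPar k a) (hb : C.IsPar l b) (c : A) :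
    ∑ h, (C.κ h * (-1 : ℝ) ^ (C.deg h * l)) • ((-1 : ℝ) ^ (k * (l + C.deg h)) •
        (C.D (C.star h) b * C.br a (C.D h c))) = (-1 : ℝ) ^ (k * l) •
      ∑ h, (C.κ h * (-1 : ℝ) ^ (C.deg h * k)) • ((-1 : ℝ) ^ (l * (k + C.deg h)) •
        (C.D (C.star h) a * C.br b (C.D h c))) := by
  simp only [br_eq ha, br_eq hb, Finset.mul_sum, Finset.smul_sum]
  rw [Finset.sum_comm]
  refine Finset.sum_congr rfl fun h _ => Finset.sum_congr rfl fun g _ => ?_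
  simp only [mul_smul_comm, ← mul_assoc, smul_smul]
  rw [(hb.D (C.star g)).mul_comm (ha.D (C.star h)), C.D_comm h g, smul_mul_smul_comm, smul_smul]
  congr 1
  rw [C.deg_star, C.deg_star]
  have := second_order_sign k l (C.deg g) (C.deg h)
  linear_combination (C.κ g * C.κ h) * this

/-- The outer bracket is expanded in each of the three terms. Only `a` and `b` need be homogeneous,
because no sign depends on the parity of `c`. -/
theorem jacobi {k l : ℕ} {a b : A} (ha : C.IsPar k a) (hb : C.IsPar l b) (c : A) :
    C.br a (C.br b c) = C.br (C.br a b) c + (-1 : ℝ) ^ (k * l) • C.br b (C.br a c) := by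
  have e1 : C.br a (C.br b c) =
      ∑ h, (C.κ h * (-1 : ℝ) ^ (C.deg h * l)) • (C.br a (C.D (C.star h) b) * C.D h c) +
      ∑ h, (C.κ h * (-1 : ℝ) ^ (C.deg h * l)) • ((-1 : ℝ) ^ (k * (l + C.deg h)) •
        (C.D (C.star h) b * C.br a (C.D h c))) := by
    conv_lhs => rw [br_eq hb, br_sum_right]
    rw [← Finset.sum_add_distrib]
    refine Finset.sum_congr rfl fun h _ => ?_
    rw [br_smul_right, br_mul ha (hb.D _), C.deg_star, smul_add]
  have e2 : C.br b (C.br a c) =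
      ∑ h, (C.κ h * (-1 : ℝ) ^ (C.deg h * k)) • (C.br b (C.D (C.star h) a) * C.D h c) +
      ∑ h, (C.κ h * (-1 : ℝ) ^ (C.deg h * k)) • ((-1 : ℝ) ^ (l * (k + C.deg h)) •
        (C.D (C.star h) a * C.br b (C.D h c))) := by
    conv_lhs => rw [br_eq ha, br_sum_right]
    rw [← Finset.sum_add_distrib]
    refine Finset.sum_congr rfl fun h _ => ?_
    rw [br_smul_right, br_mul hb (ha.D _), C.deg_star, smul_add]
  have e3 : C.br (C.br a b) c =
      ∑ h, (C.κ h * (-1 : ℝ) ^ (C.deg h * (k + l))) • (C.br (C.D (C.star h) a) b * C.D h c) +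
      ∑ h, (C.κ h * (-1 : ℝ) ^ (C.deg h * l)) • (C.br a (C.D (C.star h) b) * C.D h c) := by
    rw [br_eq (IsPar.br ha hb), ← Finset.sum_add_distrib]
    refine Finset.sum_congr rfl fun h _ => ?_
    rw [D_br ha, add_mul, smul_add, smul_mul_assoc, smul_smul, mul_assoc, ← pow_add, C.deg_star]
    congr 3
    apply neg_one_pow_congr_even
    simp only [Nat.even_add, Nat.even_mul]; tauto
  have e4 := br_br_second_order ha hb c
  have e5 : ∑ h, (C.κ h * (-1 : ℝ) ^ (C.deg h * (k + l))) • (C.br (C.D (C.star h) a) b * C.D h c) =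
      -((-1 : ℝ) ^ (k * l) •
        ∑ h, (C.κ h * (-1 : ℝ) ^ (C.deg h * k)) • (C.br b (C.D (C.star h) a) * C.D h c)) := by
    rw [Finset.smul_sum, ← Finset.sum_neg_distrib]
    refine Finset.sum_congr rfl fun h _ => ?_
    rw [br_skew (ha.D _) hb, ← neg_smul, smul_mul_assoc, smul_smul, smul_smul, ← neg_smul]
    congr 1
    have : (-1 : ℝ) ^ (C.deg h * (k + l)) * (-1) ^ ((k + C.deg h) * l) =
        (-1) ^ (k * l) * (-1) ^ (C.deg h * k) := by
      simp only [← pow_add]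
      apply neg_one_pow_congr_even
      simp only [Nat.even_add, Nat.even_mul]; tauto
    rw [C.deg_star]
    linear_combination (-C.κ h) * this
  -- Second derivatives of `c` match by `e4`. Of the first-order sums, those with a derivative of
  -- `b` inside the bracket agree in `e1` and `e3`, and those with a derivative of `a` cancel by
  -- `e5`.
  rw [e1, e2, e3, e4, e5, smul_add]
  abel

end SuperPoisson

/-! ## The exterior algebra and tensor products with commutative algebras -/

section exterior
variable {V : Type*} [AddCommGroup V] [Module ℝ V]
open CliffordAlgebra (contractLeft involute)

/-- Moving one odd generator through any element applies the parity involution; this is the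
generator step for supercommutativity. -/
theorem ι_mul_eq_involute_mul (v : V) (b : ExteriorAlgebra ℝ V) :
    ExteriorAlgebra.ι ℝ v * b = involute b * ExteriorAlgebra.ι ℝ v := by
  induction b using ExteriorAlgebra.induction with
  | algebraMap r => rw [AlgHom.commutes]; exact (Algebra.commutes r _).symm
  | ι w =>
    rw [CliffordAlgebra.involute_ι, neg_mul, eq_neg_iff_add_eq_zero]
    exact ExteriorAlgebra.ι_add_mul_swap v w
  | mul a b ha hb => rw [← mul_assoc, ha, mul_assoc, hb, map_mul, mul_assoc]
  | add a b ha hb => rw [mul_add, ha, hb, map_add, add_mul]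

theorem exterior_comm (a b : ExteriorAlgebra ℝ V) :
    (2 : ℝ) • (a * b) = (b + involute b) * a + (b - involute b) * involute a := by
  induction a using CliffordAlgebra.left_induction with
  | algebraMap r =>
    rw [AlgHom.commutes, ← add_mul, Algebra.commutes r b, ← smul_mul_assoc]
    congr 1
    rw [two_smul]; abel
  | add x y hx hy => rw [add_mul, smul_add, hx, hy, map_add, mul_add, mul_add]; abel
  | ι_mul x v hx =>
    have h := ι_mul_eq_involute_mul v
    rw [mul_assoc, ← mul_smul_comm, hx, mul_add, ← mul_assoc, ← mul_assoc, h, h, map_mul,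
      CliffordAlgebra.involute_ι]
    simp only [map_add, map_sub, CliffordAlgebra.involute_involute, mul_assoc, neg_mul, mul_neg]
    rw [add_comm (involute b) b, ← neg_sub b (involute b), neg_mul]

theorem contractLeft_mul (δ : Module.Dual ℝ V) (a b : ExteriorAlgebra ℝ V) :
    contractLeft (Q := (0 : QuadraticForm ℝ V)) δ (a * b) =
      contractLeft (Q := (0 : QuadraticForm ℝ V)) δ a * b +
        involute a * contractLeft (Q := (0 : QuadraticForm ℝ V)) δ b := by
  induction a using CliffordAlgebra.left_induction with
  | algebraMap r =>
    rw [CliffordAlgebra.contractLeft_algebraMap_mul, CliffordAlgebra.contractLeft_algebraMap,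
      zero_mul, zero_add, AlgHom.commutes]
  | add x y hx hy => rw [add_mul, map_add, hx, hy, map_add, map_add, add_mul, add_mul]; abel
  | ι_mul x v hx =>
    rw [mul_assoc, CliffordAlgebra.contractLeft_ι_mul, hx, CliffordAlgebra.contractLeft_ι_mul,
      map_mul, CliffordAlgebra.involute_ι, mul_add, sub_mul, smul_mul_assoc, neg_mul, neg_mul,
      mul_assoc, mul_assoc]
    abel

theorem involute_contractLeft (δ : Module.Dual ℝ V) (a : ExteriorAlgebra ℝ V) :
    involute (contractLeft (Q := (0 : QuadraticForm ℝ V)) δ a) =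
      -contractLeft (Q := (0 : QuadraticForm ℝ V)) δ (involute a) := by
  induction a using CliffordAlgebra.left_induction with
  | algebraMap r =>
    rw [AlgHom.commutes, CliffordAlgebra.contractLeft_algebraMap, map_zero, neg_zero]
  | add x y hx hy => simp only [map_add, hx, hy, neg_add]
  | ι_mul x v hx =>
    rw [map_mul involute, CliffordAlgebra.contractLeft_ι_mul, map_sub, map_mul involute, hx,
      CliffordAlgebra.involute_ι, neg_mul, neg_mul, map_neg, CliffordAlgebra.contractLeft_ι_mul,
      map_smul]
    simp

/-- Superdifferential calculus on an exterior algebra. -/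
def exteriorCalc (X : Type*) : SuperCalc (ExteriorAlgebra ℝ (X →₀ ℝ)) X where
  σ := involute
  deg _ := 1
  D g := contractLeft (Q := (0 : QuadraticForm ℝ (X →₀ ℝ))) (Finsupp.lapply g)
  invol_invol := CliffordAlgebra.involute_involute
  comm := exterior_comm
  leibniz g a b := contractLeft_mul _ a b
  D_comm g h a := by
    rw [CliffordAlgebra.contractLeft_comm]; simp
  invol_D g a := by rw [involute_contractLeft]; simp

end exterior

section tensor
variable {B A : Type*} [CommRing B] [Algebra ℝ B] [Ring A] [Algebra ℝ A] {I G : Type*}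

theorem tensor_map_iterate (σ : A →ₐ[ℝ] A) (k : ℕ) (b : B) (a : A) :
    (Algebra.TensorProduct.map (AlgHom.id ℝ B) σ)^[k] (b ⊗ₜ a) = b ⊗ₜ[ℝ] (σ^[k] a) := by
  induction k with
  | zero => rfl
  | succ k ih => rw [Function.iterate_succ_apply', ih, Function.iterate_succ_apply']; rfl

theorem algHom_iterate_add (σ : A →ₐ[ℝ] A) (k : ℕ) (a b : A) :
    σ^[k] (a + b) = σ^[k] a + σ^[k] b := by
  induction k with
  | zero => rfl
  | succ k ih => simp only [Function.iterate_succ_apply', ih, map_add]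

/-- Extension of scalars of a superdifferential calculus by a commutative algebra with commuting
derivations. -/
def SuperCalc.tensor (C : SuperCalc A G) (δ : I → B →ₗ[ℝ] B)
    (leib : ∀ i a b, δ i (a * b) = δ i a * b + a * δ i b)
    (comm : ∀ i j a, δ i (δ j a) = δ j (δ i a)) : SuperCalc (B ⊗[ℝ] A) (I ⊕ G) where
  σ := Algebra.TensorProduct.map (AlgHom.id ℝ B) C.σ
  deg := Sum.elim (fun _ => 0) C.deg
  D := Sum.elim (fun i => LinearMap.rTensor A (δ i)) fun g => LinearMap.lTensor B (C.D g)
  invol_invol x := by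
    induction x using TensorProduct.induction_on with
    | zero => simp
    | tmul b a => simp [C.invol_invol]
    | add x y hx hy => simp only [map_add, hx, hy]
  comm x y := by
    induction x using TensorProduct.induction_on with
    | zero => simp
    | add x x' hx hx' => simp only [add_mul, smul_add, hx, hx', map_add, mul_add]; abel
    | tmul b a =>
      induction y using TensorProduct.induction_on with
      | zero => simp
      | add y y' hy hy' => 
        simp only [add_mul, smul_add, hy, hy', map_add, mul_add, sub_mul]; abel
      | tmul b' a' =>
        simp only [Algebra.TensorProduct.tmul_mul_tmul, Algebra.TensorProduct.map_tmul,
          ← TensorProduct.tmul_smul, C.comm, add_mul, sub_mul, AlgHom.id_apply,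
          TensorProduct.tmul_add, TensorProduct.tmul_sub, mul_comm b b']
  leibniz g x y := by
    induction x using TensorProduct.induction_on with
    | zero => 
      have h : ∀ k, (Algebra.TensorProduct.map (AlgHom.id ℝ B) C.σ)^[k] 0 = 0 := fun k => by
        simpa only [zero_add, left_eq_add] using algHom_iterate_add (Algebra.TensorProduct.map (AlgHom.id ℝ B) C.σ) k 0 0
      simp [h]
    | add x x' hx hx' =>
      simp only [add_mul, algHom_iterate_add, hx, hx', map_add]; abel
    | tmul b a =>
      induction y using TensorProduct.induction_on with
      | zero => simp
      | add y y' hy hy' => simp only [hy, hy', map_add, mul_add]; abel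
      | tmul b' a' =>
        rw [tensor_map_iterate]
        cases g with
        | inl i => simp [leib, TensorProduct.add_tmul]
        | inr g => simp [C.leibniz, TensorProduct.tmul_add]
  D_comm g h x := by
    induction x using TensorProduct.induction_on with
    | zero => simp
    | add x y hx hy => simp only [map_add, hx, hy, smul_add]
    | tmul b a =>
      rcases g with i | g <;> rcases h with j | h
      · simp [comm i j]
      · simp
      · simp
      · simp [C.D_comm g h]
  invol_D g x := by
    induction x using TensorProduct.induction_on with
    | zero => simp
    | add x y hx hy => simp only [map_add, hx, hy, smul_add]
    | tmul b a => cases g <;> simp [C.invol_D]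

end tensor

/-! ### Partial derivatives on the base -/

section smooth
variable {d : ℕ} {Ω : TopologicalSpace.Opens (Model d)}

theorem baseDeriv_apply (i : Fin d) (f : Smooth Ω) (y : Ω) :
    (baseDeriv Ω i f).1 y = fderiv ℝ (extZero Ω f) y (EuclideanSpace.single i 1) := rfl

theorem baseDeriv_mul (i : Fin d) (f g : Smooth Ω) :
    baseDeriv Ω i (f * g) = baseDeriv Ω i f * g + f * baseDeriv Ω i g := by
  ext y
  have h : extZero Ω (f * g : Smooth Ω) =ᶠ[nhds y.1] extZero Ω f * extZero Ω g := by
    filter_upwards [Ω.isOpen.mem_nhds y.2] with z hz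
    simp [extZero_apply _ hz]
  have e : (baseDeriv Ω i f * g + f * baseDeriv Ω i g : Smooth Ω).1 y =
      (baseDeriv Ω i f).1 y * g.1 y + f.1 y * (baseDeriv Ω i g).1 y := rfl
  rw [baseDeriv_apply, e, h.fderiv_eq, fderiv_mul
    (smooth_differentiableAt f y) (smooth_differentiableAt g y)]
  simp [extZero_apply _ y.2, baseDeriv_apply]
  ring

/-- Symmetry of the second derivative of a smooth function on an open set. -/
theorem baseDeriv_comm (i j : Fin d) (f : Smooth Ω) :
    baseDeriv Ω i (baseDeriv Ω j f) = baseDeriv Ω j (baseDeriv Ω i f) := by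
  have key : ∀ (i j : Fin d) (y : Ω), (baseDeriv Ω i (baseDeriv Ω j f)).1 y =
      fderiv ℝ (fderiv ℝ (extZero Ω f)) y (EuclideanSpace.single i 1)
        (EuclideanSpace.single j 1) := by
    intro i j y
    have h : extZero Ω (baseDeriv Ω j f) =ᶠ[nhds y.1]
        fun z => fderiv ℝ (extZero Ω f) z (EuclideanSpace.single j 1) := by
      filter_upwards [Ω.isOpen.mem_nhds y.2] with z hz
      rw [extZero_apply _ hz, baseDeriv_apply]
    have h2 : DifferentiableAt ℝ (fderiv ℝ (extZero Ω f)) y :=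
      (((smooth_contDiffOn f).fderiv_of_isOpen (m := ∞) Ω.isOpen (by simp)).differentiableOn
        (by simp)).differentiableAt (Ω.isOpen.mem_nhds y.2)
    rw [baseDeriv_apply, h.fderiv_eq, fderiv_clm_apply h2 (differentiableAt_const _)]
    simp
  ext y
  rw [key, key]
  exact (((smooth_contDiffOn f).contDiffAt (Ω.isOpen.mem_nhds y.2)).isSymmSndFDerivAt
    (by simpa using WithTop.coe_le_coe.2 (le_top (a := (2 : ℕ∞))))).eq _ _

end smooth

/-! ## Calculus on `ΠT𝓝` -/

section calculus
variable {d m n : ℕ} {Ω : TopologicalSpace.Opens (Model d)}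

instance : AddCommGroup (Loc m n Ω) := inferInstance

instance : Ring (Loc m n Ω) := inferInstance

instance : SubtractionMonoid (Loc m n Ω) :=
  (inferInstance : SubtractionCommMonoid (Loc m n Ω)).toSubtractionMonoid

instance : AddCommGroup (Fib d m n) := inferInstance

instance : Ring (Fib d m n) := inferInstance

/-- Parity of the coordinates of `ΠT𝓝` other than `x^i`. -/
def gpar : FibGen d m n → ℕ := Sum.elim (fun _ => 0) fun _ => 1

theorem pderiv_comm {X : Type*} (g h : X) (a : MvPolynomial X ℝ) :
    MvPolynomial.pderiv g (MvPolynomial.pderiv h a) =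
      MvPolynomial.pderiv h (MvPolynomial.pderiv g a) := by
  classical
  induction a using MvPolynomial.induction_on with
  | C r => simp
  | add p q hp hq => simp only [map_add, hp, hq]
  | mul_X p x hp =>
    simp only [MvPolynomial.pderiv_mul, MvPolynomial.pderiv_X, map_add, hp, Pi.single_apply]
    split_ifs <;> simp [add_right_comm]

variable (d m n) in
/-- Superdifferential calculus on the fibre polynomials. -/
def fibCalc : SuperCalc (Fib d m n) (FibGen d m n) :=
  (exteriorCalc (OddGen d m n)).tensor (fun g => (MvPolynomial.pderiv g).toLinearMap)
    (fun _ _ _ => MvPolynomial.pderiv_mul) pderiv_comm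

variable (m n Ω) in
/-- Superdifferential calculus on local functions on `ΠT𝓝`. -/
def locSuper : SuperCalc (Loc m n Ω) (Fin d ⊕ FibGen d m n) :=
  (fibCalc d m n).tensor (baseDeriv Ω) baseDeriv_mul baseDeriv_comm

theorem fibCalc_σ : (fibCalc d m n).σ = fibInvol := rfl

theorem fibCalc_deg (g : FibGen d m n) : (fibCalc d m n).deg g = gpar g := by cases g <;> rfl

theorem fibCalc_D (g : FibGen d m n) : (fibCalc d m n).D g = fibDeriv g := by cases g <;> rfl

theorem locSuper_D_inr (g : FibGen d m n) : (locSuper m n Ω).D (.inr g) = pd g := by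
  change LinearMap.lTensor _ ((fibCalc d m n).D g) = _
  rw [fibCalc_D]; rfl

/-- All coordinates of `ΠT𝓝`. -/
abbrev Coo (d m n : ℕ) := Fin d ⊕ FibGen d m n

/-- `φ^A` -/
def pos : Idx d m n → Coo d m n
  | .inl i => .inl i
  | .inr z => .inr (fib z)

/-- The four families of coordinates of `ΠT𝓝`. -/
def cooEquiv : (Idx d m n ⊕ Idx d m n) ⊕ (Idx d m n ⊕ Idx d m n) ≃ Coo d m n where
  toFun := Sum.elim (Sum.elim pos fun A => .inr (mom A))
    (Sum.elim (fun A => .inr (covel A)) fun A => .inr (vel A))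
  invFun
    | .inl i => .inl (.inl (.inl i))
    | .inr (.inr (.eta a)) => .inl (.inl (.inr (.inl a)))
    | .inr (.inr (.c a)) => .inl (.inl (.inr (.inr a)))
    | .inr (.inr (.xMom i)) => .inl (.inr (.inl i))
    | .inr (.inl (.etaMom a)) => .inl (.inr (.inr (.inl a)))
    | .inr (.inl (.cMom a)) => .inl (.inr (.inr (.inr a)))
    | .inr (.inl (.xCovel i)) => .inr (.inl (.inl i))
    | .inr (.inr (.etaCovel a)) => .inr (.inl (.inr (.inl a)))
    | .inr (.inr (.cCovel a)) => .inr (.inl (.inr (.inr a)))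
    | .inr (.inr (.xVel i)) => .inr (.inr (.inl i))
    | .inr (.inl (.etaVel a)) => .inr (.inr (.inr (.inl a)))
    | .inr (.inl (.cVel a)) => .inr (.inr (.inr (.inr a)))
  left_inv := by rintro ((( _ | _ | _) | ( _ | _ | _)) | (( _ | _ | _) | ( _ | _ | _))) <;> rfl
  right_inv := by rintro (_ | ((_ | _ | _ | _ | _) | (_ | _ | _ | _ | _ | _))) <;> rfl

theorem sum_coo {X : Type*} [AddCommMonoid X] (F : Coo d m n → X) :
    ∑ g, F g = (∑ A, F (pos A) + ∑ A, F (.inr (mom A))) +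
      (∑ A, F (.inr (covel A)) + ∑ A, F (.inr (vel A))) := by
  rw [← cooEquiv.sum_comp, Fintype.sum_sum_type,
    Fintype.sum_sum_type (α₁ := Idx d m n) (α₂ := Idx d m n),
    Fintype.sum_sum_type (α₁ := Idx d m n) (α₂ := Idx d m n)]
  rfl

variable (m n Ω) in
/-- The even Poisson structure on local functions on `ΠT𝓝`. -/
def locCalc : SuperPoisson (Loc m n Ω) (Coo d m n) where
  toSuperCalc := locSuper m n Ω
  star g := Sum.elim
    (Sum.elim (fun A => .inr (covel A)) fun A => .inr (vel A))
    (Sum.elim pos fun A => .inr (mom A)) (cooEquiv.symm g)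
  κ g := Sum.elim
    (Sum.elim (fun A => (-1) ^ par A) fun A => (-1) ^ par A)
    (Sum.elim (fun _ => -1) fun _ => 1) (cooEquiv.symm g)
  star_star := by rintro (_ | ((_ | _ | _ | _ | _) | (_ | _ | _ | _ | _ | _))) <;> rfl
  deg_star := by rintro (_ | ((_ | _ | _ | _ | _) | (_ | _ | _ | _ | _ | _))) <;> rfl
  κ_star := by
    rintro (_ | ((_ | _ | _ | _ | _) | (_ | _ | _ | _ | _ | _))) <;>
      simp [cooEquiv, covel, vel, mom, pos, par, locSuper, SuperCalc.tensor, fibCalc,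
        exteriorCalc, fib]

theorem locCalc_D_pos (A : Idx d m n) : (locCalc m n Ω).D (pos A) = pdPos A := by
  rcases A with i | z
  · rfl
  · exact locSuper_D_inr _

theorem locCalc_D_inr (g : FibGen d m n) : (locCalc m n Ω).D (.inr g) = pd g :=
  locSuper_D_inr _

theorem locCalc_deg_inr (g : FibGen d m n) : (locCalc m n Ω).deg (.inr g) = gpar g :=
  fibCalc_deg g

/-- `φ*_A` has parity `A + 1` modulo two, while the exponent in the bracket formula may be `2`; the
involution squares to the identity. -/
theorem twist_succ_eq (A : Idx d m n) (f : Loc m n Ω) :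
    twist (par A + 1) f = twist (if par A = 0 then 1 else 0) f := by
  rcases A with i | z
  · rfl
  · exact (locSuper m n Ω).invol_invol f

/-- The explicit bracket is the constant one that pairs `φ^A` with `dφ*_A` and `φ*_A` with `dφ^A`,
so the abstract Jacobi identity applies to it. -/
theorem evenBracket_eq_br (f g : Loc m n Ω) : evenBracket f g = (locCalc m n Ω).br f g := by
  have h1 : ∀ A : Idx d m n, (locCalc m n Ω).κ (pos A) •
      ((locCalc m n Ω).D ((locCalc m n Ω).star (pos A))
        ((locCalc m n Ω).σ^[(locCalc m n Ω).deg (pos A)] f) * (locCalc m n Ω).D (pos A) g) =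
      (-1 : ℝ) ^ par A • (pd (covel A) (twist (par A) f) * pdPos A g) := by
    rintro (i | z | z) <;> rw [locCalc_D_pos] <;> rfl
  have h2 : ∀ A : Idx d m n, (locCalc m n Ω).κ (.inr (mom A)) •
      ((locCalc m n Ω).D ((locCalc m n Ω).star (.inr (mom A)))
        ((locCalc m n Ω).σ^[(locCalc m n Ω).deg (.inr (mom A))] f) *
          (locCalc m n Ω).D (.inr (mom A)) g) =
      (-1 : ℝ) ^ par A • (pd (vel A) (twist (par A + 1) f) * pd (mom A) g) := by
    intro A
    rw [locCalc_D_inr, twist_succ_eq]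
    rcases A with i | z | z <;> rfl
  have h3 : ∀ A : Idx d m n, (locCalc m n Ω).κ (.inr (covel A)) •
      ((locCalc m n Ω).D ((locCalc m n Ω).star (.inr (covel A)))
        ((locCalc m n Ω).σ^[(locCalc m n Ω).deg (.inr (covel A))] f) *
          (locCalc m n Ω).D (.inr (covel A)) g) =
      -(pdPos A (twist (par A) f) * pd (covel A) g) := by
    intro A
    rw [locCalc_D_inr, ← neg_one_smul ℝ (pdPos A (twist (par A) f) * pd (covel A) g),
      ← locCalc_D_pos]
    rcases A with i | z | z <;> rfl
  have h4 : ∀ A : Idx d m n, (locCalc m n Ω).κ (.inr (vel A)) •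
      ((locCalc m n Ω).D ((locCalc m n Ω).star (.inr (vel A)))
        ((locCalc m n Ω).σ^[(locCalc m n Ω).deg (.inr (vel A))] f) *
          (locCalc m n Ω).D (.inr (vel A)) g) =
      pd (mom A) (twist (par A + 1) f) * pd (vel A) g := by
    intro A
    rw [locCalc_D_inr, twist_succ_eq]
    refine Eq.trans ?_ (one_smul ℝ _)
    rcases A with i | z | z <;> rfl
  rw [SuperPoisson.br, sum_coo, evenBracket]
  refine Eq.trans ?_ (congrArg₂ (· + ·)
    (congrArg₂ (· + ·) (Finset.sum_congr rfl fun A _ => (h1 A).symm)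
      (Finset.sum_congr rfl fun A _ => (h2 A).symm))
    (congrArg₂ (· + ·) (Finset.sum_congr rfl fun A _ => (h3 A).symm)
      (Finset.sum_congr rfl fun A _ => (h4 A).symm)))
  rw [← Finset.sum_add_distrib, ← Finset.sum_add_distrib, ← Finset.sum_add_distrib]
  refine Finset.sum_congr rfl fun A _ => ?_
  rw [smul_add, sub_sub_eq_add_sub]
  abel

end calculus

/-! ### Derivations and restrictions of fibre polynomials, computed on generators -/

section fibreCoordinates
variable {d m n : ℕ}

theorem fib_induction {p : Fib d m n → Prop} (smul_one : ∀ r : ℝ, p (algebraMap ℝ _ r))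
    (gen : ∀ g, p (gen g)) (mul : ∀ a b, p a → p b → p (a * b))
    (add : ∀ a b, p a → p b → p (a + b)) (w : Fib d m n) : p w := by
  induction w using TensorProduct.induction_on with
  | zero => simpa using smul_one 0
  | add a b ha hb => exact add _ _ ha hb
  | tmul a b =>
    have h1 : p (a ⊗ₜ 1) := by
      induction a using MvPolynomial.induction_on with
      | C r => exact smul_one r
      | add a b ha hb => rw [TensorProduct.add_tmul]; exact add _ _ ha hb
      | mul_X a g ha =>
        have := mul _ _ ha (gen (.inl g))
        simpa [WeakKoszul.gen] using this
    have h2 : p (1 ⊗ₜ b) := by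
      induction b using ExteriorAlgebra.induction with
      | algebraMap r =>
        have := smul_one r
        rwa [Algebra.TensorProduct.algebraMap_apply'] at this
      | add a b ha hb => rw [TensorProduct.tmul_add]; exact add _ _ ha hb
      | mul a b ha hb => simpa using mul _ _ ha hb
      | ι v =>
        induction v using Finsupp.induction_linear with
        | zero => simpa using smul_one 0
        | add v w hv hw => rw [map_add, TensorProduct.tmul_add]; exact add _ _ hv hw
        | single g r =>
          have := mul _ _ (smul_one r) (gen (.inr g))
          rw [← Algebra.smul_def] at this
          simpa [WeakKoszul.gen, ← TensorProduct.tmul_smul, ← map_smul] using this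
    simpa using mul _ _ h1 h2

theorem fib_algHom_ext {B : Type*} [Semiring B] [Algebra ℝ B] {Φ Θ : Fib d m n →ₐ[ℝ] B}
    (h : ∀ g, Φ (gen g) = Θ (gen g)) : Φ = Θ := by
  refine AlgHom.ext fun w => ?_
  induction w using fib_induction with
  | smul_one r => rw [AlgHom.commutes, AlgHom.commutes]
  | gen g => exact h g
  | mul a b ha hb => rw [map_mul, map_mul, ha, hb]
  | add a b ha hb => rw [map_add, map_add, ha, hb]

theorem fibDeriv_gen (g h : FibGen d m n) : fibDeriv g (gen h) = if g = h then 1 else 0 := by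
  rcases g with g | g <;> rcases h with h | h
  · simp only [fibDeriv, gen, LinearMap.rTensor_tmul, Derivation.coeFn_coe,
      MvPolynomial.pderiv_X, Sum.inl.injEq, Pi.single_apply]
    split_ifs with h1 h2 h2
    · rfl
    · exact absurd h1.symm h2
    · exact absurd h2.symm h1
    · simp
  · simp [fibDeriv, gen]
  · simp [fibDeriv, gen]
  · simp only [fibDeriv, gen, LinearMap.lTensor_tmul, Sum.inr.injEq]
    erw [CliffordAlgebra.contractLeft_ι]
    rw [Finsupp.lapply_apply, Finsupp.single_apply]
    split_ifs with h1 h2 h2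
    · simp; rfl
    · exact absurd h1.symm h2
    · exact absurd h2.symm h1
    · simp

theorem fibInvol_gen (g : FibGen d m n) : fibInvol (gen g) = (-1 : ℝ) ^ gpar g • gen g := by
  rcases g with g | g
  · simp [fibInvol, gen, gpar]
  · simp only [fibInvol, gen, Algebra.TensorProduct.map_tmul, gpar, Sum.elim_inr]
    erw [CliffordAlgebra.involute_ι]
    simp [TensorProduct.tmul_neg]

theorem fibRestrict_gen (keep : FibGen d m n → Bool) (g : FibGen d m n) :
    fibRestrict keep (gen g) = if keep g then gen g else 0 := by
  rcases g with g | g <;> simp only [fibRestrict, gen, Algebra.TensorProduct.map_tmul] <;>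
    split_ifs with h <;> simp [h, ExteriorAlgebra.map_apply_ι, Finsupp.linearCombination_single]

theorem fibDeriv_mul (g : FibGen d m n) (a b : Fib d m n) :
    fibDeriv g (a * b) = fibDeriv g a * b + fibInvol^[gpar g] a * fibDeriv g b := by
  have := (fibCalc d m n).leibniz g a b
  rwa [fibCalc_D, fibCalc_deg] at this

theorem fibDeriv_one (g : FibGen d m n) : fibDeriv g (1 : Fib d m n) = 0 := by
  rw [← fibCalc_D]; exact (fibCalc d m n).D_one g

theorem fibDeriv_algebraMap (g : FibGen d m n) (r : ℝ) :
    fibDeriv g (algebraMap ℝ (Fib d m n) r) = 0 := by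
  rw [Algebra.algebraMap_eq_smul_one, map_smul, fibDeriv_one, smul_zero]

theorem fibInvol_fibRestrict (keep : FibGen d m n → Bool) (a : Fib d m n) :
    fibInvol (fibRestrict keep a) = fibRestrict keep (fibInvol a) := by
  have : fibInvol.comp (fibRestrict keep) = (fibRestrict keep).comp (fibInvol (d := d)) :=
    fib_algHom_ext fun g => by
      simp only [AlgHom.comp_apply, fibRestrict_gen, fibInvol_gen, map_smul]
      split_ifs
      · rw [fibInvol_gen]
      · simp
  exact DFunLike.congr_fun this a

theorem iterate_comm_of_comm {X : Type*} {f r : X → X} (h : ∀ a, f (r a) = r (f a)) (k : ℕ)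
    (a : X) : f^[k] (r a) = r (f^[k] a) := by
  induction k with
  | zero => rfl
  | succ k ih => rw [Function.iterate_succ_apply', Function.iterate_succ_apply', ih, h]

/-- Setting other coordinates to zero commutes with a derivative; once `g` itself is set to zero
nothing depends on it. -/
theorem fibDeriv_fibRestrict (keep : FibGen d m n → Bool) (g : FibGen d m n) (a : Fib d m n) :
    fibDeriv g (fibRestrict keep a) = if keep g then fibRestrict keep (fibDeriv g a) else 0 := by
  induction a using fib_induction with
  | smul_one r => rw [AlgHom.commutes, fibDeriv_algebraMap, map_zero, ite_self]
  | gen h =>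
    rw [fibRestrict_gen, fibDeriv_gen]
    by_cases hg : keep g <;> by_cases hh : keep h <;> by_cases e : g = h <;>
      simp_all [fibDeriv_gen]
  | add a b ha hb => rw [map_add, map_add, ha, hb, map_add, map_add]; split_ifs <;> simp
  | mul a b ha hb =>
    rw [map_mul, fibDeriv_mul, ha, hb, iterate_comm_of_comm (fibInvol_fibRestrict keep),
      fibDeriv_mul]
    split_ifs <;> simp

theorem fibRestrict_fibRestrict (k l : FibGen d m n → Bool) (a : Fib d m n) :
    fibRestrict k (fibRestrict l a) = fibRestrict (fun g => k g && l g) a := by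
  have : (fibRestrict k).comp (fibRestrict l) = fibRestrict (d := d) fun g => k g && l g :=
    fib_algHom_ext fun g => by
      simp only [AlgHom.comp_apply, fibRestrict_gen]
      by_cases hl : l g <;> by_cases hk : k g <;> simp [hl, hk, fibRestrict_gen]
  exact DFunLike.congr_fun this a

end fibreCoordinates

/-! ### Local functions: coordinates, evaluation and gradings -/

section localCoordinates
variable {d m n : ℕ} {Ω : TopologicalSpace.Opens (Model d)}

theorem loc_induction {p : Loc m n Ω → Prop} (base : ∀ s : Smooth Ω, p (s ⊗ₜ 1))
    (coord : ∀ g, p (coord g)) (mul : ∀ a b, p a → p b → p (a * b))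
    (add : ∀ a b, p a → p b → p (a + b)) (f : Loc m n Ω) : p f := by
  induction f using TensorProduct.induction_on with
  | zero => simpa using base 0
  | add a b ha hb => exact add _ _ ha hb
  | tmul s w =>
    have h2 : p (1 ⊗ₜ w) := by
      induction w using fib_induction with
      | smul_one r =>
        have := base (algebraMap ℝ _ r)
        rw [Algebra.algebraMap_eq_smul_one, TensorProduct.smul_tmul] at this
        rwa [Algebra.algebraMap_eq_smul_one]
      | gen g => exact coord g
      | add a b ha hb => rw [TensorProduct.tmul_add]; exact add _ _ ha hb
      | mul a b ha hb => simpa using mul _ _ ha hb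
    simpa using mul _ _ (base s) h2

theorem pd_tmul (g : FibGen d m n) (s : Smooth Ω) (w : Fib d m n) :
    pd g (s ⊗ₜ w) = s ⊗ₜ fibDeriv g w := rfl

theorem pd_coord (g h : FibGen d m n) :
    pd g (coord h : Loc m n Ω) = if g = h then 1 else 0 := by
  rw [coord, pd_tmul, fibDeriv_gen]
  split_ifs
  · rfl
  · simp

theorem baseDeriv_one (i : Fin d) : baseDeriv Ω i 1 = 0 := by
  have := baseDeriv_mul i (1 : Smooth Ω) 1
  simpa using this

theorem pdPos_inl_tmul (i : Fin d) (s : Smooth Ω) (w : Fib d m n) :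
    pdPos (.inl i) (s ⊗ₜ[ℝ] w) = baseDeriv Ω i s ⊗ₜ w := rfl

theorem pdPos_inl_coord (i : Fin d) (g : FibGen d m n) :
    pdPos (.inl i) (coord g : Loc m n Ω) = 0 := by
  rw [coord, pdPos_inl_tmul, baseDeriv_one, TensorProduct.zero_tmul]

theorem invol_tmul (s : Smooth Ω) (w : Fib d m n) : invol (s ⊗ₜ[ℝ] w) = s ⊗ₜ fibInvol w := rfl

theorem restrict_tmul (keep : FibGen d m n → Bool) (s : Smooth Ω) (w : Fib d m n) :
    restrict keep (s ⊗ₜ[ℝ] w) = s ⊗ₜ fibRestrict keep w := rfl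

theorem isPar_coord (g : FibGen d m n) : (locCalc m n Ω).IsPar (gpar g) (coord g) := by
  change invol (coord g) = _
  rw [coord, invol_tmul, fibInvol_gen, TensorProduct.tmul_smul]

theorem restrict_coord (keep : FibGen d m n → Bool) (g : FibGen d m n) :
    restrict keep (coord g : Loc m n Ω) = if keep g then coord g else 0 := by
  rw [coord, restrict_tmul, fibRestrict_gen]
  split_ifs <;> simp

theorem pd_restrict (keep : FibGen d m n → Bool) (g : FibGen d m n) (f : Loc m n Ω) :
    pd g (restrict keep f) = if keep g then restrict keep (pd g f) else 0 := by
  induction f using TensorProduct.induction_on with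
  | zero => simp
  | add a b ha hb => rw [map_add, map_add, ha, hb, map_add, map_add]; split_ifs <;> simp
  | tmul s w =>
    rw [restrict_tmul, pd_tmul, pd_tmul, restrict_tmul, fibDeriv_fibRestrict]
    split_ifs <;> simp

theorem pdPos_inl_restrict (keep : FibGen d m n → Bool) (i : Fin d) (f : Loc m n Ω) :
    pdPos (.inl i) (restrict keep f) = restrict keep (pdPos (.inl i) f) := by
  induction f using TensorProduct.induction_on with
  | zero => simp
  | add a b ha hb => rw [map_add, map_add, ha, hb, map_add, map_add]
  | tmul s w => rw [restrict_tmul, pdPos_inl_tmul, pdPos_inl_tmul, restrict_tmul]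

theorem restrict_restrict (k l : FibGen d m n → Bool) (f : Loc m n Ω) :
    restrict k (restrict l f) = restrict (fun g => k g && l g) f := by
  induction f using TensorProduct.induction_on with
  | zero => simp
  | add a b ha hb => simp only [map_add, ha, hb]
  | tmul s w => rw [restrict_tmul, restrict_tmul, fibRestrict_fibRestrict, restrict_tmul]

/-! ### Evaluation at points of the base -/

theorem evalAt_tmul (y : Ω) (s : Smooth Ω) (w : Fib d m n) :
    evalAt y (s ⊗ₜ[ℝ] w) = s.1 y • w := rfl

theorem evalAt_mul (y : Ω) (f g : Loc m n Ω) : evalAt y (f * g) = evalAt y f * evalAt y g := by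
  induction f using TensorProduct.induction_on with
  | zero => simp
  | add a b ha hb => rw [add_mul, map_add, ha, hb, map_add, add_mul]
  | tmul s w =>
    induction g using TensorProduct.induction_on with
    | zero => simp
    | add a b ha hb => rw [mul_add, map_add, ha, hb, map_add, mul_add]
    | tmul t v =>
      rw [Algebra.TensorProduct.tmul_mul_tmul, evalAt_tmul, evalAt_tmul, evalAt_tmul,
        smul_mul_smul_comm]
      rfl

theorem evalAt_pd (y : Ω) (g : FibGen d m n) (f : Loc m n Ω) :
    evalAt y (pd g f) = fibDeriv g (evalAt y f) := by
  induction f using TensorProduct.induction_on with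
  | zero => simp
  | add a b ha hb => simp only [map_add, ha, hb]
  | tmul s w => rw [pd_tmul, evalAt_tmul, evalAt_tmul, map_smul]

theorem evalAt_invol (y : Ω) (f : Loc m n Ω) : evalAt y (invol f) = fibInvol (evalAt y f) := by
  induction f using TensorProduct.induction_on with
  | zero => simp
  | add a b ha hb => simp only [map_add, ha, hb]
  | tmul s w => rw [invol_tmul, evalAt_tmul, evalAt_tmul, map_smul]

theorem evalAt_restrict (y : Ω) (keep : FibGen d m n → Bool) (f : Loc m n Ω) :
    evalAt y (restrict keep f) = fibRestrict keep (evalAt y f) := by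
  induction f using TensorProduct.induction_on with
  | zero => simp
  | add a b ha hb => simp only [map_add, ha, hb]
  | tmul s w => rw [restrict_tmul, evalAt_tmul, evalAt_tmul, map_smul]

/-! ### Euler vector fields -/

/-- The Euler vector field with the weights `wt`. -/
def euler (wt : FibGen d m n → ℤ) : Loc m n Ω →ₗ[ℝ] Loc m n Ω where
  toFun f := ∑ g, (wt g : ℝ) • (coord g * pd g f)
  map_add' a b := by
    simp only [map_add, mul_add, smul_add, Finset.sum_add_distrib]
  map_smul' r a := by
    rw [RingHom.id_apply, Finset.smul_sum]
    refine Finset.sum_congr rfl fun g _ => ?_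
    rw [map_smul, mul_smul_comm, smul_comm]

theorem euler_apply (wt : FibGen d m n → ℤ) (f : Loc m n Ω) :
    euler wt f = ∑ g, (wt g : ℝ) • (coord g * pd g f) := rfl

theorem isHomog_iff {wt : FibGen d m n → ℤ} {l : ℤ} {f : Loc m n Ω} :
    IsHomog wt l f ↔ euler wt f = (l : ℝ) • f := Iff.rfl

theorem pd_mul (g : FibGen d m n) (a b : Loc m n Ω) :
    pd g (a * b) = pd g a * b + invol^[gpar g] a * pd g b := by
  have := (locCalc m n Ω).leibniz (.inr g) a b
  rwa [locCalc_D_inr, locCalc_deg_inr] at this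

theorem pdPos_inl_mul (i : Fin d) (a b : Loc m n Ω) :
    pdPos (.inl i) (a * b) = pdPos (.inl i) a * b + a * pdPos (.inl i) b :=
  (locCalc m n Ω).leibniz (.inl i) a b

/-- The sign from the Leibniz rule is exactly the one needed to commute the coordinate past `a`;
this makes the Euler field an even derivation. -/
theorem coord_mul_iterate (g : FibGen d m n) (a : Loc m n Ω) :
    coord g * invol^[gpar g] a = a * coord g := by
  obtain ⟨b, c, hb, hc, rfl⟩ := (locCalc m n Ω).exists_even_odd a
  change coord g * (locCalc m n Ω).σ^[gpar g] (b + c) = _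
  rw [algHom_iterate_add, hb.iterate, hc.iterate, mul_add, add_mul, mul_smul_comm, mul_smul_comm,
    hb.mul_comm (isPar_coord g), hc.mul_comm (isPar_coord g)]
  simp

theorem euler_mul (wt : FibGen d m n → ℤ) (a b : Loc m n Ω) :
    euler wt (a * b) = euler wt a * b + a * euler wt b := by
  simp only [euler_apply, Finset.sum_mul, Finset.mul_sum, ← Finset.sum_add_distrib]
  refine Finset.sum_congr rfl fun g _ => ?_
  rw [pd_mul, mul_add, ← mul_assoc, ← mul_assoc, coord_mul_iterate, smul_add, smul_mul_assoc,
    mul_smul_comm, mul_assoc a]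

theorem pd_comm (g h : FibGen d m n) (f : Loc m n Ω) :
    pd g (pd h f) = (-1 : ℝ) ^ (gpar g * gpar h) • pd h (pd g f) := by
  have := (locCalc m n Ω).D_comm (.inr g) (.inr h) f
  rwa [locCalc_D_inr, locCalc_D_inr, locCalc_deg_inr, locCalc_deg_inr] at this

theorem pdPos_inl_pd (i : Fin d) (g : FibGen d m n) (f : Loc m n Ω) :
    pdPos (.inl i) (pd g f) = pd g (pdPos (.inl i) f) := by
  have := (locCalc m n Ω).D_comm (.inl i) (.inr g) f
  rw [locCalc_D_inr] at this
  refine this.trans ?_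
  change (-1 : ℝ) ^ (0 * _) • pd g (pdPos (.inl i) f) = _
  simp

theorem pd_coord_mul (g h : FibGen d m n) (f : Loc m n Ω) :
    pd g (coord h * f) = (if g = h then f else 0) +
      (-1 : ℝ) ^ (gpar g * gpar h) • (coord h * pd g f) := by
  have := SuperCalc.D_mul (isPar_coord (Ω := Ω) h) (.inr g) f
  rw [locCalc_D_inr, locCalc_deg_inr, pd_coord] at this
  rw [this]
  split_ifs <;> simp

/-- The commutator of a coordinate derivative with the Euler field is the weight of that coordinate,
so differentiation lowers the degree by that weight. -/
theorem pd_euler (wt : FibGen d m n → ℤ) (h : FibGen d m n) (f : Loc m n Ω) :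
    pd h (euler wt f) = euler wt (pd h f) + (wt h : ℝ) • pd h f := by
  simp only [euler_apply, map_sum, map_smul, pd_coord_mul, smul_add, Finset.sum_add_distrib]
  rw [add_comm]
  congr 1
  · refine Finset.sum_congr rfl fun g _ => ?_
    rw [pd_comm g h, mul_smul_comm, mul_comm (gpar g)]
  · simp

theorem pdPos_inl_euler (wt : FibGen d m n → ℤ) (i : Fin d) (f : Loc m n Ω) :
    pdPos (.inl i) (euler wt f) = euler wt (pdPos (.inl i) f) := by
  simp only [euler_apply, map_sum, map_smul, pdPos_inl_mul, pdPos_inl_coord, zero_mul, zero_add,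
    pdPos_inl_pd]

namespace IsHomog
variable {wt : FibGen d m n → ℤ} {k l : ℤ} {f g : Loc m n Ω}

theorem add (hf : IsHomog wt k f) (hg : IsHomog wt k g) : IsHomog wt k (f + g) := by
  rw [isHomog_iff] at *
  rw [map_add, hf, hg, smul_add]

theorem smul (hf : IsHomog wt k f) (r : ℝ) : IsHomog wt k (r • f) := by
  rw [isHomog_iff] at *
  rw [map_smul, hf, smul_comm]

theorem neg (hf : IsHomog wt k f) : IsHomog wt k (-f) := by
  simpa using hf.smul (-1)

theorem sub (hf : IsHomog wt k f) (hg : IsHomog wt k g) : IsHomog wt k (f - g) := by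
  simpa [sub_eq_add_neg] using hf.add hg.neg

theorem sum {ι : Type*} {s : Finset ι} {f : ι → Loc m n Ω} (h : ∀ i ∈ s, IsHomog wt k (f i)) :
    IsHomog wt k (∑ i ∈ s, f i) := by
  rw [isHomog_iff, map_sum, Finset.smul_sum]
  exact Finset.sum_congr rfl fun i hi => isHomog_iff.1 (h i hi)

theorem mul (hf : IsHomog wt k f) (hg : IsHomog wt l g) : IsHomog wt (k + l) (f * g) := by
  rw [isHomog_iff] at *
  rw [euler_mul, hf, hg, smul_mul_assoc, mul_smul_comm, ← add_smul, Int.cast_add]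

theorem pd (hf : IsHomog wt k f) (h : FibGen d m n) : IsHomog wt (k - wt h) (pd h f) := by
  have := congrArg (WeakKoszul.pd h) (isHomog_iff.1 hf)
  rw [pd_euler, map_smul] at this
  rw [isHomog_iff, Int.cast_sub, sub_smul, ← this, add_sub_cancel_right]

theorem pdPos_inl (hf : IsHomog wt k f) (i : Fin d) : IsHomog wt k (pdPos (.inl i) f) := by
  have := congrArg (WeakKoszul.pdPos (.inl i)) (isHomog_iff.1 hf)
  rwa [pdPos_inl_euler, map_smul, ← isHomog_iff] at this

theorem congr (hf : IsHomog wt k f) (h : k = l) : IsHomog wt l f := h ▸ hf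

end IsHomog

theorem isHomog_coord (wt : FibGen d m n → ℤ) (g : FibGen d m n) :
    IsHomog wt (wt g) (coord g : Loc m n Ω) := by
  rw [isHomog_iff, euler_apply]
  simp [pd_coord]

/-- Every term of the Euler field either carries a coordinate that is set to zero or has weight
zero. Hence restricting `euler f = l f` leaves `0 = l f`. -/
theorem restrict_eq_zero_of_isHomog {wt : FibGen d m n → ℤ} {l : ℤ} {f : Loc m n Ω}
    {keep : FibGen d m n → Bool} (h : IsHomog wt l f) (hl : l ≠ 0)
    (hk : ∀ g, keep g → wt g = 0) : restrict keep f = 0 := by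
  have := congrArg (restrict keep) (isHomog_iff.1 h)
  rw [euler_apply, map_sum, map_smul, Finset.sum_eq_zero] at this
  · exact (smul_eq_zero.1 this.symm).resolve_left (by exact_mod_cast hl)
  · intro g _
    rw [map_smul, map_mul, restrict_coord]
    split_ifs with hg
    · rw [hk g hg]; simp
    · simp

/-- Nonnegative weights split local functions into homogeneous components. -/
theorem sup_eigenspaces_eq_top {wt : FibGen d m n → ℤ} (hwt : ∀ g, 0 ≤ wt g) :
    LinearMap.eqLocus (restrict (Ω := Ω) fun g => decide (wt g = 0)).toLinearMap LinearMap.id ⊔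
      ⨆ k : ℕ, Module.End.eigenspace (euler (Ω := Ω) wt) (k + 1) = ⊤ := by
  set N0 := LinearMap.eqLocus (restrict (Ω := Ω) fun g => decide (wt g = 0)).toLinearMap
    LinearMap.id with hN0
  set N := ⨆ k : ℕ, Module.End.eigenspace (euler (Ω := Ω) wt) (k + 1) with hN
  have mem0 : ∀ f, f ∈ N0 ↔ restrict (Ω := Ω) (fun g => decide (wt g = 0)) f = f :=
    fun f => Iff.rfl
  have memE : ∀ (k : ℕ) (f : Loc m n Ω), f ∈ Module.End.eigenspace (euler (Ω := Ω) wt) (k + 1) ↔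
      IsHomog wt (k + 1) f := fun k f => by
    rw [Module.End.mem_eigenspace_iff, isHomog_iff]; push_cast; rfl
  have hN0' : ∀ f ∈ N0, IsHomog wt 0 f := fun f hf => by
    rw [mem0] at hf
    rw [isHomog_iff, euler_apply, Finset.sum_eq_zero]
    · simp
    · intro g _
      rw [← hf, pd_restrict]
      split_ifs with hg
      · rw [of_decide_eq_true hg]; simp
      · simp
  have e0 : ∀ f ∈ N0, ∀ g ∈ N, f * g ∈ N ∧ g * f ∈ N := fun f hf g hg => by
    induction hg using Submodule.iSup_induction' with
    | zero => simp
    | add x y _ _ hx hy => 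
      rw [mul_add, add_mul]; exact ⟨N.add_mem hx.1 hy.1, N.add_mem hx.2 hy.2⟩
    | mem k x hx =>
      rw [memE] at hx
      exact ⟨Submodule.mem_iSup_of_mem k ((memE _ _).2 (((hN0' f hf).mul hx).congr (by ring))),
        Submodule.mem_iSup_of_mem k ((memE _ _).2 ((hx.mul (hN0' f hf)).congr (by ring)))⟩
  have e1 : ∀ f ∈ N, ∀ g ∈ N, f * g ∈ N := fun f hf g hg => by
    induction hg using Submodule.iSup_induction' with
    | zero => simp
    | add x y _ _ hx hy => rw [mul_add]; exact N.add_mem hx hy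
    | mem k x hx =>
      induction hf using Submodule.iSup_induction' with
      | zero => simp
      | add y z _ _ hy hz => rw [add_mul]; exact N.add_mem hy hz
      | mem j y hy =>
        rw [memE] at hx hy
        -- The index is one less than the weight, and the product has weight `(j + 1) + (k + 1)`.
        exact Submodule.mem_iSup_of_mem (j + k + 1)
          ((memE _ _).2 ((hy.mul hx).congr (by push_cast; ring)))
  rw [eq_top_iff]
  rintro f -
  induction f using loc_induction with
  | base s =>
    refine Submodule.mem_sup_left ((mem0 _).2 ?_)
    rw [restrict_tmul, map_one]
  | coord g =>
    by_cases hg : wt g = 0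
    · refine Submodule.mem_sup_left ((mem0 _).2 ?_)
      rw [restrict_coord]; simp [hg]
    · refine Submodule.mem_sup_right (Submodule.mem_iSup_of_mem (wt g - 1).toNat ((memE _ _).2 ?_))
      refine (isHomog_coord wt g).congr ?_
      have := hwt g
      omega
  | add a b ha hb => exact Submodule.add_mem _ ha hb
  | mul a b ha hb =>
    obtain ⟨a0, ha0, a1, ha1, rfl⟩ := Submodule.mem_sup.1 ha
    obtain ⟨b0, hb0, b1, hb1, rfl⟩ := Submodule.mem_sup.1 hb
    rw [add_mul, mul_add, mul_add]
    refine Submodule.add_mem _ (Submodule.add_mem _ (Submodule.mem_sup_left ?_) ?_)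
      (Submodule.mem_sup_right (N.add_mem ?_ (e1 _ ha1 _ hb1)))
    · rw [mem0] at *
      rw [map_mul, ha0, hb0]
    · exact Submodule.mem_sup_right (e0 _ ha0 _ hb1).1
    · exact (e0 _ hb0 _ ha1).2

/-- An element of weight zero has no component in the positive eigenspaces, since eigenspaces of the
Euler field are independent; what is left does not involve the coordinates of positive weight. -/
theorem restrict_eq_self_of_isHomog {wt : FibGen d m n → ℤ} (hwt : ∀ g, 0 ≤ wt g)
    {f : Loc m n Ω} (hf : IsHomog wt 0 f) :
    restrict (fun g => decide (wt g = 0)) f = f := by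
  have hmem : f ∈ (⊤ : Submodule ℝ (Loc m n Ω)) := trivial
  rw [← sup_eigenspaces_eq_top hwt] at hmem
  obtain ⟨f0, h0, f1, h1, rfl⟩ := Submodule.mem_sup.1 hmem
  have h0' : restrict (Ω := Ω) (fun g => decide (wt g = 0)) f0 = f0 := h0
  have hf0 : IsHomog wt 0 f0 := by
    rw [isHomog_iff, euler_apply, Finset.sum_eq_zero]
    · simp
    · intro g _
      rw [← h0', pd_restrict]
      split_ifs with hg
      · rw [of_decide_eq_true hg]; simp
      · simp
  have hf1 : IsHomog wt 0 f1 := by simpa using hf.sub hf0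
  have hd := Module.End.eigenspaces_iSupIndep (euler (Ω := Ω) wt) 0
  have : f1 = 0 := by
    have hle : (⨆ k : ℕ, Module.End.eigenspace (euler (Ω := Ω) wt) (k + 1)) ≤
        ⨆ j ≠ (0 : ℝ), Module.End.eigenspace (euler (Ω := Ω) wt) j :=
      iSup_le fun k => le_iSup₂_of_le ((k : ℝ) + 1) (Nat.cast_add_one_ne_zero k) le_rfl
    refine Submodule.disjoint_def.1 hd f1 ?_ (hle h1)
    rw [Module.End.mem_eigenspace_iff]
    exact (isHomog_iff.1 hf1).trans (by rw [Int.cast_zero])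
  rw [this, add_zero, h0']

/-- The weights `0, 1, 2, …` already exhaust the space, so a negative eigenvalue is independent of
everything. -/
theorem eq_zero_of_isHomog_neg {wt : FibGen d m n → ℤ} (hwt : ∀ g, 0 ≤ wt g) {l : ℤ}
    (hl : l < 0) {f : Loc m n Ω} (hf : IsHomog wt l f) : f = 0 := by
  have hmem : f ∈ (⊤ : Submodule ℝ (Loc m n Ω)) := trivial
  rw [← sup_eigenspaces_eq_top hwt] at hmem
  have hl' : (l : ℝ) < 0 := by exact_mod_cast hl
  have hd := Module.End.eigenspaces_iSupIndep (euler (Ω := Ω) wt) (l : ℝ)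
  have hle : LinearMap.eqLocus (restrict (Ω := Ω) fun g => decide (wt g = 0)).toLinearMap
      LinearMap.id ≤ ⨆ j ≠ (l : ℝ), Module.End.eigenspace (euler (Ω := Ω) wt) j := by
    refine le_iSup₂_of_le (0 : ℝ) hl'.ne' fun f0 h0 => ?_
    have h0' : restrict (Ω := Ω) (fun g => decide (wt g = 0)) f0 = f0 := h0
    rw [Module.End.mem_eigenspace_iff, euler_apply, Finset.sum_eq_zero]
    · simp
    · intro g _
      rw [← h0', pd_restrict]
      split_ifs with hg
      · rw [of_decide_eq_true hg]; simp
      · simp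
  have hle' : (⨆ k : ℕ, Module.End.eigenspace (euler (Ω := Ω) wt) (k + 1)) ≤
      ⨆ j ≠ (l : ℝ), Module.End.eigenspace (euler (Ω := Ω) wt) j :=
    iSup_le fun k => le_iSup₂_of_le ((k : ℝ) + 1)
      (by have := k.cast_nonneg (α := ℝ); intro h; linarith) le_rfl
  refine Submodule.disjoint_def.1 hd f ?_ (sup_le hle hle' hmem)
  rw [Module.End.mem_eigenspace_iff]
  exact isHomog_iff.1 hf

end localCoordinates

/-! ### Consequences of the Jacobi identity for derived brackets -/

namespace SuperPoisson
variable {A : Type*} [Ring A] [Algebra ℝ A] {G : Type*} [Fintype G] {C : SuperPoisson A G}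

/-- Derived brackets: `{Δ, {{Δ, a}, b}} = ± {{Δ, a}, {Δ, b}}` if `{Δ, Δ} = 0`. -/
theorem br_derived {Δ : A} (hΔ : C.IsPar 1 Δ) (hΔΔ : C.br Δ Δ = 0) {k : ℕ} {a : A}
    (ha : C.IsPar k a) (b : A) :
    C.br Δ (C.br (C.br Δ a) b) = (-1 : ℝ) ^ (k + 1) • C.br (C.br Δ a) (C.br Δ b) := by
  have hsq : C.br Δ (C.br Δ a) = 0 := by
    have := jacobi hΔ hΔ a
    rw [hΔΔ, br_zero_left, zero_add] at this
    simp only [mul_one, pow_one, neg_smul, one_smul] at this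
    have h2 : (2 : ℝ) • C.br Δ (C.br Δ a) = 0 := by
      rw [two_smul]; exact eq_neg_iff_add_eq_zero.1 this
    exact (smul_eq_zero.1 h2).resolve_left two_ne_zero
  rw [jacobi hΔ (IsPar.br hΔ ha), hsq, br_zero_left, zero_add, one_mul, add_comm 1 k]

/-- A binary derived bracket of cocycles is a cocycle. -/
theorem br_br_br_eq_zero {Ψ₁ Ψ₂ a b : A} {k : ℕ} (h₁ : C.IsPar 1 Ψ₁) (h₂ : C.IsPar 1 Ψ₂)
    (ha : C.IsPar k a) (h₁₂ : C.br Ψ₁ Ψ₂ = 0) (h₁a : C.br Ψ₁ a = 0) (h₁b : C.br Ψ₁ b = 0) :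
    C.br Ψ₁ (C.br (C.br Ψ₂ a) b) = 0 := by
  rw [jacobi h₁ (IsPar.br h₂ ha), jacobi h₁ h₂, h₁₂, h₁a, h₁b]
  simp [br_zero_left, br_zero_right]

/-- An even derivation that commutes with the differential and respects the bracket up to homotopy
maps the bracket of two cocycles with exact image to an exact element. -/
theorem br_derivation {Ψ₁ Ψ₂ Γ₁ Γ₂ a b σ ρ : A} (h₁ : C.IsPar 1 Ψ₁) (h₂ : C.IsPar 1 Ψ₂)
    (k₁ : C.IsPar 0 Γ₁) (k₂ : C.IsPar 0 Γ₂) (ha : C.IsPar 1 a) (hσ : C.IsPar 0 σ)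
    (h₁₂ : C.br Ψ₁ Ψ₂ = 0) (h₁₂' : C.br Ψ₁ Γ₂ + C.br Ψ₂ Γ₁ = 0)
    (h₁a : C.br Ψ₁ a = 0) (h₁b : C.br Ψ₁ b = 0)
    (haσ : C.br Γ₁ a = C.br Ψ₁ σ) (hbρ : C.br Γ₁ b = C.br Ψ₁ ρ) :
    C.br Γ₁ (C.br (C.br Ψ₂ a) b) =
      C.br Ψ₁ (C.br (C.br Γ₂ a) b - C.br (C.br Ψ₂ σ) b + C.br (C.br Ψ₂ a) ρ) := by
  -- The mixed master relation: `Ψ₂` fails to be `Γ₁`-invariant only by a `Ψ₁`-exact term, whose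
  -- primitive `Γ₂` supplies the homotopy.
  have e1 : C.br Γ₁ Ψ₂ = C.br Ψ₁ Γ₂ := by
    rw [br_skew k₁ h₂, eq_neg_of_add_eq_zero_left h₁₂']; simp
  have e2 : C.br (C.br Ψ₁ Γ₂) a = C.br Ψ₁ (C.br Γ₂ a) := by
    rw [jacobi h₁ k₂, h₁a, br_zero_right, smul_zero, add_zero]
  have e3 : C.br Ψ₂ (C.br Ψ₁ σ) = -C.br Ψ₁ (C.br Ψ₂ σ) := by
    rw [jacobi h₁ h₂, h₁₂, br_zero_left]; simp
  -- The differential can be taken out of the first slot because `b` is a cocycle.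
  have e4 : ∀ (k : ℕ) (x : A), C.IsPar k x → C.br (C.br Ψ₁ x) b = C.br Ψ₁ (C.br x b) :=
    fun k x hx => by rw [jacobi h₁ hx, h₁b, br_zero_right, smul_zero, add_zero]
  have e5 : C.br (C.br Ψ₂ a) (C.br Ψ₁ ρ) = C.br Ψ₁ (C.br (C.br Ψ₂ a) ρ) := by
    have h : C.br Ψ₁ (C.br Ψ₂ a) = 0 := by
      rw [jacobi h₁ h₂, h₁₂, h₁a, br_zero_left, br_zero_right]; simp
    rw [jacobi h₁ (IsPar.br h₂ ha), h, br_zero_left]; simp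
  rw [jacobi k₁ (IsPar.br h₂ ha), jacobi k₁ h₂, e1, e2, haσ, e3, hbρ, e5, br_add_left,
    e4 _ _ (IsPar.br k₂ ha), br_smul_left, br_neg_left, e4 _ _ (IsPar.br h₂ hσ), br_add_right,
    sub_eq_add_neg, br_add_right, br_neg_right]
  simp

end SuperPoisson

/-! ### Momentum degree, differential degree and ghost number -/

section gradings
variable {d m n : ℕ} {Ω : TopologicalSpace.Opens (Model d)}

/-- Total momentum degrees: `φ*_A` and `dφ*_A` have degree one. -/
def totalMomWt (g : FibGen d m n) : ℤ := if onL g then 0 else 1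

/-- Differential degrees: `dφ^A` and `dφ*_A` have degree one. -/
def diffWt : FibGen d m n → ℤ
  | .inl (.etaVel _) => 1
  | .inl (.cVel _) => 1
  | .inr (.xVel _) => 1
  | .inl (.xCovel _) => 1
  | .inr (.etaCovel _) => 1
  | .inr (.cCovel _) => 1
  | _ => 0

/-- The weight of a coordinate of `ΠT𝓝`; the `x^i` have weight zero. -/
def cooWt (wt : FibGen d m n → ℤ) : Coo d m n → ℤ := Sum.elim (fun _ => 0) wt

theorem IsHomog.D {wt : FibGen d m n → ℤ} {k : ℤ} {f : Loc m n Ω} (hf : IsHomog wt k f)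
    (g : Coo d m n) : IsHomog wt (k - cooWt wt g) ((locCalc m n Ω).D g f) := by
  rcases g with i | g
  · exact (hf.pdPos_inl i).congr (by simp [cooWt])
  · rw [locCalc_D_inr]; exact hf.pd g

theorem IsHomog.br {wt : FibGen d m n → ℤ} {s : ℤ}
    (hs : ∀ g, cooWt wt ((locCalc m n Ω).star g) + cooWt wt g = s) {j : ℕ} {k l : ℤ}
    {f g : Loc m n Ω} (hj : (locCalc m n Ω).IsPar j f) (hf : IsHomog wt k f)
    (hg : IsHomog wt l g) : IsHomog wt (k + l - s) ((locCalc m n Ω).br f g) := by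
  rw [SuperPoisson.br_eq hj]
  refine IsHomog.sum fun c _ => .smul (.congr ((hf.D _).mul (hg.D c)) ?_) _
  rw [← hs c]; ring

theorem neg_one_zpow_eq (l : ℤ) : (-1 : ℝ) ^ l = (-1 : ℝ) ^ l.natAbs := by
  cases l with
  | ofNat k => simp
  | negSucc k => rw [zpow_negSucc]; simp [← inv_pow, inv_neg]

theorem hasGhost_iff {l : ℤ} {f : Loc m n Ω} :
    HasGhost l f ↔ IsHomog ghostWt l f ∧ (locCalc m n Ω).IsPar l.natAbs f := by
  rw [HasGhost, neg_one_zpow_eq]; rfl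

/-- `f` is homogeneous of momentum degree `u`, differential degree `v` and ghost number `l`. -/
structure HasType (u v l : ℤ) (f : Loc m n Ω) : Prop where
  mom : IsHomog totalMomWt u f
  diff : IsHomog diffWt v f
  ghost : HasGhost l f

namespace HasType
variable {u v l u' v' l' : ℤ} {f g : Loc m n Ω}

theorem par (hf : HasType u v l f) : (locCalc m n Ω).IsPar l.natAbs f :=
  (hasGhost_iff.1 hf.ghost).2

theorem congr (hf : HasType u v l f) (hu : u = u') (hv : v = v') (hl : l = l') :
    HasType u' v' l' f := hu ▸ hv ▸ hl ▸ hf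

theorem add (hf : HasType u v l f) (hg : HasType u v l g) : HasType u v l (f + g) :=
  ⟨hf.mom.add hg.mom, hf.diff.add hg.diff,
    hasGhost_iff.2 ⟨(hasGhost_iff.1 hf.ghost).1.add (hasGhost_iff.1 hg.ghost).1, hf.par.add hg.par⟩⟩

theorem smul (hf : HasType u v l f) (r : ℝ) : HasType u v l (r • f) :=
  ⟨hf.mom.smul r, hf.diff.smul r,
    hasGhost_iff.2 ⟨(hasGhost_iff.1 hf.ghost).1.smul r, hf.par.smul r⟩⟩

theorem neg (hf : HasType u v l f) : HasType u v l (-f) := by simpa using hf.smul (-1)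

/-- Every conjugate pair contains one momentum-type coordinate and one differential, and has total
ghost number zero. So the bracket lowers the first two degrees by one and preserves the third. -/
theorem br (hf : HasType u v l f) (hg : HasType u' v' l' g) :
    HasType (u + u' - 1) (v + v' - 1) (l + l') ((locCalc m n Ω).br f g) := by
  refine ⟨hf.mom.br ?_ hf.par hg.mom, hf.diff.br ?_ hf.par hg.diff, hasGhost_iff.2
    ⟨((hasGhost_iff.1 hf.ghost).1.br (s := 0) ?_ hf.par (hasGhost_iff.1 hg.ghost).1).congr
      (by ring), (SuperPoisson.IsPar.br hf.par hg.par).congr ?_⟩⟩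
  · rintro (_ | ((_ | _ | _ | _ | _) | (_ | _ | _ | _ | _ | _))) <;> rfl
  · rintro (_ | ((_ | _ | _ | _ | _) | (_ | _ | _ | _ | _ | _))) <;> rfl
  · rintro (_ | ((_ | _ | _ | _ | _) | (_ | _ | _ | _ | _ | _))) <;> rfl
  · simp [Nat.even_add, Int.even_add]

/-- The derivative would have momentum degree `-1`. -/
theorem pd_eq_zero_of_mom (hf : HasType 0 v l f) {h : FibGen d m n} (hh : totalMomWt h = 1) :
    pd h f = 0 := by
  refine eq_zero_of_isHomog_neg (wt := totalMomWt) (l := -1) ?_ (by norm_num)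
    ((hf.mom.pd h).congr (by rw [hh]; ring))
  intro g; unfold totalMomWt; split_ifs <;> norm_num

theorem pd_eq_zero_of_diff (hf : HasType u 0 l f) {h : FibGen d m n} (hh : diffWt h = 1) :
    pd h f = 0 := by
  refine eq_zero_of_isHomog_neg (wt := diffWt) (l := -1) ?_ (by norm_num)
    ((hf.diff.pd h).congr (by rw [hh]; ring))
  rintro ((_ | _ | _ | _ | _) | (_ | _ | _ | _ | _ | _)) <;> simp [diffWt]

/-- Momentum degree zero leaves no momenta to set to zero, so the restriction to `𝓛` in the
definitions of the brackets has no effect. -/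
theorem restrict_onL (hf : HasType 0 v l f) : restrict onL f = f := by
  have h := restrict_eq_self_of_isHomog (wt := totalMomWt (d := d) (m := m) (n := n))
    (fun g => by unfold totalMomWt; split_ifs <;> norm_num) hf.mom
  have e : (fun g : FibGen d m n => decide (totalMomWt g = 0)) = onL := by
    funext g
    unfold totalMomWt
    cases h : onL g <;> simp
  rwa [e] at h

end HasType

theorem totalMomWt_mom (A : Idx d m n) : totalMomWt (mom A) = 1 := by
  rcases A with i | z | z <;> rfl

theorem totalMomWt_covel (A : Idx d m n) : totalMomWt (covel A) = 1 := by
  rcases A with i | z | z <;> rfl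

theorem diffWt_vel (A : Idx d m n) : diffWt (vel A) = 1 := by
  rcases A with i | z | z <;> rfl

theorem diffWt_covel (A : Idx d m n) : diffWt (covel A) = 1 := by
  rcases A with i | z | z <;> rfl

/-- A weight can be replaced by one that agrees with it on the coordinates that occur. -/
theorem IsHomog.congr_wt {wt wt' : FibGen d m n → ℤ} {k : ℤ} {f : Loc m n Ω}
    (hf : IsHomog wt k f) (h : ∀ g, wt g = wt' g ∨ WeakKoszul.pd g f = 0) : IsHomog wt' k f := by
  rw [isHomog_iff, euler_apply] at *
  rw [← hf]
  refine Finset.sum_congr rfl fun g _ => ?_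
  rcases h g with h | h
  · rw [h]
  · rw [h, mul_zero, smul_zero, smul_zero]

theorem fibGen_cases {p : FibGen d m n → Prop} (h1 : ∀ z, p (fib z)) (h2 : ∀ A, p (mom A))
    (h3 : ∀ A, p (covel A)) (h4 : ∀ A, p (vel A)) (g : FibGen d m n) : p g := by
  rcases g with (a | a | a | a | a) | (a | a | a | a | a | a)
  · exact h2 (.inr (.inl a))
  · exact h2 (.inr (.inr a))
  · exact h4 (.inr (.inl a))
  · exact h4 (.inr (.inr a))
  · exact h3 (.inl a)
  · exact h1 (.inl a)
  · exact h1 (.inr a)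
  · exact h2 (.inl a)
  · exact h4 (.inl a)
  · exact h3 (.inr (.inl a))
  · exact h3 (.inr (.inr a))

theorem isHomog_zero_zero {f : Loc m n Ω} : IsHomog (fun _ => 0) 0 f := by
  rw [isHomog_iff, euler_apply]; simp

/-- On functions without `φ*` and `dφ*` the form degree agrees with the differential degree, which,
unlike the former, is respected by the bracket on all of `ΠT𝓝`. -/
theorem hasType_of_noMom {k l : ℤ} {f : Loc m n Ω} (h1 : ∀ A, pd (mom A) f = 0)
    (h2 : ∀ A, pd (covel A) f = 0) (h3 : IsHomog formWt k f) (h4 : HasGhost l f) :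
    HasType 0 k l f := by
  refine ⟨isHomog_zero_zero.congr_wt (fibGen_cases (fun z => .inl ?_) (fun A => .inr (h1 A))
    (fun A => .inr (h2 A)) fun A => .inl ?_), h3.congr_wt (fibGen_cases (fun z => .inl ?_)
    (fun A => .inl ?_) (fun A => .inr (h2 A)) fun A => .inl ?_), h4⟩
  · rcases z with z | z <;> rfl
  · rcases A with i | z | z <;> rfl
  · rcases z with z | z <;> rfl
  · rcases A with i | z | z <;> rfl
  · rcases A with i | z | z <;> rfl

theorem hasType_of_noVel {k l : ℤ} {f : Loc m n Ω} (h1 : ∀ A, pd (vel A) f = 0)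
    (h2 : ∀ A, pd (covel A) f = 0) (h3 : IsHomog momWt k f) (h4 : HasGhost l f) :
    HasType k 0 l f := by
  refine ⟨h3.congr_wt (fibGen_cases (fun z => .inl ?_) (fun A => .inl ?_)
    (fun A => .inr (h2 A)) fun A => .inr (h1 A)), isHomog_zero_zero.congr_wt
      (fibGen_cases (fun z => .inl ?_) (fun A => .inl ?_) (fun A => .inr (h2 A))
        fun A => .inr (h1 A)), h4⟩
  · rcases z with z | z <;> rfl
  · rcases A with i | z | z <;> rfl
  · rcases z with z | z <;> rfl
  · rcases A with i | z | z <;> rfl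

theorem HasType.formDegree {v l : ℤ} {f : Loc m n Ω} (h : HasType 0 v l f) :
    IsHomog formWt v f := by
  refine h.diff.congr_wt (fibGen_cases (fun z => .inl ?_) (fun A => .inl ?_)
    (fun A => .inr (h.pd_eq_zero_of_mom (totalMomWt_covel A))) fun A => .inl ?_)
  · rcases z with z | z <;> rfl
  · rcases A with i | z | z <;> rfl
  · rcases A with i | z | z <;> rfl

end gradings

/-! ### The odd bracket as a bracket derived from `Δ` -/

section derivedBrackets
variable {d m n : ℕ} {Ω : TopologicalSpace.Opens (Model d)}

variable (m n Ω) in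
/-- `Δ = (-1)^A dφ^A dφ*_A` -/
def canonDelta : Loc m n Ω :=
  ∑ A : Idx d m n, ((-1 : ℝ) ^ par A) • (coord (vel A) * coord (covel A))

theorem Delta_eq : (Delta : Formal m n Ω) = single 1 (canonDelta m n Ω) := rfl

theorem par_sq (A : Idx d m n) : (-1 : ℝ) ^ par A * (-1) ^ par A = 1 := by
  rw [← mul_pow]; simp

theorem canonDelta_hasType : HasType 1 2 (-1) (canonDelta m n Ω) := by
  have key : ∀ wt : FibGen d m n → ℤ, ∀ k, (∀ A, wt (vel A) + wt (covel A) = k) →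
      IsHomog wt k (canonDelta m n Ω) := fun wt k h =>
    IsHomog.sum fun A _ => .smul (.congr ((isHomog_coord wt _).mul (isHomog_coord wt _)) (h A)) _
  refine ⟨key _ _ ?_, key _ _ ?_, hasGhost_iff.2 ⟨key _ _ ?_, SuperCalc.IsPar.sum fun A _ =>
    .smul (.congr ((isPar_coord _).mul (isPar_coord _)) ?_) _⟩⟩
  · rintro (i | z | z) <;> rfl
  · rintro (i | z | z) <;> rfl
  · rintro (i | z | z) <;> rfl
  · rcases A with i | z | z <;> simp [gpar, vel, covel]

theorem canonDelta_par : (locCalc m n Ω).IsPar 1 (canonDelta m n Ω) :=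
  canonDelta_hasType.par

theorem vel_ne_covel (A B : Idx d m n) : vel A ≠ covel B := by
  rcases A with i | z | z <;> rcases B with j | w | w <;> simp [vel, covel]

theorem mom_ne_vel (A B : Idx d m n) : mom A ≠ vel B := by
  rcases A with i | z | z <;> rcases B with j | w | w <;> simp [vel, mom]

theorem mom_ne_covel (A B : Idx d m n) : mom A ≠ covel B := by
  rcases A with i | z | z <;> rcases B with j | w | w <;> simp [covel, mom]

theorem fib_ne_vel (z : FibIdx m n) (B : Idx d m n) : fib z ≠ vel B := by
  rcases z with z | z <;> rcases B with j | w | w <;> simp [vel, fib]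

theorem fib_ne_covel (z : FibIdx m n) (B : Idx d m n) : fib z ≠ covel B := by
  rcases z with z | z <;> rcases B with j | w | w <;> simp [covel, fib]

theorem vel_inj {A B : Idx d m n} : vel A = vel B ↔ A = B := by
  rcases A with i | z | z <;> rcases B with j | w | w <;> simp [vel]

theorem covel_inj {A B : Idx d m n} : covel A = covel B ↔ A = B := by
  rcases A with i | z | z <;> rcases B with j | w | w <;> simp [covel]

theorem pd_canonDelta (g : FibGen d m n) (h1 : ∀ A, g ≠ vel A) (h2 : ∀ A, g ≠ covel A) :
    pd g (canonDelta m n Ω) = 0 := by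
  rw [canonDelta, map_sum]
  refine Finset.sum_eq_zero fun A _ => ?_
  rw [map_smul, pd_coord_mul, pd_coord, if_neg (h1 A), if_neg (h2 A)]
  simp

theorem pdPos_canonDelta (A : Idx d m n) : pdPos A (canonDelta m n Ω) = 0 := by
  rcases A with i | z
  · rw [canonDelta, map_sum]
    refine Finset.sum_eq_zero fun A _ => ?_
    rw [map_smul, pdPos_inl_mul, pdPos_inl_coord, pdPos_inl_coord]
    simp
  · exact pd_canonDelta _ (fib_ne_vel z) (fib_ne_covel z)

theorem pd_vel_canonDelta (A : Idx d m n) :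
    pd (vel A) (canonDelta m n Ω) = (-1 : ℝ) ^ par A • coord (covel A) := by
  rw [canonDelta, map_sum, Finset.sum_eq_single A]
  · rw [map_smul, pd_coord_mul, pd_coord, if_pos rfl, if_neg (vel_ne_covel A A)]
    simp
  · intro B _ hB
    rw [map_smul, pd_coord_mul, pd_coord, if_neg (mt vel_inj.1 hB.symm),
      if_neg (vel_ne_covel A B)]
    simp
  · exact fun h => absurd (Finset.mem_univ _) h

theorem pd_covel_canonDelta (A : Idx d m n) :
    pd (covel A) (canonDelta m n Ω) = (-1 : ℝ) ^ par A • coord (vel A) := by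
  rw [canonDelta, map_sum, Finset.sum_eq_single A]
  · rw [map_smul, pd_coord_mul, pd_coord, if_pos rfl, if_neg (vel_ne_covel A A).symm]
    rcases A with i | z | z <;> simp [gpar, vel, covel, par]
  · intro B _ hB
    rw [map_smul, pd_coord_mul, pd_coord, if_neg (mt covel_inj.1 hB.symm),
      if_neg (vel_ne_covel B A).symm]
    simp
  · exact fun h => absurd (Finset.mem_univ _) h

theorem twist_of_par {j : ℕ} {f : Loc m n Ω} (hf : (locCalc m n Ω).IsPar j f) (k : ℕ) :
    twist k f = (-1 : ℝ) ^ (k * j) • f := hf.iterate k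

/-- `Δ` is quadratic in `dφ, dφ*`, so its Hamiltonian vector field is linear in them: up to signs it
is the de Rham differential of `𝓝`. -/
theorem br_canonDelta (f : Loc m n Ω) :
    (locCalc m n Ω).br (canonDelta m n Ω) f = ∑ A : Idx d m n, (-1 : ℝ) ^ par A •
      (coord (vel A) * pdPos A f - coord (covel A) * pd (mom A) f) := by
  rw [← evenBracket_eq_br, evenBracket]
  refine Finset.sum_congr rfl fun A _ => ?_
  rw [twist_of_par canonDelta_par, twist_of_par canonDelta_par, map_smul, map_smul, map_smul,
    map_smul, pd_vel_canonDelta, pd_covel_canonDelta, pdPos_canonDelta,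
    pd_canonDelta _ (mom_ne_vel A) (mom_ne_covel A), mul_one, mul_one, pow_succ]
  simp only [smul_zero, zero_mul, smul_smul, mul_neg, mul_one, neg_mul, par_sq,
    one_smul, neg_smul]
  rw [sub_zero, sub_zero, ← sub_eq_add_neg]

theorem br_canonDelta_self : (locCalc m n Ω).br (canonDelta m n Ω) (canonDelta m n Ω) = 0 := by
  rw [br_canonDelta]
  refine Finset.sum_eq_zero fun A _ => ?_
  rw [pdPos_canonDelta, pd_canonDelta _ (mom_ne_vel A) (mom_ne_covel A)]
  simp

theorem pd_pd_eq_zero {g : FibGen d m n} {f : Loc m n Ω} (hf : pd g f = 0) (h : FibGen d m n) :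
    pd g (pd h f) = 0 := by
  rw [pd_comm, hf]; simp

theorem pd_pdPos_eq_zero {g : FibGen d m n} {f : Loc m n Ω} (hf : pd g f = 0) (A : Idx d m n) :
    pd g (pdPos A f) = 0 := by
  rcases A with i | z
  · rw [← pdPos_inl_pd, hf, map_zero]
  · exact pd_pd_eq_zero hf _

theorem pd_covel_br_canonDelta {f : Loc m n Ω} (hf : ∀ A, pd (covel A) f = 0) (A : Idx d m n) :
    pd (covel A) ((locCalc m n Ω).br (canonDelta m n Ω) f) =
      -((-1 : ℝ) ^ par A • pd (mom A) f) := by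
  rw [br_canonDelta, map_sum, Finset.sum_eq_single A]
  · rw [map_smul, map_sub, pd_coord_mul, pd_coord_mul, pd_pdPos_eq_zero (hf A),
      pd_pd_eq_zero (hf A), if_pos rfl, if_neg (vel_ne_covel A A).symm]
    simp
  · intro B _ hB
    rw [map_smul, map_sub, pd_coord_mul, pd_coord_mul, pd_pdPos_eq_zero (hf A),
      pd_pd_eq_zero (hf A), if_neg (mt covel_inj.1 hB.symm), if_neg (vel_ne_covel B A).symm]
    simp
  · exact fun h => absurd (Finset.mem_univ _) h

theorem pd_vel_br_canonDelta {f : Loc m n Ω} (hf : ∀ A, pd (vel A) f = 0) (A : Idx d m n) :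
    pd (vel A) ((locCalc m n Ω).br (canonDelta m n Ω) f) = (-1 : ℝ) ^ par A • pdPos A f := by
  rw [br_canonDelta, map_sum, Finset.sum_eq_single A]
  · rw [map_smul, map_sub, pd_coord_mul, pd_coord_mul, pd_pdPos_eq_zero (hf A),
      pd_pd_eq_zero (hf A), if_pos rfl, if_neg (vel_ne_covel A A)]
    simp
  · intro B _ hB
    rw [map_smul, map_sub, pd_coord_mul, pd_coord_mul, pd_pdPos_eq_zero (hf A),
      pd_pd_eq_zero (hf A), if_neg (mt vel_inj.1 hB.symm), if_neg (vel_ne_covel A B)]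
    simp
  · exact fun h => absurd (Finset.mem_univ _) h

/-- The canonical odd bracket as a derived bracket. -/
theorem br_br_canonDelta {k : ℕ} {f g : Loc m n Ω} (hk : (locCalc m n Ω).IsPar k f)
    (hf : ∀ A, pd (vel A) f = 0) (hf' : ∀ A, pd (covel A) f = 0)
    (hg : ∀ A, pd (vel A) g = 0) (hg' : ∀ A, pd (covel A) g = 0) :
    (locCalc m n Ω).br ((locCalc m n Ω).br (canonDelta m n Ω) f) g =
      (-1 : ℝ) ^ k • oddBracket f g := by
  have hH := SuperPoisson.IsPar.br canonDelta_par hk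
  rw [← evenBracket_eq_br, evenBracket, oddBracket, Finset.smul_sum]
  refine Finset.sum_congr rfl fun A _ => ?_
  simp only [twist_of_par hH, twist_of_par hk, map_smul, pd_covel_br_canonDelta hf',
    pd_vel_br_canonDelta hf, hg, hg', mul_zero, sub_zero, smul_neg, neg_mul, smul_mul_assoc,
    smul_smul, smul_add, smul_sub]
  rw [sub_eq_add_neg]
  simp only [← neg_smul]
  -- The common factor `(-1)^k` comes from the shift of parity under the lift: `{Δ, f}` has parity
  -- `k + 1`, while the odd bracket uses the parity `k` of `f`.
  have e1 : -((-1 : ℝ) ^ par A * ((-1) ^ (par A * (1 + k)) * (-1) ^ par A)) =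
      (-1) ^ k * ((-1) ^ (par A + 1) * (-1) ^ ((par A + 1) * k)) := by
    rw [mul_comm ((-1 : ℝ) ^ (par A * (1 + k))), ← mul_assoc, par_sq, one_mul, ← pow_add,
      ← pow_add, eq_comm, neg_one_pow_congr_odd]
    rcases A with i | z <;> simp [par, Nat.even_add, -Nat.not_even_iff_odd]
  have e2 : (-1 : ℝ) ^ par A * ((-1) ^ ((par A + 1) * (1 + k)) * (-1) ^ par A) =
      -((-1) ^ k * ((-1) ^ par A * (-1) ^ (par A * k))) := by
    rw [mul_comm ((-1 : ℝ) ^ ((par A + 1) * (1 + k))), ← mul_assoc, par_sq, one_mul, ← pow_add,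
      ← pow_add, neg_one_pow_congr_odd]
    rcases A with i | z <;> simp [par, Nat.even_add, -Nat.not_even_iff_odd]
  rw [e1, e2]

end derivedBrackets

/-! ### Components of the formal series in the momenta -/

section series
variable {d m n : ℕ} {Ω : TopologicalSpace.Opens (Model d)}

theorem evenBracket_zero_left (f : Loc m n Ω) : evenBracket 0 f = 0 := by
  rw [evenBracket_eq_br, SuperPoisson.br_zero_left]

theorem evenBracket_zero_right (f : Loc m n Ω) : evenBracket f 0 = 0 := by
  rw [evenBracket_eq_br, SuperPoisson.br_zero_right]

theorem lift_apply (S : Formal m n Ω) (k : ℕ) :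
    lift S k = (locCalc m n Ω).br (canonDelta m n Ω) (S k) := by
  rw [lift, evenBr, Finset.sum_eq_single (1, k), ← evenBracket_eq_br]
  · rfl
  · rintro ⟨i, j⟩ hij hne
    rw [Finset.HasAntidiagonal.mem_antidiagonal] at hij
    have hi : i ≠ 1 := by
      rintro rfl
      exact hne (by ext <;> simp at hij ⊢; omega)
    rw [Delta_eq, single, Pi.single_eq_of_ne hi, evenBracket_zero_left]
  · intro h
    exact absurd (Finset.HasAntidiagonal.mem_antidiagonal.2 (add_comm 1 k)) h

theorem evenBr_single_zero (H : Formal m n Ω) (θ : Loc m n Ω) (k : ℕ) :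
    evenBr H (single 0 θ) k = (locCalc m n Ω).br (H (k + 1)) θ := by
  rw [evenBr, Finset.sum_eq_single (k + 1, 0), ← evenBracket_eq_br]
  · rfl
  · rintro ⟨i, j⟩ hij hne
    rw [Finset.HasAntidiagonal.mem_antidiagonal] at hij
    have hj : j ≠ 0 := by
      rintro rfl
      exact hne (by ext <;> simp at hij ⊢; omega)
    rw [single, Pi.single_eq_of_ne hj, evenBracket_zero_right]
  · intro h
    exact absurd (Finset.HasAntidiagonal.mem_antidiagonal.2 (add_zero (k + 1))) h

/-- The bracket with a function on `𝓛` lowers the momentum degree by one and the restriction keeps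
degree zero, so only the first component of `H` survives; for `binary` only the second. -/
theorem unary_eq (H : Formal m n Ω) (θ : Loc m n Ω) :
    unary H θ = restrict onL ((locCalc m n Ω).br (H 1) θ) := by
  rw [unary, restrictL, evenBr_single_zero]

theorem binary_eq (H : Formal m n Ω) (θ τ : Loc m n Ω) :
    binary H θ τ = restrict onL ((locCalc m n Ω).br ((locCalc m n Ω).br (H 2) θ) τ) := by
  rw [binary, restrictL, evenBr_single_zero, evenBr_single_zero]

theorem HasType.pd_vel {u l : ℤ} {f : Loc m n Ω} (hf : HasType u 0 l f) (A : Idx d m n) :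
    pd (vel A) f = 0 := hf.pd_eq_zero_of_diff (diffWt_vel A)

theorem HasType.pd_covel {u l : ℤ} {f : Loc m n Ω} (hf : HasType u 0 l f) (A : Idx d m n) :
    pd (covel A) f = 0 := hf.pd_eq_zero_of_diff (diffWt_covel A)

theorem HasType.pd_mom {v l : ℤ} {f : Loc m n Ω} (hf : HasType 0 v l f) (A : Idx d m n) :
    pd (WeakKoszul.mom A) f = 0 := hf.pd_eq_zero_of_mom (totalMomWt_mom A)

theorem HasType.pd_covel' {v l : ℤ} {f : Loc m n Ω} (hf : HasType 0 v l f) (A : Idx d m n) :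
    pd (covel A) f = 0 := hf.pd_eq_zero_of_mom (totalMomWt_covel A)

theorem HasType.br_canonDelta {k l : ℤ} {f : Loc m n Ω} (hf : HasType k 0 l f) :
    HasType k 1 (l - 1) ((locCalc m n Ω).br (canonDelta m n Ω) f) :=
  (canonDelta_hasType.br hf).congr (by ring) (by ring) (by ring)

theorem oddBracket_zero_left (f : Loc m n Ω) : oddBracket 0 f = 0 := by
  rw [oddBracket]
  refine Finset.sum_eq_zero fun A _ => ?_
  have h : ∀ k, twist k (0 : Loc m n Ω) = 0 := fun k => by
    rw [twist_of_par (j := 0) SuperCalc.IsPar.zero, smul_zero]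
  simp [h]

theorem oddBracket_zero_right (f : Loc m n Ω) : oddBracket f 0 = 0 := by
  simp [oddBracket]

/-- Output degree two means total input degree three, and the splittings `0 + 3` and `3 + 0` vanish.
-/
theorem oddBr_two {S V : Formal m n Ω} (hS : S 0 = 0) (hV : V 0 = 0) :
    oddBr S V 2 = oddBracket (S 1) (V 2) + oddBracket (S 2) (V 1) := by
  have h : Finset.HasAntidiagonal.antidiagonal (2 + 1) =
      ({(0, 3), (1, 2), (2, 1), (3, 0)} : Finset (ℕ × ℕ)) := rfl
  rw [oddBr, h, Finset.sum_insert (by simp), Finset.sum_insert (by simp),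
    Finset.sum_insert (by simp), Finset.sum_singleton]
  dsimp only
  rw [hS, hV, oddBracket_zero_left, oddBracket_zero_right, zero_add, add_zero]

/-- The lift to `ΠT𝓝` intertwines the odd and the even bracket. -/
theorem br_lift_lift {k l k' l' : ℤ} {f g : Loc m n Ω} (hf : HasType k 0 l f)
    (hg : HasType k' 0 l' g) :
    (locCalc m n Ω).br (canonDelta m n Ω) (oddBracket f g) =
      -(locCalc m n Ω).br ((locCalc m n Ω).br (canonDelta m n Ω) f)
        ((locCalc m n Ω).br (canonDelta m n Ω) g) := by
  have h := br_br_canonDelta hf.par hf.pd_vel hf.pd_covel hg.pd_vel hg.pd_covel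
  have h2 := SuperPoisson.br_derived canonDelta_par (br_canonDelta_self (Ω := Ω)) hf.par g
  rw [h, SuperPoisson.br_smul_right, pow_succ, mul_neg_one, neg_smul, ← smul_neg] at h2
  exact smul_right_injective _ (pow_ne_zero _ (by norm_num)) h2

/-- `{{Δ, a}, θ}` on functions `θ` without `dφ`: the vector field attached to `a`. -/
theorem br_lift_eq_sum {k j l : ℤ} {a f : Loc m n Ω} (ha : HasType k 0 j a)
    (hf : HasType 0 0 l f) :
    (locCalc m n Ω).br ((locCalc m n Ω).br (canonDelta m n Ω) a) f =
      ∑ B : Idx d m n, (-(-1 : ℝ) ^ (par B * (j.natAbs + 1))) • (pd (mom B) a * pdPos B f) := by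
  have hH := SuperPoisson.IsPar.br canonDelta_par ha.par
  rw [← evenBracket_eq_br, evenBracket]
  refine Finset.sum_congr rfl fun A _ => ?_
  rw [hf.pd_mom, hf.pd_vel, hf.pd_covel, twist_of_par hH, map_smul,
    pd_covel_br_canonDelta ha.pd_covel, mul_zero, mul_zero, mul_zero, add_zero, sub_zero, sub_zero,
    smul_neg, neg_mul, smul_neg, smul_mul_assoc, smul_mul_assoc, smul_smul, smul_smul, neg_smul,
    mul_right_comm, par_sq, one_mul, add_comm 1 j.natAbs]

/-- `{a, θ}` for `a` on `𝓝` and `θ` on `𝓛`. -/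
theorem br_eq_sum {k j v l : ℤ} {a θ : Loc m n Ω} (ha : HasType k 0 j a)
    (hθ : HasType 0 v l θ) :
    (locCalc m n Ω).br a θ =
      ∑ A : Idx d m n, ((-1 : ℝ) ^ ((par A + 1) * j.natAbs)) • (pd (mom A) a * pd (vel A) θ) := by
  rw [← evenBracket_eq_br, evenBracket]
  refine Finset.sum_congr rfl fun A _ => ?_
  rw [hθ.pd_mom, hθ.pd_covel', twist_of_par ha.par, twist_of_par ha.par, map_smul, map_smul,
    map_smul, map_smul, ha.pd_covel]
  simp only [smul_zero, zero_mul, mul_zero, zero_add, zero_sub, sub_neg_eq_add, smul_mul_assoc]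

/-- By Jacobi, `{{Δ, a}, θ}` differs from `{Δ, {a, θ}}` by `±{a, {Δ, θ}}`, which kills functions
without `dφ`. The binary bracket thus becomes the vector field attached to the single function `{a,
θ}`, whose change of coordinates can be controlled. -/
theorem br_br_lift {k j v l l' : ℤ} {a θ f : Loc m n Ω} (ha : HasType k 0 j a)
    (hθ : HasType 0 v l θ) (hf : HasType 0 0 l' f) :
    (locCalc m n Ω).br ((locCalc m n Ω).br ((locCalc m n Ω).br (canonDelta m n Ω) a) θ) f =
      (locCalc m n Ω).br ((locCalc m n Ω).br (canonDelta m n Ω) ((locCalc m n Ω).br a θ)) f := by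
  -- Only derivatives along `dφ*` pair with those of `f`, and `{a, {Δ, θ}}` contains no `dφ*`.
  have hz : (locCalc m n Ω).br ((locCalc m n Ω).br a ((locCalc m n Ω).br (canonDelta m n Ω) θ)) f
      = 0 := by
    have hX := SuperPoisson.IsPar.br ha.par (SuperPoisson.IsPar.br canonDelta_par hθ.par)
    have hc : ∀ A, pd (covel A) ((locCalc m n Ω).br a
        ((locCalc m n Ω).br (canonDelta m n Ω) θ)) = 0 := fun A => by
      have := SuperPoisson.D_br ha.par (.inr (covel A))
        ((locCalc m n Ω).br (canonDelta m n Ω) θ)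
      rw [locCalc_D_inr] at this
      rw [this, ha.pd_covel, pd_covel_br_canonDelta hθ.pd_covel', hθ.pd_mom, smul_zero, neg_zero,
        SuperPoisson.br_zero_left, SuperPoisson.br_zero_right, smul_zero, add_zero]
    rw [← evenBracket_eq_br, evenBracket]
    refine Finset.sum_eq_zero fun A _ => ?_
    rw [hf.pd_mom, hf.pd_vel, hf.pd_covel, twist_of_par hX, map_smul, hc, mul_zero, mul_zero,
      mul_zero, add_zero, sub_zero, sub_zero, smul_zero, zero_mul, smul_zero]
  have h := SuperPoisson.jacobi canonDelta_par ha.par θ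
  rw [h, SuperPoisson.br_add_left, SuperPoisson.br_smul_left, hz, smul_zero, add_zero]

end series

/-! ### Degrees of the global objects -/

section structures
variable {d m n : ℕ} {M : Type*} [TopologicalSpace M] [ChartedSpace (Model d) M]
  {E : M → Type*} [TopologicalSpace (Bundle.TotalSpace (Model m) E)]
  [∀ x, TopologicalSpace (E x)] [FiberBundle (Model m) E]
  {F : M → Type*} [TopologicalSpace (Bundle.TotalSpace (Model n) F)]
  [∀ x, TopologicalSpace (F x)] [FiberBundle (Model n) F]
  [∀ x, AddCommGroup (E x)] [∀ x, Module ℝ (E x)] [VectorBundle ℝ (Model m) E]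
  [∀ x, AddCommGroup (F x)] [∀ x, Module ℝ (F x)] [VectorBundle ℝ (Model n) F]

theorem IsForm.hasType {k l : ℤ} {θ : Fam d m n E F} (h : IsForm k l θ) (p : M) :
    HasType 0 k l (θ p) :=
  hasType_of_noMom (h.noMom p) (h.noCovel p) (h.formDegree p) (h.ghost p)

theorem isForm_of_hasType {k l : ℤ} {θ : Fam d m n E F} (hc : IsCompatible θ)
    (h : ∀ p, HasType 0 k l (θ p)) : IsForm k l θ :=
  ⟨hc, fun p => (h p).pd_mom, fun p => (h p).pd_covel', fun p => (h p).formDegree,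
    fun p => (h p).ghost⟩

theorem IsFunctionOnN.hasType {S : FormalFam d m n E F} (h : IsFunctionOnN S) {l : ℤ} {p : M}
    {k : ℕ} (hg : HasGhost l (S p k)) : HasType k 0 l (S p k) :=
  hasType_of_noVel (h.noVel p k) (h.noCovel p k) (h.momDegree p k) hg

end structures

/-! ### Leading terms on the zero section and on `ΠTM` -/

section constantTerm
variable {d m n : ℕ} {Ω : TopologicalSpace.Opens (Model d)}

variable (d m n) in
/-- The constant term of a fibre polynomial. -/
def fibConst : Fib d m n →ₐ[ℝ] ℝ :=
  (Algebra.TensorProduct.lmul' ℝ).comp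
    (Algebra.TensorProduct.map (MvPolynomial.aeval fun _ => (0 : ℝ)) ExteriorAlgebra.algebraMapInv)

theorem fibConst_gen (g : FibGen d m n) : fibConst d m n (gen g) = 0 := by
  rcases g with g | g
  · simp [fibConst, gen]
  · simp only [fibConst, gen, AlgHom.comp_apply, Algebra.TensorProduct.map_tmul, map_one]
    rw [ExteriorAlgebra.algebraMapInv, ExteriorAlgebra.lift_ι_apply]
    simp

variable (m n Ω) in
/-- The restriction of a local function to the zero section. -/
def constPart : Loc m n Ω →ₐ[ℝ] Smooth Ω :=
  (Algebra.TensorProduct.rid ℝ ℝ (Smooth Ω)).toAlgHom.comp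
    (Algebra.TensorProduct.map (AlgHom.id ℝ _) (fibConst d m n))

theorem constPart_tmul (s : Smooth Ω) (w : Fib d m n) :
    constPart m n Ω (s ⊗ₜ w) = fibConst d m n w • s := rfl

theorem constPart_coord (g : FibGen d m n) : constPart m n Ω (coord g) = 0 := by
  rw [coord, constPart_tmul, fibConst_gen, zero_smul]

theorem constPart_invol (f : Loc m n Ω) : constPart m n Ω (invol f) = constPart m n Ω f := by
  induction f using loc_induction with
  | base s => rw [invol_tmul, map_one]
  | coord g =>
    have h : invol (coord g : Loc m n Ω) = _ := isPar_coord g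
    rw [h, map_smul, constPart_coord, smul_zero]
  | mul a b ha hb => simp only [map_mul, ha, hb]
  | add a b ha hb => simp only [map_add, ha, hb]

theorem restrict_none_eq (f : Loc m n Ω) :
    restrict (fun _ => false) f = constPart m n Ω f ⊗ₜ 1 := by
  induction f using loc_induction with
  | base s => rw [restrict_tmul, constPart_tmul, map_one, map_one, one_smul]
  | coord g => rw [restrict_coord, constPart_coord]; simp
  | mul a b ha hb => rw [map_mul, map_mul, ha, hb]; simp
  | add a b ha hb => rw [map_add, map_add, ha, hb, TensorProduct.add_tmul]

theorem evalAt_constPart (y : Ω) (f : Loc m n Ω) :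
    (constPart m n Ω f).1 y = fibConst d m n (evalAt y f) := by
  induction f using TensorProduct.induction_on with
  | zero => simp
  | add a b ha hb => rw [map_add, map_add, map_add, ← ha, ← hb]; rfl
  | tmul s w => rw [constPart_tmul, evalAt_tmul, map_smul, smul_eq_mul, mul_comm]; rfl

theorem fibConst_fibRestrict (keep : FibGen d m n → Bool) (w : Fib d m n) :
    fibConst d m n (fibRestrict keep w) = fibConst d m n w := by
  have : (fibConst d m n).comp (fibRestrict keep) = fibConst d m n :=
    fib_algHom_ext fun g => by
      rw [AlgHom.comp_apply, fibRestrict_gen, fibConst_gen]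
      split_ifs
      · exact fibConst_gen g
      · simp
  exact DFunLike.congr_fun this w

/-- A nonzero weight forces a factor that vanishes on the zero section. Applied to ghost number,
this removes all unwanted structure functions below. -/
theorem constPart_eq_zero {wt : FibGen d m n → ℤ} {l : ℤ} {f : Loc m n Ω} (h : IsHomog wt l f)
    (hl : l ≠ 0) : constPart m n Ω f = 0 := by
  have := congrArg (constPart m n Ω) (isHomog_iff.1 h)
  rw [euler_apply, map_sum, map_smul, Finset.sum_eq_zero] at this
  · exact (smul_eq_zero.1 this.symm).resolve_left (by exact_mod_cast hl)
  · intro g _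
    rw [map_smul, map_mul, constPart_coord, zero_mul, smul_zero]

theorem constPart_pd_mul (g : FibGen d m n) (a b : Loc m n Ω) :
    constPart m n Ω (pd g (a * b)) = constPart m n Ω (pd g a) * constPart m n Ω b +
      constPart m n Ω a * constPart m n Ω (pd g b) := by
  have h : ∀ k, constPart m n Ω (invol^[k] a) = constPart m n Ω a := fun k => by
    induction k with
    | zero => rfl
    | succ k ih => rw [Function.iterate_succ_apply', constPart_invol, ih]
  rw [pd_mul, map_add, map_mul, map_mul, h]

theorem HasType.isHomog_ghost {u v l : ℤ} {f : Loc m n Ω} (hf : HasType u v l f) :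
    IsHomog ghostWt l f := (hasGhost_iff.1 hf.ghost).1

/-- Form degree zero excludes `dx` as well, so on `ΠTM` only the dependence on `x` remains. -/
theorem HasType.restrict_onTM {l : ℤ} {f : Loc m n Ω} (hf : HasType 0 0 l f) :
    restrict onTM f = constPart m n Ω f ⊗ₜ 1 := by
  have h := restrict_eq_self_of_isHomog (wt := formWt (d := d) (m := m) (n := n))
    (by rintro ((_ | _ | _ | _ | _) | (_ | _ | _ | _ | _ | _)) <;> simp [formWt]) hf.formDegree
  rw [← restrict_none_eq]
  conv_lhs => rw [← h, restrict_restrict]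
  congr 2
  funext g
  rcases g with (_ | _ | _ | _ | _) | (_ | _ | _ | _ | _ | _) <;> rfl

theorem HasType.pdPos_inl {u v l : ℤ} {f : Loc m n Ω} (hf : HasType u v l f) (i : Fin d) :
    HasType u v l (pdPos (.inl i) f) :=
  ⟨hf.mom.pdPos_inl i, hf.diff.pdPos_inl i, hasGhost_iff.2 ⟨hf.isHomog_ghost.pdPos_inl i,
    (hf.par.D (.inl i))⟩⟩

theorem HasType.evalAt_pdPos_restrict_onTM {l : ℤ} {f : Loc m n Ω} (hf : HasType 0 0 l f)
    (i : Fin d) (y : Ω) : evalAt y (pdPos (.inl i) (restrict onTM f)) =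
      (constPart m n Ω (pdPos (.inl i) f)).1 y • (1 : Fib d m n) := by
  rw [pdPos_inl_restrict, (hf.pdPos_inl i).restrict_onTM, evalAt_tmul]

/-- Functions of the resolution degree zero part determine the leading structure functions. -/
theorem constPart_pd_resZero {g : FibGen d m n} (hg : resZero g = true) (f : Loc m n Ω) (y : Ω) :
    (constPart m n Ω (pd g f)).1 y =
      fibConst d m n (fibDeriv g (evalAt y (restrict resZero f))) := by
  rw [evalAt_constPart, evalAt_pd, evalAt_restrict, fibDeriv_fibRestrict, if_pos hg,
    fibConst_fibRestrict]

theorem constPart_pd_pd_resZero {g h : FibGen d m n} (hg : resZero g = true)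
    (hh : resZero h = true) (f : Loc m n Ω) (y : Ω) :
    (constPart m n Ω (pd g (pd h f))).1 y =
      fibConst d m n (fibDeriv g (fibDeriv h (evalAt y (restrict resZero f)))) := by
  rw [constPart_pd_resZero hg, evalAt_restrict, evalAt_pd, evalAt_restrict,
    fibDeriv_fibRestrict resZero h, if_pos hh]

/-- The part of `{{Δ, a}, f}` linear in `c^α`. -/
theorem constPart_pd_br {k : ℤ} {a f : Loc m n Ω} (ha : HasType k 0 2 a) (hf : HasType 0 0 0 f)
    (α : Fin n) :
    constPart m n Ω (pd (fib (.inr α))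
      ((locCalc m n Ω).br ((locCalc m n Ω).br (canonDelta m n Ω) a) f)) =
      -∑ i, constPart m n Ω (pd (fib (.inr α)) (pd (mom (.inl i)) a)) *
          constPart m n Ω (pdPos (.inl i) f) +
        ∑ b, constPart m n Ω (pd (mom (.inr (.inl b))) a) *
          constPart m n Ω (pd (fib (.inr α)) (pd (fib (.inl b)) f)) := by
  rw [br_lift_eq_sum ha hf, map_sum, map_sum, Fintype.sum_sum_type, Fintype.sum_sum_type]
  -- The ghost numbers of these four derivatives of `a` are `1`, `-1`, `2` and `1`, so none has a
  -- constant term. What remains are the coefficients of `c^α x*_i` and `η*_b`.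
  have h1 : ∀ i : Fin d, constPart m n Ω (pd (mom (.inl i)) a) = 0 := fun i =>
    constPart_eq_zero (ha.isHomog_ghost.pd _) (by simp [ghostWt, mom])
  have h2 : ∀ b : Fin m, constPart m n Ω (pd (fib (.inr α)) (pd (mom (.inr (.inl b))) a)) = 0 :=
    fun b => constPart_eq_zero ((ha.isHomog_ghost.pd _).pd _) (by simp [ghostWt, mom, fib])
  have h3 : ∀ β : Fin n, constPart m n Ω (pd (mom (.inr (.inr β))) a) = 0 := fun i =>
    constPart_eq_zero (ha.isHomog_ghost.pd _) (by simp [ghostWt, mom])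
  have h4 : ∀ β : Fin n, constPart m n Ω (pd (fib (.inr α)) (pd (mom (.inr (.inr β))) a)) = 0 :=
    fun b => constPart_eq_zero ((ha.isHomog_ghost.pd _).pd _) (by simp [ghostWt, mom, fib])
  simp only [map_smul, constPart_pd_mul, h1, h2, h3, h4, zero_mul, zero_add, add_zero, smul_zero,
    Finset.sum_const_zero]
  simp only [par, pdPos, zero_mul, pow_zero, neg_smul, one_smul, Finset.sum_neg_distrib]
  refine congrArg₂ (· + ·) rfl ?_
  rw [← Finset.sum_neg_distrib]
  refine Finset.sum_congr rfl fun b _ => ?_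
  norm_num

theorem constPart_br {k j l : ℤ} {a f : Loc m n Ω} (ha : HasType k 0 j a) (hf : HasType 0 0 l f) :
    constPart m n Ω ((locCalc m n Ω).br ((locCalc m n Ω).br (canonDelta m n Ω) a) f) =
      ∑ B, (-(-1 : ℝ) ^ (par B * (j.natAbs + 1))) •
        (constPart m n Ω (pd (mom B) a) * constPart m n Ω (pdPos B f)) := by
  simp only [br_lift_eq_sum ha hf, map_sum, map_smul, map_mul]

/-- At ghost number two, `η*_b` is the only momentum whose derivative of `a` can have a constant
term. -/
theorem constPart_br_of_two {k l : ℤ} {a f : Loc m n Ω} (ha : HasType k 0 2 a)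
    (hf : HasType 0 0 l f) :
    constPart m n Ω ((locCalc m n Ω).br ((locCalc m n Ω).br (canonDelta m n Ω) a) f) =
      ∑ b, constPart m n Ω (pd (mom (.inr (.inl b))) a) *
        constPart m n Ω (pd (fib (.inl b)) f) := by
  rw [constPart_br ha hf, Fintype.sum_sum_type, Fintype.sum_sum_type]
  have h1 : ∀ i : Fin d, constPart m n Ω (pd (mom (.inl i)) a) = 0 := fun i =>
    constPart_eq_zero (ha.isHomog_ghost.pd _) (by simp [ghostWt, mom])
  have h3 : ∀ β : Fin n, constPart m n Ω (pd (mom (.inr (.inr β))) a) = 0 := fun i =>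
    constPart_eq_zero (ha.isHomog_ghost.pd _) (by simp [ghostWt, mom])
  simp only [h1, h3, zero_mul, smul_zero, Finset.sum_const_zero, zero_add, add_zero]
  refine Finset.sum_congr rfl fun b _ => ?_
  simp only [par, pdPos]
  norm_num

/-- At ghost number one, `x*_i` is the only momentum whose derivative of `a` can have a constant
term. -/
theorem constPart_br_of_one {k l : ℤ} {a f : Loc m n Ω} (ha : HasType k 0 1 a)
    (hf : HasType 0 0 l f) :
    constPart m n Ω ((locCalc m n Ω).br ((locCalc m n Ω).br (canonDelta m n Ω) a) f) =
      -∑ i, constPart m n Ω (pd (mom (.inl i)) a) * constPart m n Ω (pdPos (.inl i) f) := by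
  rw [constPart_br ha hf, Fintype.sum_sum_type, Fintype.sum_sum_type]
  have h1 : ∀ b : Fin m, constPart m n Ω (pd (mom (.inr (.inl b))) a) = 0 := fun i =>
    constPart_eq_zero (ha.isHomog_ghost.pd _) (by simp [ghostWt, mom])
  have h3 : ∀ β : Fin n, constPart m n Ω (pd (mom (.inr (.inr β))) a) = 0 := fun i =>
    constPart_eq_zero (ha.isHomog_ghost.pd _) (by simp [ghostWt, mom])
  simp only [h1, h3, zero_mul, smul_zero, Finset.sum_const_zero, add_zero]
  rw [← Finset.sum_neg_distrib]
  refine Finset.sum_congr rfl fun b _ => ?_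
  simp only [par]
  norm_num

theorem pd_mom_br {k j v l : ℤ} {a θ : Loc m n Ω} (ha : HasType k 0 j a)
    (hθ : HasType 0 v l θ) (B : Idx d m n) :
    pd (mom B) ((locCalc m n Ω).br a θ) = ∑ A : Idx d m n,
      ((-1 : ℝ) ^ ((par A + 1) * j.natAbs)) • (pd (mom B) (pd (mom A) a) * pd (vel A) θ) := by
  rw [br_eq_sum ha hθ, map_sum]
  refine Finset.sum_congr rfl fun A _ => ?_
  rw [map_smul, pd_mul, pd_pd_eq_zero (hθ.pd_mom B), mul_zero, add_zero]

theorem br_one_form {k j l : ℤ} {a θ : Loc m n Ω} (ha : HasType k 0 j a) (hθ : HasType 0 1 l θ) :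
    HasType (k - 1) 0 (j + l) ((locCalc m n Ω).br a θ) :=
  (ha.br hθ).congr (by ring) (by ring) rfl

/-- The binary bracket of a one-form and a function involves only their first derivatives. -/
theorem br_br_lift_eq_sum {k j l l' : ℤ} {a θ f : Loc m n Ω} (ha : HasType k 0 j a)
    (hθ : HasType 0 1 l θ) (hf : HasType 0 0 l' f) :
    (locCalc m n Ω).br ((locCalc m n Ω).br ((locCalc m n Ω).br (canonDelta m n Ω) a) θ) f =
      ∑ B : Idx d m n, (-(-1 : ℝ) ^ (par B * ((j + l).natAbs + 1))) •
        ((∑ A : Idx d m n, ((-1 : ℝ) ^ ((par A + 1) * j.natAbs)) •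
          (pd (mom B) (pd (mom A) a) * pd (vel A) θ)) * pdPos B f) := by
  rw [br_br_lift ha hθ hf, br_lift_eq_sum (br_one_form ha hθ) hf]
  simp only [pd_mom_br ha hθ]

/-- The bracket is bilinear in `∂θ/∂dφ` and `∂f/∂φ`, so only the restrictions of these derivatives
matter; this gives independence of the extensions. -/
theorem restrict_binary_congr {keep : FibGen d m n → Bool} {k j l l' : ℤ} {a θ θ' f f' : Loc m n Ω}
    (ha : HasType k 0 j a) (hθ : HasType 0 1 l θ) (hf : HasType 0 0 l' f) (hθ' : HasType 0 1 l θ')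
    (hf' : HasType 0 0 l' f')
    (h : ∀ A, restrict keep (pd (vel A) θ) = restrict keep (pd (vel A) θ'))
    (h' : ∀ A, restrict keep (pdPos A f) = restrict keep (pdPos A f')) :
    restrict keep
      ((locCalc m n Ω).br ((locCalc m n Ω).br ((locCalc m n Ω).br (canonDelta m n Ω) a) θ) f) =
    restrict keep
      ((locCalc m n Ω).br ((locCalc m n Ω).br ((locCalc m n Ω).br (canonDelta m n Ω) a) θ') f') := by
  simp only [br_br_lift_eq_sum ha hθ hf, br_br_lift_eq_sum ha hθ' hf', map_sum, map_smul, map_mul,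
    h, h']

theorem IsHomog.restrict {wt : FibGen d m n → ℤ} {k : ℤ} {f : Loc m n Ω} (hf : IsHomog wt k f)
    (keep : FibGen d m n → Bool) : IsHomog wt k (restrict keep f) := by
  rw [isHomog_iff] at *
  rw [← map_smul, ← hf, euler_apply, euler_apply, map_sum]
  refine Finset.sum_congr rfl fun g _ => ?_
  rw [map_smul, map_mul, restrict_coord, pd_restrict]
  split_ifs <;> simp

theorem invol_restrict (keep : FibGen d m n → Bool) (f : Loc m n Ω) :
    invol (WeakKoszul.restrict keep f) = WeakKoszul.restrict keep (invol f) := by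
  induction f using TensorProduct.induction_on with
  | zero => simp
  | add a b ha hb => simp only [map_add, ha, hb]
  | tmul s w =>
    rw [restrict_tmul, invol_tmul, invol_tmul, restrict_tmul, fibInvol_fibRestrict]

theorem HasType.restrict {u v l : ℤ} {f : Loc m n Ω} (hf : HasType u v l f)
    (keep : FibGen d m n → Bool) : HasType u v l (restrict keep f) := by
  refine ⟨hf.mom.restrict keep, hf.diff.restrict keep,
    hasGhost_iff.2 ⟨hf.isHomog_ghost.restrict keep, ?_⟩⟩
  have h : invol f = _ := hf.par
  change invol _ = _
  rw [invol_restrict, h, map_smul]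

/-- For extensions of a one-form, the derivatives along the odd fibre velocities vanish
on `ΠTM`. -/
theorem restrict_onTM_pd {k : ℤ} {θ : Loc m n Ω} (hθ : HasType 0 k (-k) θ) {g : FibGen d m n}
    (hg : onTM g = true ∨ ghostWt g + formWt g ≠ 0) :
    restrict onTM (pd g (restrict onTM θ)) = restrict onTM (pd g θ) := by
  rw [pd_restrict]
  split_ifs with h
  · rw [restrict_restrict]; simp
  -- Ghost number `-k` and form degree `k` add up to weight zero. The derivative then has nonzero
  -- weight, while `dx` has weight zero, so the derivative vanishes on `ΠTM`.
  · have hw : IsHomog (fun g => ghostWt g + formWt g) 0 θ := by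
      have h1 := isHomog_iff.1 hθ.isHomog_ghost
      have h2 := isHomog_iff.1 hθ.formDegree
      rw [isHomog_iff, euler_apply]
      rw [euler_apply] at h1 h2
      simp only [Int.cast_add, add_smul, Finset.sum_add_distrib, h1, h2]
      simp
    rw [map_zero, restrict_eq_zero_of_isHomog (hw.pd g)]
    · rw [zero_sub, neg_ne_zero]
      exact hg.resolve_left h
    · rintro ((_ | _ | _ | _ | _) | (_ | _ | _ | _ | _ | _)) <;> simp [onTM, ghostWt, formWt]

theorem restrict_onTM_pd_vel {k : ℤ} {θ : Loc m n Ω} (hθ : HasType 0 k (-k) θ) (A : Idx d m n) :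
    restrict onTM (pd (vel A) (restrict onTM θ)) = restrict onTM (pd (vel A) θ) := by
  refine restrict_onTM_pd hθ ?_
  rcases A with i | z | z <;> simp [vel, onTM, ghostWt, formWt]

theorem restrict_onTM_pdPos {k : ℤ} {θ : Loc m n Ω} (hθ : HasType 0 k (-k) θ) (A : Idx d m n) :
    restrict onTM (pdPos A (restrict onTM θ)) = restrict onTM (pdPos A θ) := by
  rcases A with i | z
  · rw [pdPos_inl_restrict, restrict_restrict]; simp
  · refine restrict_onTM_pd hθ ?_
    rcases z with z | z <;> simp [fib, onTM, ghostWt, formWt]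

end constantTerm

theorem SuperCalc.IsPar.mul_eq_iterate_mul {A : Type*} [Ring A] [Algebra ℝ A] {G : Type*}
    {C : SuperCalc A G} {j : ℕ} {c : A} (hc : C.IsPar j c) (a : A) : c * a = C.σ^[j] a * c := by
  obtain ⟨a0, a1, h0, h1, rfl⟩ := C.exists_even_odd a
  rw [algHom_iterate_add, h0.iterate, h1.iterate, mul_add, add_mul, hc.mul_comm h0,
    hc.mul_comm h1]
  simp

/-! ### Changes of coordinates over a single point -/

section coordinateChange
variable {d m n : ℕ}

/-- The coordinates other than the `dφ*_A`. -/
def notCovel : FibGen d m n → Bool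
  | .inl (.xCovel _) => false
  | .inr (.etaCovel _) => false
  | .inr (.cCovel _) => false
  | _ => true

/-- The coordinates `η^a` and `c^α`. -/
def isFib : FibGen d m n → Bool
  | .inr (.eta _) => true
  | .inr (.c _) => true
  | _ => false

theorem sum_fibGen {X : Type*} [AddCommMonoid X] (H : FibGen d m n → X) :
    ∑ g, H g = (∑ z, H (fib z) + ∑ A, H (mom A)) + (∑ A, H (covel A) + ∑ A, H (vel A)) := by
  have h := sum_coo (Sum.elim (fun _ : Fin d => (0 : X)) H)
  rw [Fintype.sum_sum_type] at h
  simp only [Sum.elim_inl, Finset.sum_const_zero, zero_add, Sum.elim_inr] at h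
  rw [h]
  congr 2
  rw [Fintype.sum_sum_type]
  simp [pos]

theorem restrict_eq_self {Ω : TopologicalSpace.Opens (Model d)} {keep : FibGen d m n → Bool}
    {f : Loc m n Ω} (h : ∀ g, keep g = false → pd g f = 0) : restrict keep f = f := by
  have h1 := restrict_eq_self_of_isHomog (wt := fun g => if keep g then 0 else 1) (f := f)
    (fun g => by split_ifs <;> norm_num) (by
      rw [isHomog_iff, euler_apply, Finset.sum_eq_zero]
      · simp
      · intro g _
        split_ifs with hg
        · simp
        · rw [h g (by simpa using hg)]; simp)
  have e : (fun g : FibGen d m n => decide ((if keep g then (0 : ℤ) else 1) = 0)) = keep := by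
    funext g
    cases h : keep g <;> simp
  rwa [e] at h1

theorem restrict_notCovel {Ω : TopologicalSpace.Opens (Model d)} {f : Loc m n Ω}
    (h : ∀ A, pd (covel A) f = 0) : restrict notCovel f = f := by
  refine restrict_eq_self fun g => ?_
  revert g
  refine fibGen_cases (fun z hz => ?_) (fun A hA => ?_) (fun A _ => h A) fun A hA => ?_
  · rcases z with z | z <;> simp [fib, notCovel] at hz
  · rcases A with i | z | z <;> simp [mom, notCovel] at hA
  · rcases A with i | z | z <;> simp [vel, notCovel] at hA

theorem HasType.restrict_isFib {Ω : TopologicalSpace.Opens (Model d)} {l : ℤ} {f : Loc m n Ω}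
    (hf : HasType 0 0 l f) : WeakKoszul.restrict isFib f = f := by
  refine restrict_eq_self fun g => ?_
  revert g
  refine fibGen_cases (fun z hz => ?_) (fun A hA => hf.pd_mom A) (fun A _ => hf.pd_covel A)
    fun A hA => hf.pd_vel A
  rcases z with z | z <;> simp [fib, isFib] at hz

/-- The Jacobian data of a change of coordinates at a point. -/
structure ChangeData (d m n : ℕ) where
  J : Fin d → Fin d → ℝ
  Jinv : Fin d → Fin d → ℝ
  g : FibIdx m n → FibIdx m n → ℝ
  ginv : FibIdx m n → FibIdx m n → ℝ
  dg : Fin d → FibIdx m n → FibIdx m n → ℝ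
  dginv : Fin d → FibIdx m n → FibIdx m n → ℝ

/-- The Jacobian data of inverse changes of coordinates are inverse to each other. -/
structure ChangeData.IsInverse (D : ChangeData d m n) : Prop where
  J_mul : ∀ k j, ∑ i, D.J k i * D.Jinv i j = if k = j then 1 else 0
  g_mul : ∀ c b, ∑ a, D.g c a * D.ginv a b = if c = b then 1 else 0
  dg_add : ∀ j b a, ∑ i, D.dg i b a * D.Jinv i j +
    ∑ a', D.g b a' * ∑ b', D.dginv j a' b' * D.g b' a = 0

/-- A change of the coordinates of `𝓝` and `ΠT𝓜`, extended by zero to the `dφ*_A`. -/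
structure ChangeData.IsChange (D : ChangeData d m n) (Θ : Fib d m n →ₐ[ℝ] Fib d m n) :
    Prop where
  fib : ∀ b, Θ (gen (fib b)) = ∑ a, D.g b a • gen (WeakKoszul.fib a)
  fibMom : ∀ b, Θ (gen (mom (.inr b))) = ∑ a, D.ginv a b • gen (mom (.inr a))
  baseMom : ∀ j, Θ (gen (mom (.inl j))) =
    ∑ i, D.Jinv i j • gen (mom (.inl i))
      + ∑ a, ∑ b, ∑ c, (D.dginv j a b * D.g b c) •
          (gen (WeakKoszul.fib c) * gen (mom (.inr a)))
  baseVel : ∀ j, Θ (gen (vel (.inl j))) = ∑ i, D.J j i • gen (vel (.inl i))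
  fibVel : ∀ b, Θ (gen (vel (.inr b))) =
    ∑ a, D.g b a • gen (vel (.inr a))
      - ∑ i, ∑ a, D.dg i b a • (gen (vel (.inl i)) * gen (WeakKoszul.fib a))
  covel : ∀ A, Θ (gen (covel A)) = 0

namespace ChangeData
variable {D : ChangeData d m n} {Θ Θ' : Fib d m n →ₐ[ℝ] Fib d m n}

/-- Fixing the images of the `dφ*` as zero leaves no freedom on the generators, so compatibility of
several families can be tested with one and the same homomorphism. -/
theorem IsChange.unique (h : D.IsChange Θ) (h' : D.IsChange Θ') : Θ = Θ' := by
  refine fib_algHom_ext (fibGen_cases (fun z => ?_) ?_ (fun A => ?_) ?_)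
  · rw [h.fib, h'.fib]
  · rintro (i | z)
    · rw [h.baseMom, h'.baseMom]
    · rw [h.fibMom, h'.fibMom]
  · rw [h.covel, h'.covel]
  · rintro (i | z)
    · rw [h.baseVel, h'.baseVel]
    · rw [h.fibVel, h'.fibVel]

theorem fibCalc_isPar_gen (g : FibGen d m n) : (fibCalc d m n).IsPar (gpar g) (gen g) :=
  fibInvol_gen g

theorem IsChange.isPar (h : D.IsChange Θ) (g : FibGen d m n) :
    (fibCalc d m n).IsPar (gpar g) (Θ (gen g)) := by
  revert g
  refine fibGen_cases (fun z => ?_) ?_ (fun A => ?_) ?_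
  · rw [h.fib]
    refine .sum fun a _ => .smul (.congr (fibCalc_isPar_gen _) ?_) _
    rcases z with z | z <;> rcases a with a | a <;> rfl
  · rintro (j | b)
    · rw [h.baseMom]
      refine .add (.sum fun i _ => .smul (fibCalc_isPar_gen _) _) (.sum fun a _ => .sum fun b _ =>
        .sum fun c _ => .smul (.congr ((fibCalc_isPar_gen _).mul (fibCalc_isPar_gen _)) ?_) _)
      rcases a with a | a <;> rcases c with c | c <;> rfl
    · rw [h.fibMom]
      refine .sum fun a _ => .smul (.congr (fibCalc_isPar_gen _) ?_) _
      rcases b with z | z <;> rcases a with a | a <;> rfl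
  · rw [h.covel]; exact .zero
  · rintro (j | b)
    · rw [h.baseVel]
      exact .sum fun i _ => .smul (fibCalc_isPar_gen _) _
    · rw [h.fibVel, sub_eq_add_neg, ← neg_one_smul ℝ]
      refine .add (.sum fun i _ => .smul (.congr (fibCalc_isPar_gen _) ?_) _) (.smul (.sum
        fun i _ => .sum fun a _ =>
          .smul (.congr ((fibCalc_isPar_gen _).mul (fibCalc_isPar_gen _)) ?_) _) _)
      · rcases b with b | b <;> rcases i with c | c <;> rfl
      · rcases b with b | b <;> rcases a with c | c <;> simp [gpar, vel, WeakKoszul.fib]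

theorem IsChange.invol (h : D.IsChange Θ) (w : Fib d m n) :
    fibInvol (Θ w) = Θ (fibInvol w) := by
  have : fibInvol.comp Θ = Θ.comp fibInvol := fib_algHom_ext fun g => by
    rw [AlgHom.comp_apply, AlgHom.comp_apply, fibInvol_gen, map_smul]
    exact h.isPar g
  exact DFunLike.congr_fun this w

theorem iterate_fibInvol_add (j k : ℕ) (hjk : Even k) (w : Fib d m n) :
    fibInvol^[j + k] w = fibInvol^[j] w := by
  obtain ⟨k, rfl⟩ := hjk
  rw [Function.iterate_add_apply]
  congr 1
  rw [← two_mul, Function.iterate_mul]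
  have : (fibInvol (d := d) (m := m) (n := n))^[2] = id := by
    funext w; exact (fibCalc d m n).invol_invol w
  rw [this, Function.iterate_id, id]

theorem IsChange.chain_rule (h : D.IsChange Θ) (g : FibGen d m n) (w : Fib d m n) :
    fibDeriv g (Θ w) = ∑ k, fibDeriv g (Θ (gen k)) * Θ (fibDeriv k w) := by
  induction w using fib_induction with
  | smul_one r =>
    simp only [AlgHom.commutes, fibDeriv_algebraMap, map_zero, mul_zero, Finset.sum_const_zero]
  | gen k => simp [fibDeriv_gen, apply_ite Θ]
  | add a b ha hb =>
    simp only [map_add, ha, hb, mul_add, Finset.sum_add_distrib]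
  | mul a b ha hb =>
    rw [map_mul, fibDeriv_mul, ha, hb, Finset.sum_mul, Finset.mul_sum, ← Finset.sum_add_distrib]
    refine Finset.sum_congr rfl fun k _ => ?_
    have hp := (h.isPar k).D g
    rw [fibCalc_D, fibCalc_deg] at hp
    -- Moving `∂_g Θ(z_k)`, of parity `|k| + |g|`, past `Θ(a)` changes the sign twist of `∂_g` into
    -- that of `∂_k`.
    have e : fibInvol^[gpar g] (Θ a) * fibDeriv g (Θ (gen k)) =
        fibDeriv g (Θ (gen k)) * Θ (fibInvol^[gpar k] a) := by
      rw [← iterate_comm_of_comm h.invol, hp.mul_eq_iterate_mul, fibCalc_σ,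
        ← Function.iterate_add_apply]
      rw [show gpar k + gpar g + gpar k = gpar g + (gpar k + gpar k) by omega,
        iterate_fibInvol_add _ _ ⟨gpar k, rfl⟩]
    rw [fibDeriv_mul, map_add, map_mul, map_mul, mul_add, mul_assoc,
      ← mul_assoc (fibInvol^[gpar g] (Θ a)), e, mul_assoc]

end ChangeData
end coordinateChange

/-! ### The chain rule coordinate by coordinate, and invariant contractions -/

section coordinateChange
variable {d m n : ℕ}

theorem fibDeriv_mom_gen (A B : Idx d m n) :
    fibDeriv (mom A) (gen (mom B)) = if A = B then 1 else 0 := by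
  rw [fibDeriv_gen]
  rcases A with i | z | z <;> rcases B with j | w | w <;> simp [mom]

theorem fibDeriv_vel_gen (A B : Idx d m n) :
    fibDeriv (vel A) (gen (vel B)) = if A = B then 1 else 0 := by
  rw [fibDeriv_gen]
  rcases A with i | z | z <;> rcases B with j | w | w <;> simp [vel]

theorem fibDeriv_mom_fib (A : Idx d m n) (z : FibIdx m n) :
    fibDeriv (mom A) (gen (fib z)) = 0 := by
  rw [fibDeriv_gen]
  rcases A with i | y | y <;> rcases z with j | w <;> simp [mom, fib]

theorem fibDeriv_vel_fib (A : Idx d m n) (z : FibIdx m n) :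
    fibDeriv (vel A) (gen (fib z)) = 0 := by
  rw [fibDeriv_gen]
  rcases A with i | y | y <;> rcases z with j | w <;> simp [vel, fib]

theorem fibDeriv_fib_gen (z w : FibIdx m n) :
    fibDeriv (fib z) (gen (fib w)) = if z = w then (1 : Fib d m n) else 0 := by
  rw [fibDeriv_gen]
  rcases z with z | z <;> rcases w with w | w <;> simp [fib]

theorem fibDeriv_mom_vel (A B : Idx d m n) : fibDeriv (mom A) (gen (vel B)) = 0 := by
  rw [fibDeriv_gen, if_neg (mom_ne_vel _ _)]

theorem fibDeriv_vel_mom (A B : Idx d m n) : fibDeriv (vel A) (gen (mom B)) = 0 := by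
  rw [fibDeriv_gen, if_neg (mom_ne_vel _ _).symm]

namespace ChangeData
variable {D : ChangeData d m n} {Θ Θ' : Fib d m n →ₐ[ℝ] Fib d m n}

/-- The momenta occur only in the images of momenta, so differentiation along them never meets the
other coordinates. -/
theorem IsChange.fibDeriv_mom (h : D.IsChange Θ) (A : Idx d m n) (w : Fib d m n) :
    fibDeriv (mom A) (Θ w) =
      ∑ B, fibDeriv (mom A) (Θ (gen (mom B))) * Θ (fibDeriv (mom B) w) := by
  rw [h.chain_rule, sum_fibGen]
  have h1 : ∀ z, fibDeriv (mom A) (Θ (gen (WeakKoszul.fib z))) = 0 := fun z => by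
    simp [h.fib, fibDeriv_mom_fib]
  have h2 : ∀ B, fibDeriv (mom A) (Θ (gen (vel B))) = 0 := by
    rintro (i | b)
    · simp [h.baseVel, fibDeriv_mom_vel]
    · simp [h.fibVel, fibDeriv_mom_vel, fibDeriv_mul, fibDeriv_mom_fib]
  simp [h1, h2, h.covel]

theorem IsChange.fibDeriv_vel (h : D.IsChange Θ) (A : Idx d m n) (w : Fib d m n) :
    fibDeriv (vel A) (Θ w) =
      ∑ B, fibDeriv (vel A) (Θ (gen (vel B))) * Θ (fibDeriv (vel B) w) := by
  rw [h.chain_rule, sum_fibGen]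
  have h1 : ∀ z, fibDeriv (vel A) (Θ (gen (WeakKoszul.fib z))) = 0 := fun z => by
    simp [h.fib, fibDeriv_vel_fib]
  have h2 : ∀ B, fibDeriv (vel A) (Θ (gen (mom B))) = 0 := by
    rintro (i | b)
    · simp [h.baseMom, fibDeriv_vel_mom, fibDeriv_mul, fibDeriv_vel_fib]
    · simp [h.fibMom, fibDeriv_vel_mom]
  simp [h1, h2, h.covel]

theorem IsChange.fibDeriv_mom_inl (h : D.IsChange Θ) (i : Fin d) (w : Fib d m n) :
    fibDeriv (mom (.inl i)) (Θ w) = ∑ j, D.Jinv i j • Θ (fibDeriv (mom (.inl j)) w) := by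
  rw [h.fibDeriv_mom, Fintype.sum_sum_type]
  simp [h.baseMom, h.fibMom, fibDeriv_mom_gen, fibDeriv_mul, fibDeriv_mom_fib,
    -Fintype.sum_sum_type]

/-- The second sum comes from the inhomogeneous term in the transformation of `x*`. -/
theorem IsChange.fibDeriv_mom_inr (h : D.IsChange Θ) (a : FibIdx m n) (w : Fib d m n) :
    fibDeriv (mom (.inr a)) (Θ w) = ∑ b, D.ginv a b • Θ (fibDeriv (mom (.inr b)) w)
      + ∑ j, ∑ b, ∑ c, (D.dginv j a b * D.g b c) •
          (gen (WeakKoszul.fib c) * Θ (fibDeriv (mom (.inl j)) w)) := by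
  rw [h.fibDeriv_mom, Fintype.sum_sum_type, add_comm]
  have hp : gpar (mom (.inr a : Idx d m n)) = 0 := by rcases a with a | a <;> rfl
  simp [h.baseMom, h.fibMom, fibDeriv_mom_gen, fibDeriv_mul, fibDeriv_mom_fib, hp,
    Finset.sum_mul, -Fintype.sum_sum_type]

theorem IsChange.fibDeriv_vel_inl (h : D.IsChange Θ) (i : Fin d) (w : Fib d m n) :
    fibDeriv (vel (.inl i)) (Θ w) = ∑ j, D.J j i • Θ (fibDeriv (vel (.inl j)) w)
      - ∑ b, ∑ a, D.dg i b a • (gen (WeakKoszul.fib a) * Θ (fibDeriv (vel (.inr b)) w)) := by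
  rw [h.fibDeriv_vel, Fintype.sum_sum_type]
  simp [h.baseVel, h.fibVel, fibDeriv_vel_gen, fibDeriv_mul, fibDeriv_vel_fib,
    Finset.sum_mul, -Fintype.sum_sum_type, ← sub_eq_add_neg]

theorem IsChange.fibDeriv_vel_inr (h : D.IsChange Θ) (a : FibIdx m n) (w : Fib d m n) :
    fibDeriv (vel (.inr a)) (Θ w) = ∑ b, D.g b a • Θ (fibDeriv (vel (.inr b)) w) := by
  rw [h.fibDeriv_vel, Fintype.sum_sum_type]
  simp [h.baseVel, h.fibVel, fibDeriv_vel_gen, fibDeriv_mul, fibDeriv_vel_fib,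
    -Fintype.sum_sum_type]

/-- Only for the coordinates on `𝓜`. -/
theorem IsChange.fibDeriv_fib (h : D.IsChange Θ) (a : FibIdx m n) (w : Fib d m n)
    (h1 : ∀ A, fibDeriv (mom A) w = 0) (h2 : ∀ A, fibDeriv (vel A) w = 0) :
    fibDeriv (WeakKoszul.fib a) (Θ w) = ∑ b, D.g b a • Θ (fibDeriv (WeakKoszul.fib b) w) := by
  rw [h.chain_rule, sum_fibGen]
  simp [h1, h2, h.covel, h.fib, fibDeriv_fib_gen, -Fintype.sum_sum_type]

theorem sum_pairing {R : Type*} [Ring R] [Algebra ℝ R] {ι κ κ' : Type*} [Fintype ι] [Fintype κ]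
    [Fintype κ'] (A : ι → κ → ℝ) (B : κ' → ι → ℝ) (X : κ → R) (Y : κ' → R) :
    ∑ i, (∑ j, A i j • X j) * (∑ k, B k i • Y k) =
      ∑ j, ∑ k, (∑ i, B k i * A i j) • (X j * Y k) := by
  simp only [Finset.sum_mul_sum, Finset.sum_smul]
  rw [Finset.sum_comm]
  refine Finset.sum_congr rfl fun j _ => ?_
  rw [Finset.sum_comm]
  refine Finset.sum_congr rfl fun k _ => Finset.sum_congr rfl fun i _ => ?_
  rw [smul_mul_smul_comm, mul_comm]

/-- Invariance of the pairing of covectors with vectors under changes of coordinates. -/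
theorem IsInverse.contraction (hD : D.IsInverse) {R : Type*} [Ring R] [Algebra ℝ R]
    {s t u v : ℝ} (hs : s * t * u = -v) (N : FibIdx m n → R) (Xb Yb : Fin d → R)
    (Xf Yf : FibIdx m n → R) (hN : ∀ j c, Xb j * N c = t • (N c * Xb j)) :
    s • ∑ i, (∑ j, D.Jinv i j • Xb j) *
        (∑ k, D.J k i • Yb k - u • ∑ b, ∑ a, D.dg i b a • (N a * Yf b)) +
      v • ∑ a, (∑ b, D.ginv a b • Xf b +
        ∑ j, ∑ b, ∑ c, (D.dginv j a b * D.g b c) • (N c * Xb j)) * (∑ c, D.g c a • Yf c) =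
      s • ∑ k, Xb k * Yb k + v • ∑ b, Xf b * Yf b := by
  simp only [mul_sub, add_mul, Finset.sum_sub_distrib, Finset.sum_add_distrib]
  have e1 := sum_pairing D.Jinv D.J Xb Yb
  have e2 := sum_pairing D.ginv D.g Xf Yf
  simp only [hD.J_mul, hD.g_mul, ite_smul, one_smul, zero_smul, Finset.sum_ite_eq',
    Finset.mem_univ, if_true] at e1 e2
  have e3 := sum_pairing D.Jinv (fun (p : FibIdx m n × FibIdx m n) i => D.dg i p.1 p.2) Xb
    (fun p => N p.2 * Yf p.1)
  have e4 := sum_pairing (fun a (p : Fin d × FibIdx m n) => ∑ b, D.dginv p.1 a b * D.g b p.2)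
    D.g (fun p => N p.2 * Xb p.1) Yf
  simp only [Fintype.sum_prod_type] at e3 e4
  have e5 : ∀ a j, ∑ b, ∑ c, (D.dginv j a b * D.g b c) • (N c * Xb j) =
      ∑ c, (∑ b, D.dginv j a b * D.g b c) • (N c * Xb j) := fun a j => by
    simp only [Finset.sum_smul]
    exact Finset.sum_comm
  simp only [e5]
  rw [e1, e2]
  simp only [mul_smul_comm, ← Finset.smul_sum, e3, e4]
  -- Here the derivative of `g g⁻¹ = 1` turns the inhomogeneous term of the momenta into the one of
  -- the vectors.
  have e6 : ∀ j c b, ∑ a, D.g b a * ∑ b', D.dginv j a b' * D.g b' c =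
      -∑ i, D.dg i b c * D.Jinv i j := fun j c b => by
    rw [eq_neg_iff_add_eq_zero, add_comm]; exact hD.dg_add j b c
  simp only [e6, neg_smul, Finset.sum_neg_distrib]
  have e7 : ∑ j, ∑ b, ∑ a, (∑ i, D.dg i b a * D.Jinv i j) • (Xb j * (N a * Yf b)) =
      t • ∑ j, ∑ c, ∑ b, (∑ i, D.dg i b c * D.Jinv i j) • (N c * Xb j * Yf b) := by
    simp only [Finset.smul_sum]
    refine Finset.sum_congr rfl fun j _ => ?_
    rw [Finset.sum_comm]
    refine Finset.sum_congr rfl fun c _ => Finset.sum_congr rfl fun b _ => ?_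
    rw [← mul_assoc, hN, smul_mul_assoc, smul_comm]
  -- The two cross terms have coefficients `-s t u` and `-v` in front of the same sum, so the sign
  -- condition makes them cancel.
  obtain rfl : v = -(s * t * u) := by linarith
  rw [e7]
  module

/-- The contraction of the momentum derivatives of `a` with a vector is invariant. -/
theorem IsChange.sum_fibDeriv_mom_mul (h : D.IsChange Θ) (hD : D.IsInverse) {j : ℕ}
    {a : Fib d m n} (ha : (fibCalc d m n).IsPar j a) {s u v : ℝ}
    (hs : s * (-1) ^ (j + 1) * u = -v) (Y Y' : Idx d m n → Fib d m n)
    (hb : ∀ i, Y' (.inl i) = ∑ k, D.J k i • Θ (Y (.inl k)) - u • ∑ b, ∑ a, D.dg i b a •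
      (gen (WeakKoszul.fib a) * Θ (Y (.inr b))))
    (hf : ∀ a, Y' (.inr a) = ∑ b, D.g b a • Θ (Y (.inr b))) {c : Idx d m n → ℝ}
    (hcs : ∀ i, c (.inl i) = s) (hcv : ∀ a, c (.inr a) = v) :
    ∑ A, c A • (fibDeriv (mom A) (Θ a) * Y' A) = Θ (∑ A, c A • (fibDeriv (mom A) a * Y A)) := by
  rw [map_sum, Fintype.sum_sum_type fun A => c A • (fibDeriv (mom A) (Θ a) * Y' A),
    Fintype.sum_sum_type fun A => Θ (c A • (fibDeriv (mom A) a * Y A))]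
  simp only [hcs, hcv, hb, hf, map_smul, map_mul, ← Finset.smul_sum, h.fibDeriv_mom_inl,
    h.fibDeriv_mom_inr]
  refine hD.contraction (t := (-1) ^ (j + 1)) hs _ _ _ _ _ fun i z => ?_
  have hp : (fibCalc d m n).IsPar (j + 1) (Θ (fibDeriv (mom (.inl i)) a)) := by
    have := ha.D (mom (.inl i))
    rw [fibCalc_D, fibCalc_deg] at this
    change fibInvol _ = _
    rw [h.invol, show fibInvol _ = _ from this, map_smul]
    rfl
  have hz : (fibCalc d m n).IsPar 1 (gen (WeakKoszul.fib z)) := by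
    have := fibCalc_isPar_gen (WeakKoszul.fib (d := d) z)
    rcases z with z | z <;> exact this
  simpa using hp.mul_comm hz

end ChangeData
end coordinateChange

/-! ### Derivatives of curves in a vector space without topology -/

section derivative
variable {A B : Type*} [Ring A] [Algebra ℝ A] [AddCommGroup B] [Module ℝ B]

/-- A curve in a real vector space without topology, of finite rank near `0`, has the derivative
`γ'` at `0`. -/
inductive HasPolyDeriv : (ℝ → B) → B → Prop
  | smul_const {s : ℝ → ℝ} {s' : ℝ} (w : B) (h : HasDerivAt s s' 0) :
      HasPolyDeriv (fun t => s t • w) (s' • w)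
  | add {γ δ : ℝ → B} {γ' δ' : B} (h : HasPolyDeriv γ γ') (h' : HasPolyDeriv δ δ') :
      HasPolyDeriv (fun t => γ t + δ t) (γ' + δ')
  | congr {γ δ : ℝ → B} {γ' : B} (h : HasPolyDeriv γ γ') (e : γ =ᶠ[nhds 0] δ) :
      HasPolyDeriv δ γ'

namespace HasPolyDeriv

theorem congr_deriv {γ : ℝ → B} {γ' γ'' : B} (h : HasPolyDeriv γ γ') (e : γ' = γ'') :
    HasPolyDeriv γ γ'' := e ▸ h

theorem const (w : B) : HasPolyDeriv (fun _ => w) 0 := by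
  simpa using smul_const w (hasDerivAt_const (0 : ℝ) (1 : ℝ))

theorem sum {ι : Type*} {s : Finset ι} {γ : ι → ℝ → B} {γ' : ι → B}
    (h : ∀ i ∈ s, HasPolyDeriv (γ i) (γ' i)) :
    HasPolyDeriv (fun t => ∑ i ∈ s, γ i t) (∑ i ∈ s, γ' i) := by
  classical
  induction s using Finset.induction_on with
  | empty => simpa using const (0 : B)
  | insert i s hi ih =>
    simp only [Finset.sum_insert hi]
    exact (h i (Finset.mem_insert_self i s)).add
      (ih fun j hj => h j (Finset.mem_insert_of_mem hj))

theorem smul {γ : ℝ → B} {γ' : B} {s : ℝ → ℝ} {s' : ℝ} (hs : HasDerivAt s s' 0)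
    (h : HasPolyDeriv γ γ') : HasPolyDeriv (fun t => s t • γ t) (s' • γ 0 + s 0 • γ') := by
  induction h with
  | smul_const w hr =>
    have := smul_const w (hs.mul hr)
    simpa only [smul_smul, ← add_smul, Pi.mul_apply] using this
  | add _ _ h1 h2 =>
    have := h1.add h2
    simp only [← smul_add] at this
    convert this using 1
    simp only [smul_add]; abel
  | congr _ e ih =>
    rw [← e.eq_of_nhds]
    exact ih.congr (e.mono fun t ht => by simp only [ht])

theorem mul {γ δ : ℝ → A} {γ' δ' : A} (h : HasPolyDeriv γ γ') (h' : HasPolyDeriv δ δ') :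
    HasPolyDeriv (fun t => γ t * δ t) (γ' * δ 0 + γ 0 * δ') := by
  induction h with
  | @smul_const s s' w hs =>
    have hw : HasPolyDeriv (fun t => w * δ t) (w * δ') := by
      clear hs
      induction h' with
      | @smul_const r r' v hr => simpa only [mul_smul_comm] using smul_const (w * v) hr
      | add _ _ h1 h2 => simpa only [mul_add] using h1.add h2
      | congr _ e ih => exact ih.congr (e.mono fun t ht => by simp only [ht])
    simpa only [smul_mul_assoc] using hw.smul hs
  | add _ _ h1 h2 =>
    have := h1.add h2
    simp only [← add_mul] at this
    convert this using 1
    simp only [add_mul]; abel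
  | congr _ e ih =>
    rw [← e.eq_of_nhds]
    exact ih.congr (e.mono fun t ht => by simp only [ht])

theorem hasDerivAt_dual {γ : ℝ → B} {γ' : B} (h : HasPolyDeriv γ γ') (φ : Module.Dual ℝ B) :
    HasDerivAt (fun t => φ (γ t)) (φ γ') 0 := by
  induction h with
  | smul_const w hs => simpa only [map_smul, smul_eq_mul] using hs.mul_const (φ w)
  | add _ _ h1 h2 => simpa only [map_add] using! h1.add h2
  | congr _ e ih => exact ih.congr_of_eventuallyEq (e.mono fun t ht => by simp only [ht])

/-- Linear functionals turn such a curve into a real function with an ordinary derivative, and they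
separate the points of a real vector space. -/
theorem unique {γ : ℝ → B} {γ' γ'' : B} (h : HasPolyDeriv γ γ') (h' : HasPolyDeriv γ γ'') :
    γ' = γ'' := by
  rw [← sub_eq_zero, ← Module.forall_dual_apply_eq_zero_iff ℝ]
  intro φ
  rw [map_sub, sub_eq_zero]
  exact (h.hasDerivAt_dual φ).unique (h'.hasDerivAt_dual φ)

end HasPolyDeriv
end derivative

/-! ### Differentiating local functions and coordinate changes along curves -/

section curves
variable {d m n : ℕ} {Ω : TopologicalSpace.Opens (Model d)}

/-- `evalAt`, extended by zero. -/
def evalExt (y : Model d) : Loc m n Ω →ₗ[ℝ] Fib d m n :=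
  (TensorProduct.lid ℝ (Fib d m n)).toLinearMap ∘ₗ LinearMap.rTensor _
    { toFun := fun f : Smooth Ω => extZero Ω f y
      map_add' := fun f g => by
        by_cases hy : y ∈ Ω
        · simp [extZero_apply _ hy]
        · simp [extZero, Function.extend_apply' _ _ _ (show ¬∃ a : Ω, a.1 = y by simpa using hy)]
      map_smul' := fun r f => by
        by_cases hy : y ∈ Ω
        · simp [extZero_apply _ hy]
        · simp [extZero, Function.extend_apply' _ _ _ (show ¬∃ a : Ω, a.1 = y by simpa using hy)] }

theorem evalExt_tmul (y : Model d) (s : Smooth Ω) (w : Fib d m n) :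
    evalExt y (s ⊗ₜ[ℝ] w) = extZero Ω s y • w := rfl

theorem evalExt_eq {y : Model d} (hy : y ∈ Ω) (f : Loc m n Ω) : evalExt y f = evalAt ⟨y, hy⟩ f := by
  induction f using TensorProduct.induction_on with
  | zero => simp
  | add a b ha hb => rw [map_add, map_add, ha, hb]
  | tmul s w => rw [evalExt_tmul, evalAt_tmul, extZero_apply _ hy]

theorem evalAt_eq_evalExt (y : Ω) (f : Loc m n Ω) : evalAt y f = evalExt y.1 f :=
  (evalExt_eq y.2 f).symm

theorem hasDerivAt_extZero_comp {γ : ℝ → Model d} {v : Model d} (hγ : HasDerivAt γ v 0)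
    (h0 : γ 0 ∈ Ω) (s : Smooth Ω) :
    HasDerivAt (fun t => extZero Ω s (γ t)) (∑ k, v k * (baseDeriv Ω k s).1 ⟨γ 0, h0⟩) 0 := by
  have h := (smooth_differentiableAt s ⟨γ 0, h0⟩).hasFDerivAt.comp_hasDerivAt 0 hγ
  have hv : v = ∑ k, v k • EuclideanSpace.single k (1 : ℝ) := by
    ext i
    simp [Finset.sum_apply, Pi.single_apply]
  have e := congrArg (fderiv ℝ (extZero Ω s) (γ 0)) hv
  simp only [map_sum, map_smul, smul_eq_mul] at e
  exact h.congr_deriv e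

theorem hasPolyDeriv_evalExt {γ : ℝ → Model d} {v : Model d} (hγ : HasDerivAt γ v 0)
    (h0 : γ 0 ∈ Ω) (f : Loc m n Ω) :
    HasPolyDeriv (fun t => evalExt (γ t) f) (∑ k, v k • evalAt ⟨γ 0, h0⟩ (pdPos (.inl k) f)) := by
  induction f using TensorProduct.induction_on with
  | zero => simpa using HasPolyDeriv.const (0 : Fib d m n)
  | add a b ha hb => simpa only [map_add, smul_add, Finset.sum_add_distrib] using ha.add hb
  | tmul s w =>
    have := HasPolyDeriv.smul_const w (hasDerivAt_extZero_comp hγ h0 s)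
    simpa only [evalExt_tmul, pdPos_inl_tmul, evalAt_tmul, Finset.sum_smul, smul_smul] using this

theorem fibRestrict_isFib_gen (k : FibGen d m n) :
    fibRestrict isFib (gen k) = 0 ∨ ∃ z, k = fib z ∧ fibRestrict isFib (gen k) = gen k := by
  rw [fibRestrict_gen]
  by_cases h : isFib k
  · right
    rcases k with (a | a | a | a | a) | (a | a | a | a | a | a) <;> simp [isFib] at h
    · exact ⟨.inl a, rfl, rfl⟩
    · exact ⟨.inr a, rfl, rfl⟩
  · exact .inl (if_neg h)

/-- On polynomials in `η` and `c` the homomorphism depends on `t` only through `g`. Momenta are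
excluded because their images contain derivatives of the transition data, whose variation is not
controlled here. -/
theorem hasPolyDeriv_change {D : ℝ → ChangeData d m n} {Θ : ℝ → Fib d m n →ₐ[ℝ] Fib d m n}
    (hΘ : ∀ᶠ t in nhds 0, (D t).IsChange (Θ t)) {g' : FibIdx m n → FibIdx m n → ℝ}
    (hg : ∀ b a, HasDerivAt (fun t => (D t).g b a) (g' b a) 0) (w : Fib d m n) :
    HasPolyDeriv (fun t => Θ t (fibRestrict isFib w))
      (∑ b, ∑ a, g' b a • (gen (fib a) * Θ 0 (fibDeriv (fib b) (fibRestrict isFib w)))) := by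
  have h0 := hΘ.self_of_nhds
  induction w using fib_induction with
  | smul_one r =>
    simp only [AlgHom.commutes, fibDeriv_algebraMap, map_zero, mul_zero, smul_zero,
      Finset.sum_const_zero]
    exact .const _
  | gen k =>
    rcases fibRestrict_isFib_gen k with h | ⟨z, rfl, h⟩
    · simp only [h, map_zero, mul_zero, smul_zero, Finset.sum_const_zero]
      exact .const _
    · simp only [h, fibDeriv_fib_gen]
      have : HasPolyDeriv (fun t => ∑ a, (D t).g z a • gen (fib (d := d) a))
          (∑ a, g' z a • gen (fib a)) := .sum fun a _ => .smul_const _ (hg z a)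
      convert this.congr (hΘ.mono fun t ht => (ht.fib z).symm) using 1
      simp [apply_ite (Θ 0), -Fintype.sum_sum_type]
  | add a b ha hb =>
    simpa only [map_add, mul_add, smul_add, Finset.sum_add_distrib] using ha.add hb
  | mul u v hu hv =>
    have e : ∀ t, Θ t (fibRestrict isFib (u * v)) =
        Θ t (fibRestrict isFib u) * Θ t (fibRestrict isFib v) := fun t => by
      rw [map_mul, map_mul]
    simp only [e]
    refine HasPolyDeriv.congr_deriv (hu.mul hv) ?_
    rw [map_mul]
    simp only [Finset.sum_mul, Finset.mul_sum, ← Finset.sum_add_distrib]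
    refine Finset.sum_congr rfl fun b _ => Finset.sum_congr rfl fun a _ => ?_
    have hp : ∀ z, gpar (fib (d := d) (m := m) (n := n) z) = 1 := by rintro (z | z) <;> rfl
    -- The new factor is an odd generator; carrying it past `Θ u` produces the sign of the Leibniz
    -- rule for `∂/∂z^b`.
    have h1 := (ChangeData.fibCalc_isPar_gen (fib (d := d) a)).mul_eq_iterate_mul
      (Θ 0 (fibInvol (fibRestrict isFib u)))
    rw [hp, Function.iterate_one, fibCalc_σ, h0.invol, show fibInvol (fibInvol (fibRestrict isFib u)) = fibRestrict isFib u from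
      (fibCalc d m n).invol_invol _] at h1
    rw [fibDeriv_mul, hp, Function.iterate_one, map_add, map_mul, map_mul, mul_add, ← mul_assoc,
      ← mul_assoc, h1, smul_add, smul_mul_assoc, mul_smul_comm, mul_assoc (Θ 0 _)]

theorem hasPolyDeriv_change_evalExt {D : ℝ → ChangeData d m n}
    {Θ : ℝ → Fib d m n →ₐ[ℝ] Fib d m n}
    (hΘ : ∀ᶠ t in nhds 0, (D t).IsChange (Θ t)) {g' : FibIdx m n → FibIdx m n → ℝ}
    (hg : ∀ b a, HasDerivAt (fun t => (D t).g b a) (g' b a) 0) {γ : ℝ → Model d} {v : Model d}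
    (hγ : HasDerivAt γ v 0) (h0 : γ 0 ∈ Ω) (f : Loc m n Ω) :
    HasPolyDeriv (fun t => Θ t (evalExt (γ t) (restrict isFib f)))
      (∑ k, v k • Θ 0 (evalAt ⟨γ 0, h0⟩ (pdPos (.inl k) (restrict isFib f))) +
        ∑ b, ∑ a, g' b a • (gen (fib a) *
          Θ 0 (evalAt ⟨γ 0, h0⟩ (pdPos (.inr b) (restrict isFib f))))) := by
  induction f using TensorProduct.induction_on with
  | zero => simpa using HasPolyDeriv.const (0 : Fib d m n)
  | add a b ha hb =>
    simp only [map_add, smul_add, Finset.sum_add_distrib, mul_add]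
    convert ha.add hb using 1
    abel
  | tmul s w =>
    have := (hasPolyDeriv_change hΘ hg w).smul (hasDerivAt_extZero_comp hγ h0 s)
    simp only [restrict_tmul, evalExt_tmul, pdPos_inl_tmul, evalAt_tmul, map_smul]
    convert this using 2
    · simp only [Finset.sum_smul, smul_smul]
    · simp only [Finset.smul_sum]
      refine Finset.sum_congr rfl fun b _ => Finset.sum_congr rfl fun a _ => ?_
      rw [pdPos, pd_tmul, evalAt_tmul, extZero_apply _ h0, map_smul, mul_smul_comm, smul_comm]

end curves

/-! ### Smooth transition data of the manifold and of the bundles -/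

section charts
variable {d : ℕ} {M : Type*} [TopologicalSpace M] [ChartedSpace (Model d) M]

theorem fderiv_apply_eq_sum {G : Type*} [NormedAddCommGroup G] [NormedSpace ℝ G]
    (L : Model d →L[ℝ] G) (v : Model d) :
    L v = ∑ i, v i • L (EuclideanSpace.single i 1) := by
  have hv : v = ∑ k, v k • EuclideanSpace.single k (1 : ℝ) := by
    ext i
    simp [Finset.sum_apply, Pi.single_apply]
  conv_lhs => rw [hv]
  simp only [map_sum, map_smul]

theorem eventually_chart_symm_mem {p x : M} {s : Set M} (hs : s ∈ nhds x)
    (hp : x ∈ (chartAt (Model d) p).source) :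
    ∀ᶠ y in nhds (chartAt (Model d) p x), (chartAt (Model d) p).symm y ∈ s := by
  have := (chartAt (Model d) p).continuousAt_symm ((chartAt (Model d) p).map_source hp)
  rw [ContinuousAt, (chartAt (Model d) p).left_inv hp] at this
  exact this hs

end charts

section patches
variable {d m n : ℕ} {M : Type*} [TopologicalSpace M] [ChartedSpace (Model d) M]
  [IsManifold 𝓘(ℝ, Model d) ∞ M]

/-- A point covered by two charts, seen in the first one, and the transition map to the second. -/
theorem differentiableAt_chart_transition {p q x : M} (hp : x ∈ (chartAt (Model d) p).source)
    (hq : x ∈ (chartAt (Model d) q).source) :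
    DifferentiableAt ℝ (fun y => chartAt (Model d) q ((chartAt (Model d) p).symm y))
      (chartAt (Model d) p x) := by
  have h1 : ContMDiffAt 𝓘(ℝ, Model d) 𝓘(ℝ, Model d) ∞ (chartAt (Model d) p).symm
      (chartAt (Model d) p x) :=
    (contMDiffOn_chart_symm (I := 𝓘(ℝ, Model d)) (n := ∞) (x := p)).contMDiffAt
      ((chartAt (Model d) p).open_target.mem_nhds ((chartAt (Model d) p).map_source hp))
  have h2 : ContMDiffAt 𝓘(ℝ, Model d) 𝓘(ℝ, Model d) ∞ (chartAt (Model d) q)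
      ((chartAt (Model d) p).symm (chartAt (Model d) p x)) := by
    rw [(chartAt (Model d) p).left_inv hp]
    exact (contMDiffOn_chart (I := 𝓘(ℝ, Model d)) (n := ∞) (x := q)).contMDiffAt
      ((chartAt (Model d) q).open_source.mem_nhds hq)
  exact ((h2.comp _ h1).contDiffAt).differentiableAt (by simp)

/-- Chain rule for the transition map composed with its inverse, which is the identity near the
point. -/
theorem jac_mul_jac {p q x : M} (hp : x ∈ (chartAt (Model d) p).source)
    (hq : x ∈ (chartAt (Model d) q).source) (k j : Fin d) :
    ∑ i, jac p q x k i * jac q p x i j = if k = j then 1 else 0 := by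
  have h1 := (differentiableAt_chart_transition (d := d) hp hq).hasFDerivAt
  have h2 := (differentiableAt_chart_transition (d := d) hq hp).hasFDerivAt
  have e : (chartAt (Model d) p).symm (chartAt (Model d) p x) = x :=
    (chartAt (Model d) p).left_inv hp
  have e' : (chartAt (Model d) q).symm (chartAt (Model d) q x) = x :=
    (chartAt (Model d) q).left_inv hq
  have h3 : HasFDerivAt (fun y => chartAt (Model d) q ((chartAt (Model d) p).symm
      (chartAt (Model d) p ((chartAt (Model d) q).symm y)))) _ (chartAt (Model d) q x) :=
    HasFDerivAt.comp (g := fun y => chartAt (Model d) q ((chartAt (Model d) p).symm y))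
      (chartAt (Model d) q x) (by rw [e']; exact h1) h2
  have h4 : HasFDerivAt (fun y => y) (ContinuousLinearMap.id ℝ (Model d))
    (chartAt (Model d) q x) := hasFDerivAt_id _
  have h5 := h3.congr_of_eventuallyEq (f₁ := fun y => y) (by
    filter_upwards [(chartAt (Model d) q).open_target.mem_nhds
        ((chartAt (Model d) q).map_source hq),
      eventually_chart_symm_mem ((chartAt (Model d) p).open_source.mem_nhds hp) hq] with y hy hy'
    rw [(chartAt (Model d) p).left_inv hy', (chartAt (Model d) q).right_inv hy])
  have h6 := DFunLike.congr_fun (h5.unique h4) (EuclideanSpace.single j 1)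
  rw [ContinuousLinearMap.comp_apply, fderiv_apply_eq_sum] at h6
  have h7 := congrArg (fun v : Model d => v k) h6
  simp only [ContinuousLinearMap.id_apply, PiLp.single_apply] at h7
  rw [← h7]
  simp [jac, mul_comm]

end patches

section bundles
variable {d m : ℕ} {M : Type*} [TopologicalSpace M] [ChartedSpace (Model d) M]
  [IsManifold 𝓘(ℝ, Model d) ∞ M]
  {E : M → Type*} [TopologicalSpace (Bundle.TotalSpace (Model m) E)]
  [∀ x, TopologicalSpace (E x)] [FiberBundle (Model m) E]
  [∀ x, AddCommGroup (E x)] [∀ x, Module ℝ (E x)] [VectorBundle ℝ (Model m) E]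

/-- The transition matrix of a vector bundle. -/
def transMat (E : M → Type*) [TopologicalSpace (Bundle.TotalSpace (Model m) E)]
    [∀ x, TopologicalSpace (E x)] [FiberBundle (Model m) E]
    [∀ x, AddCommGroup (E x)] [∀ x, Module ℝ (E x)] [VectorBundle ℝ (Model m) E]
    (p q x : M) (b a : Fin m) : ℝ :=
  (trivializationAt (Model m) E p).coordChangeL ℝ (trivializationAt (Model m) E q) x
    (EuclideanSpace.single a 1) b

theorem transMat_mul {p q x : M} (hp : x ∈ (trivializationAt (Model m) E p).baseSet)
    (hq : x ∈ (trivializationAt (Model m) E q).baseSet) (c b : Fin m) :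
    ∑ a, transMat E p q x c a * transMat E q p x a b = if c = b then 1 else 0 := by
  have h1 : ((trivializationAt (Model m) E p).coordChangeL ℝ (trivializationAt (Model m) E q) x)
      ((trivializationAt (Model m) E q).coordChangeL ℝ (trivializationAt (Model m) E p) x
        (EuclideanSpace.single b 1)) = EuclideanSpace.single b 1 := by
    rw [← Bundle.Trivialization.symm_coordChangeL _ _ ⟨hq, hp⟩]
    exact ContinuousLinearEquiv.apply_symm_apply _ _
  have h2 := fderiv_apply_eq_sum (((trivializationAt (Model m) E p).coordChangeL ℝ
    (trivializationAt (Model m) E q) x : Model m →L[ℝ] Model m))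
      ((trivializationAt (Model m) E q).coordChangeL ℝ (trivializationAt (Model m) E p) x
        (EuclideanSpace.single b 1))
  have h3 := congrArg (fun v : Model m => v c) (h2.symm.trans h1)
  simp only [PiLp.single_apply] at h3
  rw [← h3]
  simp [transMat, mul_comm]

theorem differentiableAt_transMat [ContMDiffVectorBundle ∞ (Model m) E 𝓘(ℝ, Model d)]
    {p q r x : M} (hr : x ∈ (chartAt (Model d) r).source)
    (hp : x ∈ (trivializationAt (Model m) E p).baseSet)
    (hq : x ∈ (trivializationAt (Model m) E q).baseSet) (b a : Fin m) :
    DifferentiableAt ℝ (fun y => transMat E p q ((chartAt (Model d) r).symm y) b a)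
      (chartAt (Model d) r x) := by
  have h1 : ContMDiffAt 𝓘(ℝ, Model d) 𝓘(ℝ, Model d) ∞ (chartAt (Model d) r).symm
      (chartAt (Model d) r x) :=
    (contMDiffOn_chart_symm (I := 𝓘(ℝ, Model d)) (n := ∞) (x := r)).contMDiffAt
      ((chartAt (Model d) r).open_target.mem_nhds ((chartAt (Model d) r).map_source hr))
  have h2 : ContMDiffAt 𝓘(ℝ, Model d) 𝓘(ℝ, Model m →L[ℝ] Model m) ∞
      (fun x => ((trivializationAt (Model m) E p).coordChangeL ℝ (trivializationAt (Model m) E q) x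
        : Model m →L[ℝ] Model m)) ((chartAt (Model d) r).symm (chartAt (Model d) r x)) := by
    rw [(chartAt (Model d) r).left_inv hr]
    exact (contMDiffOn_coordChangeL _ _).contMDiffAt
      (((trivializationAt (Model m) E p).open_baseSet.inter
        (trivializationAt (Model m) E q).open_baseSet).mem_nhds ⟨hp, hq⟩)
  have h3 := ((h2.comp _ h1).contDiffAt).differentiableAt (by simp)
  have h4 := h3.clm_apply (differentiableAt_const (EuclideanSpace.single a (1 : ℝ)))
  exact (EuclideanSpace.proj b : Model m →L[ℝ] ℝ).differentiableAt.comp _ h4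

end bundles

section patchSource
variable {d m n : ℕ} {M : Type*} [TopologicalSpace M] [ChartedSpace (Model d) M]
  {E : M → Type*} [TopologicalSpace (Bundle.TotalSpace (Model m) E)]
  [∀ x, TopologicalSpace (E x)] [FiberBundle (Model m) E]
  {F : M → Type*} [TopologicalSpace (Bundle.TotalSpace (Model n) F)]
  [∀ x, TopologicalSpace (F x)] [FiberBundle (Model n) F]

theorem isOpen_patchSource (p : M) : IsOpen (patchSource (d := d) (m := m) (n := n) E F p) :=
  (chartAt (Model d) p).open_source.inter ((trivializationAt (Model m) E p).open_baseSet.inter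
    (trivializationAt (Model n) F p).open_baseSet)

end patchSource

/-! ### Compatibility of local expressions on overlaps -/

section compatibility
variable {d m n : ℕ} {M : Type*} [TopologicalSpace M] [ChartedSpace (Model d) M]
  (E : M → Type*) [TopologicalSpace (Bundle.TotalSpace (Model m) E)]
  [∀ x, TopologicalSpace (E x)] [FiberBundle (Model m) E]
  [∀ x, AddCommGroup (E x)] [∀ x, Module ℝ (E x)] [VectorBundle ℝ (Model m) E]
  (F : M → Type*) [TopologicalSpace (Bundle.TotalSpace (Model n) F)]
  [∀ x, TopologicalSpace (F x)] [FiberBundle (Model n) F]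
  [∀ x, AddCommGroup (F x)] [∀ x, Module ℝ (F x)] [VectorBundle ℝ (Model n) F]

/-- The change of coordinates from the patch `q` to the patch `p` over `x`. -/
def changeData (p q x : M) : ChangeData d m n where
  J := jac p q x
  Jinv := jac q p x
  g := trans E F p q x
  ginv := trans E F q p x
  dg := dtrans E F p q x
  dginv := dtrans E F q p x

theorem fibRestrict_notCovel_gen {g : FibGen d m n} (h : notCovel g = true) :
    fibRestrict notCovel (gen g) = gen g := by
  rw [fibRestrict_gen, if_pos h]

variable {E F}

/-- The given homomorphism is arbitrary on the `dφ*`; killing these first normalises it without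
affecting functions that do not contain them. -/
theorem IsCoordChange.isChange {p q x : M} {Θ : Fib d m n →ₐ[ℝ] Fib d m n}
    (h : IsCoordChange E F p q x Θ) :
    (changeData E F p q x).IsChange (Θ.comp (fibRestrict notCovel)) := by
  have hf : ∀ z, fibRestrict notCovel (gen (WeakKoszul.fib (d := d) (m := m) (n := n) z)) =
      gen (WeakKoszul.fib z) := by
    rintro (z | z) <;> exact fibRestrict_notCovel_gen rfl
  have hm : ∀ A, fibRestrict notCovel (gen (mom (d := d) (m := m) (n := n) A)) = gen (mom A) := by
    rintro (z | z | z) <;> exact fibRestrict_notCovel_gen rfl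
  have hv : ∀ A, fibRestrict notCovel (gen (vel (d := d) (m := m) (n := n) A)) = gen (vel A) := by
    rintro (z | z | z) <;> exact fibRestrict_notCovel_gen rfl
  have hc : ∀ A, fibRestrict notCovel (gen (covel (d := d) (m := m) (n := n) A)) = 0 := by
    rintro (z | z | z) <;> rw [fibRestrict_gen] <;> rfl
  constructor
  · intro b; rw [AlgHom.comp_apply, hf]; exact h.fib b
  · intro b; rw [AlgHom.comp_apply, hm]; exact h.fibMom b
  · intro b; rw [AlgHom.comp_apply, hm]; exact h.baseMom b
  · intro b; rw [AlgHom.comp_apply, hv]; exact h.baseVel b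
  · intro b; rw [AlgHom.comp_apply, hv]; exact h.fibVel b
  · intro A; rw [AlgHom.comp_apply, hc, map_zero]

theorem ChangeData.IsChange.isCoordChange {p q x : M} {Θ : Fib d m n →ₐ[ℝ] Fib d m n}
    (h : (changeData E F p q x).IsChange Θ) : IsCoordChange E F p q x Θ :=
  ⟨h.fib, h.fibMom, h.baseMom, h.baseVel, h.fibVel⟩

theorem IsCompatible.exists_isChange {f : Fam d m n E F} (hf : IsCompatible f)
    (hn : ∀ p A, pd (covel A) (f p) = 0) (p q x : M)
    (hp : x ∈ patchSource (d := d) (m := m) (n := n) E F p)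
    (hq : x ∈ patchSource (d := d) (m := m) (n := n) E F q) :
    ∃ Θ, (changeData E F p q x).IsChange Θ ∧
      evalAt (toPatch E F p ⟨x, hp⟩) (f p) = Θ (evalAt (toPatch E F q ⟨x, hq⟩) (f q)) := by
  obtain ⟨Θ, h1, h2⟩ := hf p q x hp hq
  refine ⟨_, h1.isChange, ?_⟩
  rw [h2, AlgHom.comp_apply, ← evalAt_restrict, restrict_notCovel (hn q)]

/-- Uniqueness of the normalised change lets any one witness serve for every compatible family. -/
theorem IsCompatible.evalAt_eq {f : Fam d m n E F} (hf : IsCompatible f)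
    (hn : ∀ p A, pd (covel A) (f p) = 0) {p q x : M}
    (hp : x ∈ patchSource (d := d) (m := m) (n := n) E F p)
    (hq : x ∈ patchSource (d := d) (m := m) (n := n) E F q) {Θ : Fib d m n →ₐ[ℝ] Fib d m n}
    (hΘ : (changeData E F p q x).IsChange Θ) :
    evalAt (toPatch E F p ⟨x, hp⟩) (f p) = Θ (evalAt (toPatch E F q ⟨x, hq⟩) (f q)) := by
  obtain ⟨Θ', h1, h2⟩ := hf.exists_isChange hn p q x hp hq
  rw [hΘ.unique h1, h2]

theorem trans_mul {p q x : M} (hp : x ∈ patchSource (d := d) (m := m) (n := n) E F p)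
    (hq : x ∈ patchSource (d := d) (m := m) (n := n) E F q) (c b : FibIdx m n) :
    ∑ a, trans E F p q x c a * trans E F q p x a b = if c = b then 1 else 0 := by
  rw [Fintype.sum_sum_type]
  rcases c with c | c <;> rcases b with b | b
  · simpa [trans, transMat] using transMat_mul hp.2.1 hq.2.1 c b
  · simp [trans]
  · simp [trans]
  · simpa [trans, transMat] using transMat_mul hp.2.2 hq.2.2 c b

variable [IsManifold 𝓘(ℝ, Model d) ∞ M]
  [ContMDiffVectorBundle ∞ (Model m) E 𝓘(ℝ, Model d)]
  [ContMDiffVectorBundle ∞ (Model n) F 𝓘(ℝ, Model d)]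

theorem differentiableAt_trans {p q r x : M}
    (hr : x ∈ (chartAt (Model d) r).source)
    (hp : x ∈ patchSource (d := d) (m := m) (n := n) E F p)
    (hq : x ∈ patchSource (d := d) (m := m) (n := n) E F q) (b a : FibIdx m n) :
    DifferentiableAt ℝ (fun y => trans E F p q ((chartAt (Model d) r).symm y) b a)
      (chartAt (Model d) r x) := by
  rcases b with b | b <;> rcases a with a | a
  · exact differentiableAt_transMat hr hp.2.1 hq.2.1 b a
  · exact differentiableAt_const _
  · exact differentiableAt_const _
  · exact differentiableAt_transMat hr hp.2.2 hq.2.2 b a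

theorem fderiv_chart_symm_eq_sum {p q x : M} (hp : x ∈ (chartAt (Model d) p).source)
    (hq : x ∈ (chartAt (Model d) q).source) {h : M → ℝ}
    (hh : DifferentiableAt ℝ (fun y => h ((chartAt (Model d) p).symm y)) (chartAt (Model d) p x))
    (j : Fin d) :
    fderiv ℝ (fun y => h ((chartAt (Model d) q).symm y)) (chartAt (Model d) q x)
        (EuclideanSpace.single j 1) =
      ∑ i, fderiv ℝ (fun y => h ((chartAt (Model d) p).symm y)) (chartAt (Model d) p x)
        (EuclideanSpace.single i 1) * jac q p x i j := by
  have e' : (chartAt (Model d) q).symm (chartAt (Model d) q x) = x :=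
    (chartAt (Model d) q).left_inv hq
  have h2 := (differentiableAt_chart_transition (d := d) hq hp).hasFDerivAt
  have h3 : HasFDerivAt (fun y => h ((chartAt (Model d) p).symm
      (chartAt (Model d) p ((chartAt (Model d) q).symm y)))) _ (chartAt (Model d) q x) :=
    HasFDerivAt.comp (g := fun y => h ((chartAt (Model d) p).symm y))
      (chartAt (Model d) q x) (by rw [e']; exact hh.hasFDerivAt) h2
  have h5 := h3.congr_of_eventuallyEq (f₁ := fun y => h ((chartAt (Model d) q).symm y)) (by
    filter_upwards [eventually_chart_symm_mem
      ((chartAt (Model d) p).open_source.mem_nhds hp) hq] with y hy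
    rw [(chartAt (Model d) p).left_inv hy])
  rw [h5.fderiv, ContinuousLinearMap.comp_apply, fderiv_apply_eq_sum]
  simp [jac, mul_comm]

theorem changeData_isInverse {p q x : M}
    (hp : x ∈ patchSource (d := d) (m := m) (n := n) E F p)
    (hq : x ∈ patchSource (d := d) (m := m) (n := n) E F q) :
    (changeData (d := d) (m := m) (n := n) E F p q x).IsInverse where
  J_mul := jac_mul_jac hp.1 hq.1
  g_mul := trans_mul hp hq
  dg_add j b a := by
    have h1 := fderiv_chart_symm_eq_sum (h := fun y => trans E F p q y b a) hp.1 hq.1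
      (differentiableAt_trans hp.1 hp hq b a) j
    change ∑ i, dtrans E F p q x i b a * jac q p x i j + ∑ a', trans E F p q x b a' *
      ∑ b', dtrans E F q p x j a' b' * trans E F p q x b' a = 0
    have e' : (chartAt (Model d) q).symm (chartAt (Model d) q x) = x :=
      (chartAt (Model d) q).left_inv hq.1
    -- Differentiate `g g⁻¹ = 1` in the chart `q`. Multiplying by `g` on the right then isolates
    -- `∂g`, and the chain rule expresses it through the chart `p`.
    have key : ∀ b', ∑ a', (fderiv ℝ (fun y => trans E F p q ((chartAt (Model d) q).symm y) b a')
        (chartAt (Model d) q x) (EuclideanSpace.single j 1) * trans E F q p x a' b' +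
        trans E F p q x b a' * dtrans E F q p x j a' b') = 0 := by
      intro b'
      have h2 : HasFDerivAt (fun y => ∑ a', trans E F p q ((chartAt (Model d) q).symm y) b a' *
          trans E F q p ((chartAt (Model d) q).symm y) a' b') _ (chartAt (Model d) q x) :=
        HasFDerivAt.fun_sum fun a' _ =>
          (differentiableAt_trans hq.1 hp hq b a').hasFDerivAt.mul
            (differentiableAt_trans hq.1 hq hp a' b').hasFDerivAt
      have h3 := h2.congr_of_eventuallyEq (f₁ := fun _ => if b = b' then (1 : ℝ) else 0) (by
        filter_upwards [eventually_chart_symm_mem (((isOpen_patchSource p).inter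
          (isOpen_patchSource q)).mem_nhds ⟨hp, hq⟩) hq.1] with y hy
        exact (trans_mul hy.1 hy.2 b b').symm)
      have h4 := DFunLike.congr_fun (h3.unique (hasFDerivAt_const _ _))
        (EuclideanSpace.single j 1)
      rw [← show _ = (0 : ℝ) from h4]
      simp only [sum_apply, add_apply, smul_apply, smul_eq_mul, e']
      refine Finset.sum_congr rfl fun a' _ => ?_
      rw [add_comm, mul_comm (fderiv _ _ _ _)]
      rfl
    have h5 : ∑ b', (∑ a', (fderiv ℝ (fun y => trans E F p q ((chartAt (Model d) q).symm y) b a')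
        (chartAt (Model d) q x) (EuclideanSpace.single j 1) * trans E F q p x a' b' +
        trans E F p q x b a' * dtrans E F q p x j a' b')) * trans E F p q x b' a = 0 := by
      simp only [key, zero_mul, Finset.sum_const_zero]
    rw [← h5]
    change fderiv ℝ _ _ _ = ∑ i, dtrans E F p q x i b a * jac q p x i j at h1
    rw [← h1]
    simp only [Finset.sum_add_distrib, add_mul, Finset.sum_mul, Finset.mul_sum]
    congr 1
    · rw [Finset.sum_comm]
      simp only [mul_assoc, ← Finset.mul_sum, trans_mul hq hp]
      simp [-Fintype.sum_sum_type]
    · rw [Finset.sum_comm]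
      simp only [mul_assoc]

/-- The derivatives along `M` of a function on `𝓜`, in two patches. -/
theorem IsCompatible.evalAt_pdPos_inl {f : Fam d m n E F} (hf : IsCompatible f) {l : ℤ}
    (h : ∀ p, HasType 0 0 l (f p)) {p q x : M}
    (hp : x ∈ patchSource (d := d) (m := m) (n := n) E F p)
    (hq : x ∈ patchSource (d := d) (m := m) (n := n) E F q) {Θ : Fib d m n →ₐ[ℝ] Fib d m n}
    (hΘ : (changeData E F p q x).IsChange Θ) (i : Fin d) :
    evalAt (toPatch E F p ⟨x, hp⟩) (pdPos (.inl i) (f p)) =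
      ∑ k, jac p q x k i • Θ (evalAt (toPatch E F q ⟨x, hq⟩) (pdPos (.inl k) (f q))) +
        ∑ b, ∑ a, dtrans E F p q x i b a •
          (gen (fib a) * Θ (evalAt (toPatch E F q ⟨x, hq⟩) (pdPos (.inr b) (f q)))) := by
  have hn : ∀ p A, pd (covel A) (f p) = 0 := fun p => (h p).pd_covel
  set y := chartAt (Model d) p x with hy
  have e : (chartAt (Model d) p).symm y = x := (chartAt (Model d) p).left_inv hp.1
  -- Compatibility is differentiated along the `i`-th coordinate line of the chart `p`; the chart
  -- `q` sees a curve whose velocity is a column of the Jacobian.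
  let c : ℝ → Model d := fun t => y + t • EuclideanSpace.single i 1
  have hc0 : c 0 = y := by simp [c]
  have hc : HasDerivAt c (EuclideanSpace.single i 1) 0 := by
    exact (((hasDerivAt_id (0 : ℝ)).smul_const (EuclideanSpace.single i (1 : ℝ))).const_add
      y).congr_deriv (one_smul _ _)
  let X : ℝ → M := fun t => (chartAt (Model d) p).symm (c t)
  have hX0 : X 0 = x := by simp only [X, hc0, e]
  have hγ : HasDerivAt (fun t => chartAt (Model d) q (X t))
      (fderiv ℝ (fun y => chartAt (Model d) q ((chartAt (Model d) p).symm y)) y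
        (EuclideanSpace.single i 1)) 0 :=
    HasFDerivAt.comp_hasDerivAt
      (l := fun y => chartAt (Model d) q ((chartAt (Model d) p).symm y)) 0
      (by rw [hc0]; exact (differentiableAt_chart_transition hp.1 hq.1).hasFDerivAt) hc
  have hU : ∀ᶠ t in nhds 0, c t ∈ (chartAt (Model d) p).target ∧
      X t ∈ patchSource (d := d) (m := m) (n := n) E F p ∩
        patchSource (d := d) (m := m) (n := n) E F q := by
    refine hc.continuousAt.eventually (p := fun z => z ∈ (chartAt (Model d) p).target ∧
      (chartAt (Model d) p).symm z ∈ _) ?_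
    rw [hc0]
    exact Filter.Eventually.and
      ((chartAt (Model d) p).open_target.mem_nhds ((chartAt (Model d) p).map_source hp.1))
      (eventually_chart_symm_mem (((isOpen_patchSource p).inter
          (isOpen_patchSource q)).mem_nhds ⟨hp, hq⟩) hp.1)
  have hex : ∀ t, ∃ Θ : Fib d m n →ₐ[ℝ] Fib d m n, (c t ∈ (chartAt (Model d) p).target ∧
      X t ∈ patchSource (d := d) (m := m) (n := n) E F p ∩
        patchSource (d := d) (m := m) (n := n) E F q) →
      (changeData E F p q (X t)).IsChange Θ ∧
        evalExt (c t) (f p) = Θ (evalExt (chartAt (Model d) q (X t)) (f q)) := by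
    intro t
    by_cases ht : c t ∈ (chartAt (Model d) p).target ∧
      X t ∈ patchSource (d := d) (m := m) (n := n) E F p ∩
        patchSource (d := d) (m := m) (n := n) E F q
    · obtain ⟨Θ, h1, h2⟩ := hf.exists_isChange hn p q (X t) ht.2.1 ht.2.2
      refine ⟨Θ, fun _ => ⟨h1, ?_⟩⟩
      rw [evalAt_eq_evalExt, evalAt_eq_evalExt] at h2
      rwa [show c t = (toPatch E F p ⟨X t, ht.2.1⟩).1 from
        ((chartAt (Model d) p).right_inv ht.1).symm]
    -- Off the overlap any homomorphism will do, since only the germ at `t = 0` is used.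
    · exact ⟨AlgHom.id ℝ _, fun h => absurd h ht⟩
  choose Θt hΘt using hex
  have hΘ0 : Θt 0 = Θ := by
    have := (hΘt 0 hU.self_of_nhds).1
    rw [hX0] at this
    exact this.unique hΘ
  have hg : ∀ b a, HasDerivAt (fun t => (changeData (d := d) E F p q (X t)).g b a)
      (dtrans E F p q x i b a) 0 := fun b a =>
    HasFDerivAt.comp_hasDerivAt
      (l := fun y => trans E F p q ((chartAt (Model d) p).symm y) b a) 0
      (by rw [hc0]; exact (differentiableAt_trans hp.1 hp hq b a).hasFDerivAt) hc
  have hp0 : c 0 ∈ patch (d := d) (m := m) (n := n) E F p := by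
    rw [hc0]; exact (toPatch E F p ⟨x, hp⟩).2
  have hq0 : chartAt (Model d) q (X 0) ∈ patch (d := d) (m := m) (n := n) E F q := by
    rw [hX0]; exact (toPatch E F q ⟨x, hq⟩).2
  have h1 := hasPolyDeriv_evalExt hc hp0 (f p)
  have h2 := hasPolyDeriv_change_evalExt (hU.mono fun t ht => (hΘt t ht).1) hg hγ hq0 (f q)
  -- `f` depends only on `x`, `η` and `c`, so restricting to these coordinates changes nothing.
  rw [(h q).restrict_isFib] at h2
  have h3 := h1.unique (h2.congr (hU.mono fun t ht => ((hΘt t ht).2).symm))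
  simp only [evalAt_eq_evalExt, hc0, hX0, hΘ0] at h3 ⊢
  refine Eq.trans ?_ h3
  simp
  rfl

end compatibility

/-! ### Brackets with lifts, without restriction to `𝓛` -/

section localForms
variable {d m n : ℕ} {Ω : TopologicalSpace.Opens (Model d)}

theorem HasType.br_lift {k j v l : ℤ} {a θ : Loc m n Ω} (ha : HasType k 0 j a)
    (hθ : HasType 0 v l θ) :
    HasType (k - 1) v (j - 1 + l)
      ((locCalc m n Ω).br ((locCalc m n Ω).br (canonDelta m n Ω) a) θ) :=
  (ha.br_canonDelta.br hθ).congr (by ring) (by ring) rfl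

theorem HasType.br_br_lift {k j v l w l' : ℤ} {a θ τ : Loc m n Ω} (ha : HasType k 0 j a)
    (hθ : HasType 0 v l θ) (hτ : HasType 0 w l' τ) :
    HasType (k - 2) (v + w - 1) (j - 1 + l + l') ((locCalc m n Ω).br
      ((locCalc m n Ω).br ((locCalc m n Ω).br (canonDelta m n Ω) a) θ) τ) :=
  ((ha.br_lift hθ).br hτ).congr (by ring) rfl rfl

theorem unary_lift_eq {S : Formal m n Ω} {j v l : ℤ} {θ : Loc m n Ω} (hS : HasType 1 0 j (S 1))
    (hθ : HasType 0 v l θ) :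
    unary (lift S) θ = (locCalc m n Ω).br ((locCalc m n Ω).br (canonDelta m n Ω) (S 1)) θ := by
  rw [unary_eq, lift_apply, ((hS.br_lift hθ).congr (sub_self 1) rfl rfl).restrict_onL]

theorem binary_lift_eq {S : Formal m n Ω} {j v l w l' : ℤ} {θ τ : Loc m n Ω}
    (hS : HasType 2 0 j (S 2)) (hθ : HasType 0 v l θ) (hτ : HasType 0 w l' τ) :
    binary (lift S) θ τ = (locCalc m n Ω).br
      ((locCalc m n Ω).br ((locCalc m n Ω).br (canonDelta m n Ω) (S 2)) θ) τ := by
  rw [binary_eq, lift_apply, ((hS.br_br_lift hθ hτ).congr (sub_self 2) rfl rfl).restrict_onL]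

theorem smooth_sum_mul_apply {ι : Type*} [Fintype ι] (u v : ι → Smooth Ω) (y : Ω) :
    (∑ i, u i * v i).1 y = ∑ i, (u i).1 y * (v i).1 y := by
  change baseEval y (∑ i, u i * v i) = _
  rw [map_sum]
  rfl

theorem HasType.sum_evalAt_pdPos {G : Loc m n Ω} (hG : HasType 0 0 0 G) (Y : Fin d → ℝ) (y : Ω) :
    ∑ i, Y i • evalAt y (pdPos (.inl i) (WeakKoszul.restrict onTM G)) =
      (∑ i, Y i * (constPart m n _ (pdPos (.inl i) G)).1 y) • (1 : Fib d m n) := by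
  simp only [hG.evalAt_pdPos_restrict_onTM, smul_smul, Finset.sum_smul]

theorem isPar_evalAt {j : ℕ} {f : Loc m n Ω} (h : (locCalc m n Ω).IsPar j f) (y : Ω) :
    (fibCalc d m n).IsPar j (evalAt y f) := by
  change fibInvol _ = _
  rw [← evalAt_invol, show invol f = _ from h, map_smul]

end localForms

/-! ### Global forms and the compatibility of their brackets -/

section forms
variable {d m n : ℕ} {M : Type*} [TopologicalSpace M] [ChartedSpace (Model d) M]
  {E : M → Type*} [TopologicalSpace (Bundle.TotalSpace (Model m) E)]
  [∀ x, TopologicalSpace (E x)] [FiberBundle (Model m) E]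
  [∀ x, AddCommGroup (E x)] [∀ x, Module ℝ (E x)] [VectorBundle ℝ (Model m) E]
  {F : M → Type*} [TopologicalSpace (Bundle.TotalSpace (Model n) F)]
  [∀ x, TopologicalSpace (F x)] [FiberBundle (Model n) F]
  [∀ x, AddCommGroup (F x)] [∀ x, Module ℝ (F x)] [VectorBundle ℝ (Model n) F]

theorem IsForm.add {k l : ℤ} {θ τ : Fam d m n E F} (hθ : IsForm k l θ) (hτ : IsForm k l τ) :
    IsForm k l fun p => θ p + τ p := by
  refine isForm_of_hasType (fun p q x hp hq => ?_) fun p => (hθ.hasType p).add (hτ.hasType p)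
  obtain ⟨Θ, h, e⟩ := hθ.compatible.exists_isChange hθ.noCovel p q x hp hq
  refine ⟨Θ, h.isCoordChange, ?_⟩
  rw [map_add, map_add, map_add, e, hτ.compatible.evalAt_eq hτ.noCovel hp hq h]

theorem IsForm.neg {k l : ℤ} {θ : Fam d m n E F} (hθ : IsForm k l θ) :
    IsForm k l fun p => -θ p := by
  refine isForm_of_hasType (fun p q x hp hq => ?_) fun p => (hθ.hasType p).neg
  obtain ⟨Θ, h, e⟩ := hθ.compatible p q x hp hq
  exact ⟨Θ, h, by rw [map_neg, map_neg, map_neg, e]⟩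

theorem IsForm.congr {k k' l l' : ℤ} {θ : Fam d m n E F} (hθ : IsForm k l θ) (hk : k = k')
    (hl : l = l') : IsForm k' l' θ := hk ▸ hl ▸ hθ

variable [IsManifold 𝓘(ℝ, Model d) ∞ M]
  [ContMDiffVectorBundle ∞ (Model m) E 𝓘(ℝ, Model d)]
  [ContMDiffVectorBundle ∞ (Model n) F 𝓘(ℝ, Model d)]

/-- The bracket is the contraction of `∂a/∂φ*` with `∂θ/∂dφ`, hence independent of coordinates. -/
theorem IsCompatible.br_form {k j l : ℤ} {a θ : Fam d m n E F} (ha : IsCompatible a)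
    (hθ : IsCompatible θ) (hta : ∀ p, HasType k 0 j (a p)) (htθ : ∀ p, HasType 0 1 l (θ p)) :
    IsCompatible fun p => (locCalc m n _).br (a p) (θ p) := by
  intro p q x hp hq
  obtain ⟨Θ, h, e⟩ := ha.exists_isChange (fun p => (hta p).pd_covel) p q x hp hq
  refine ⟨Θ, h.isCoordChange, ?_⟩
  beta_reduce
  rw [br_eq_sum (hta p) (htθ p), br_eq_sum (hta q) (htθ q), map_sum, map_sum]
  simp only [map_smul, evalAt_mul, evalAt_pd]
  rw [e, hθ.evalAt_eq (fun p => (htθ p).pd_covel') hp hq h]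
  refine (h.sum_fibDeriv_mom_mul (changeData_isInverse hp hq) (isPar_evalAt (hta q).par _)
    -- `s` and `v` are the signs of the even and odd indices `A` in the bracket; `u = 1` matches the
    -- term `-∂g dx z` in the transformation of the fibre velocities.
    (s := (-1) ^ j.natAbs) (u := 1) (v := 1) ?_
    (fun A => fibDeriv (vel A) (evalAt (toPatch E F q ⟨x, hq⟩) (θ q)))
    (fun A => fibDeriv (vel A) (Θ (evalAt (toPatch E F q ⟨x, hq⟩) (θ q)))) (fun i => ?_)
    (fun a => h.fibDeriv_vel_inr a _) (fun i => ?_) fun a => ?_).trans ?_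
  · rw [mul_one, ← pow_add, Odd.neg_one_pow ⟨j.natAbs, by ring⟩]
  · rw [one_smul]; exact h.fibDeriv_vel_inl i _
  · simp [par]
  · simp [par]
  · rw [map_sum]

/-- The same contraction, now with the derivatives `∂f/∂φ`. -/
theorem IsCompatible.br_lift {k j l : ℤ} {a f : Fam d m n E F} (ha : IsCompatible a)
    (hf : IsCompatible f) (hta : ∀ p, HasType k 0 j (a p)) (htf : ∀ p, HasType 0 0 l (f p)) :
    IsCompatible fun p =>
      (locCalc m n _).br ((locCalc m n _).br (canonDelta m n _) (a p)) (f p) := by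
  intro p q x hp hq
  obtain ⟨Θ, h, e⟩ := ha.exists_isChange (fun p => (hta p).pd_covel) p q x hp hq
  refine ⟨Θ, h.isCoordChange, ?_⟩
  beta_reduce
  rw [br_lift_eq_sum (hta p) (htf p), br_lift_eq_sum (hta q) (htf q), map_sum, map_sum]
  simp only [map_smul, evalAt_mul, evalAt_pd]
  rw [e]
  refine (h.sum_fibDeriv_mom_mul (changeData_isInverse hp hq) (isPar_evalAt (hta q).par _)
    -- `u = -1` because `∂/∂x` acquires the term `+∂g z ∂/∂z`, of sign opposite to that for the
    -- velocities.
    (s := -1) (u := -1) (v := -(-1) ^ (j.natAbs + 1)) ?_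
    (fun A => evalAt (toPatch E F q ⟨x, hq⟩) (pdPos A (f q)))
    (fun A => evalAt (toPatch E F p ⟨x, hp⟩) (pdPos A (f p))) (fun i => ?_)
    (fun a => ?_) (fun i => ?_) fun a => ?_).trans ?_
  · ring
  · rw [neg_smul, one_smul, sub_neg_eq_add]
    exact hf.evalAt_pdPos_inl htf hp hq h i
  · simp only [pdPos, evalAt_pd]
    rw [hf.evalAt_eq (fun p => (htf p).pd_covel) hp hq h]
    refine h.fibDeriv_fib a _ (fun A => ?_) fun A => ?_
    · rw [← evalAt_pd, (htf q).pd_mom, map_zero]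
    · rw [← evalAt_pd, (htf q).pd_vel, map_zero]
  · simp [par]
  · simp [par]
  · rw [map_sum]

/-- The double bracket is a `br_lift` applied to the function `{a, θ}` on `𝓝`; that function is
global by `br_form`. -/
theorem IsForm.br_br_lift {j l l' : ℤ} {a θ f : Fam d m n E F} (ha : IsCompatible a)
    (hta : ∀ p, HasType 2 0 j (a p)) (hθ : IsForm 1 l θ) (hf : IsForm 0 l' f) :
    IsForm 0 (j - 1 + l + l') fun p => (locCalc m n _).br ((locCalc m n _).br
      ((locCalc m n _).br (canonDelta m n _) (a p)) (θ p)) (f p) := by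
  refine isForm_of_hasType ?_ fun p =>
    ((hta p).br_br_lift (hθ.hasType p) (hf.hasType p)).congr (by ring) (by ring) rfl
  simp only [WeakKoszul.br_br_lift (hta _) (hθ.hasType _) (hf.hasType _)]
  exact (ha.br_form hθ.compatible hta hθ.hasType).br_lift hf.compatible
    (fun p => br_one_form (hta p) (hθ.hasType p)) hf.hasType

end forms

/-! ### The master function, the evolution and the main results -/

section gaugeSystem
variable {d m n : ℕ} {M : Type*} [TopologicalSpace M] [ChartedSpace (Model d) M]
  {E : M → Type*} [TopologicalSpace (Bundle.TotalSpace (Model m) E)]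
  [∀ x, TopologicalSpace (E x)] [FiberBundle (Model m) E]
  [∀ x, AddCommGroup (E x)] [∀ x, Module ℝ (E x)] [VectorBundle ℝ (Model m) E]
  {F : M → Type*} [TopologicalSpace (Bundle.TotalSpace (Model n) F)]
  [∀ x, TopologicalSpace (F x)] [FiberBundle (Model n) F]
  [∀ x, AddCommGroup (F x)] [∀ x, Module ℝ (F x)] [VectorBundle ℝ (Model n) F]
  {T : ∀ x, E x} {R : ∀ x, F x →ₗ[ℝ] TangentSpace 𝓘(ℝ, Model d) x}
  {P : ∀ x : M, (TangentSpace 𝓘(ℝ, Model d) x →L[ℝ] ℝ) →ₗ[ℝ]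
    (TangentSpace 𝓘(ℝ, Model d) x →L[ℝ] ℝ) →ₗ[ℝ] ℝ}
  {X : ∀ x : M, TangentSpace 𝓘(ℝ, Model d) x} {S V : FormalFam d m n E F}

theorem IsMasterFunction.hasType (hS : IsMasterFunction T R P S) (p : M) (k : ℕ) :
    HasType k 0 2 (S p k) := hS.isFunction.hasType (hS.ghost p k)

theorem IsEvolution.hasType (hV : IsEvolution S X V) (p : M) (k : ℕ) :
    HasType k 0 1 (V p k) := hV.isFunction.hasType (hV.ghost p k)

/-- The degree-two part of the master equation, lifted. Both lifts are odd, so their bracket is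
symmetric and the equation says twice the same thing. -/
theorem IsMasterFunction.br_one_two (hS : IsMasterFunction T R P S) (p : M) :
    (locCalc m n _).br ((locCalc m n _).br (canonDelta m n _) (S p 1))
      ((locCalc m n _).br (canonDelta m n _) (S p 2)) = 0 := by
  have h := congrFun (hS.master p) 2
  rw [oddBr_two (hS.posDegree p) (hS.posDegree p)] at h
  have h2 := congrArg ((locCalc m n _).br (canonDelta m n _)) h
  rw [SuperPoisson.br_add_right, br_lift_lift (hS.hasType p 1) (hS.hasType p 2),
    br_lift_lift (hS.hasType p 2) (hS.hasType p 1),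
    SuperPoisson.br_skew (hS.hasType p 2).br_canonDelta.par
      (hS.hasType p 1).br_canonDelta.par, Pi.zero_apply, SuperPoisson.br_zero_right] at h2
  have e : ((-1 : ℝ) ^ ((2 - 1 : ℤ).natAbs * (2 - 1 : ℤ).natAbs)) = -1 := by norm_num
  rw [e, neg_one_smul, neg_neg, ← neg_add, neg_eq_zero, ← two_smul ℝ] at h2
  exact (smul_eq_zero.1 h2).resolve_left two_ne_zero

theorem IsEvolution.br_one_two (hS : IsMasterFunction T R P S) (hV : IsEvolution S X V) (p : M) :
    (locCalc m n _).br ((locCalc m n _).br (canonDelta m n _) (S p 1))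
        ((locCalc m n _).br (canonDelta m n _) (V p 2)) +
      (locCalc m n _).br ((locCalc m n _).br (canonDelta m n _) (S p 2))
        ((locCalc m n _).br (canonDelta m n _) (V p 1)) = 0 := by
  have h := congrFun (hV.master p) 2
  rw [oddBr_two (hS.posDegree p) (hV.posDegree p)] at h
  have h2 := congrArg ((locCalc m n _).br (canonDelta m n _)) h
  rw [SuperPoisson.br_add_right, br_lift_lift (hS.hasType p 1) (hV.hasType p 2),
    br_lift_lift (hS.hasType p 2) (hV.hasType p 1), Pi.zero_apply,
    SuperPoisson.br_zero_right] at h2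
  rwa [← neg_add, neg_eq_zero] at h2

theorem IsMasterFunction.constPart_etaMom (hS : IsMasterFunction T R P S) {p x : M}
    (hx : x ∈ patchSource (d := d) (m := m) (n := n) E F p) (b : Fin m) :
    (constPart m n _ (pd (mom (.inr (.inl b))) (S p 1))).1 (toPatch E F p ⟨x, hx⟩) =
      sectionComp T p x b := by
  rw [constPart_pd_resZero rfl, hS.boundary_one]
  simp [fibDeriv_mul, fibDeriv_mom_fib, fibDeriv_mom_gen]

/-- The sign comes from moving the odd derivative along `x*_i` past `c^α`. -/
theorem IsMasterFunction.constPart_c_xMom (hS : IsMasterFunction T R P S) {p x : M}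
    (hx : x ∈ patchSource (d := d) (m := m) (n := n) E F p) (α : Fin n) (i : Fin d) :
    (constPart m n _ (pd (fib (.inr α)) (pd (mom (.inl i)) (S p 1)))).1 (toPatch E F p ⟨x, hx⟩) =
      -gaugeComp R p x α i := by
  have hp : gpar (mom (.inl i : Idx d m n)) = 1 := rfl
  have hp' : ∀ β : Fin n, gpar (fib (d := d) (m := m) (.inr β)) = 1 := fun _ => rfl
  rw [constPart_pd_pd_resZero rfl rfl, hS.boundary_one]
  simp [fibDeriv_mul, fibDeriv_mom_fib, fibDeriv_mom_gen, hp, hp', fibInvol_gen, fibDeriv_fib_gen]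

theorem IsEvolution.constPart_xMom (hV : IsEvolution S X V) {p x : M}
    (hx : x ∈ patchSource (d := d) (m := m) (n := n) E F p) (i : Fin d) :
    (constPart m n _ (pd (mom (.inl i)) (V p 1))).1 (toPatch E F p ⟨x, hx⟩) =
      tangentComp p x (X x) i := by
  rw [constPart_pd_resZero rfl, hV.boundary]
  simp [fibDeriv_mom_gen]

/-- The coefficient of `c^α` in the cocycle equation, on the zero section, expresses `R_α f` through
the `T^b`. -/
theorem isObservable_of_cocycle (hS : IsMasterFunction T R P S) {G : Fam d m n E F}
    (hG : ∀ p, HasType 0 0 0 (G p)) (hQ : ∀ p, Qhat S G p = 0) :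
    IsObservable T R (restrictTM G) := by
  intro p α
  refine ⟨fun b => -constPart m n _ (pd (fib (.inr α)) (pd (fib (.inl b)) (G p))), fun x hx => ?_⟩
  have h := hQ p
  rw [Qhat, unary_lift_eq (hS.hasType p 1) (hG p)] at h
  have h2 := constPart_pd_br (hS.hasType p 1) (hG p) α
  rw [h, map_zero, map_zero, eq_comm, neg_add_eq_zero] at h2
  have h3 := congrArg (fun s : Smooth _ => s.1 (toPatch E F p ⟨x, hx⟩)) h2
  simp only [smooth_sum_mul_apply, hS.constPart_etaMom hx, hS.constPart_c_xMom hx, neg_mul,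
    Finset.sum_neg_distrib] at h3
  simp only [restrictTM, (hG p).sum_evalAt_pdPos]
  congr 1
  rw [neg_eq_iff_eq_neg.1 h3, ← Finset.sum_neg_distrib]
  exact Finset.sum_congr rfl fun b _ => (mul_neg _ _).symm

/-- The constant term of `𝓛_V G = Q̂τ` has `X^i ∂_i f` on the left, and only the terms `T^b ∂τ/∂η^b`
on the right. -/
theorem isIntegralOfMotion_of_exact (hS : IsMasterFunction T R P S) (hV : IsEvolution S X V)
    {G : Fam d m n E F} (hG : ∀ p, HasType 0 0 0 (G p))
    (hQ : IsExact S 0 0 (lieDeriv V G)) : IsIntegralOfMotion T X (restrictTM G) := by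
  obtain ⟨τ, hτ, e⟩ := hQ
  intro p
  refine ⟨fun b => constPart m n _ (pd (fib (.inl b)) (τ p)), fun x hx => ?_⟩
  have h := congrFun e p
  rw [lieDeriv, evolution, Qhat, unary_lift_eq (hV.hasType p 1) (hG p),
    unary_lift_eq (hS.hasType p 1) (hτ.hasType p)] at h
  have h2 := congrArg (constPart m n _) h
  rw [map_neg, constPart_br_of_one (hV.hasType p 1) (hG p), neg_neg,
    constPart_br_of_two (hS.hasType p 1) (hτ.hasType p)] at h2
  have h3 := congrArg (fun s : Smooth _ => s.1 (toPatch E F p ⟨x, hx⟩)) h2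
  simp only [smooth_sum_mul_apply, hS.constPart_etaMom hx, hV.constPart_xMom hx] at h3
  simp only [restrictTM, (hG p).sum_evalAt_pdPos]
  rw [h3]

theorem koszul_eq (hS : IsMasterFunction T R P S) {θ f : Fam d m n E F} {v l w l' : ℤ} {p : M}
    (hθ : HasType 0 v l (θ p)) (hf : HasType 0 w l' (f p)) :
    koszul S θ f p = (locCalc m n _).br ((locCalc m n _).br
      ((locCalc m n _).br (canonDelta m n _) (S p 2)) (θ p)) (f p) :=
  binary_lift_eq (hS.hasType p 2) hθ hf

/-- The derivatives that enter the bracket have the same restriction to `ΠTM` for a projectible form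
as for its extension. -/
theorem weakKoszul_eq (hS : IsMasterFunction T R P S) {θ f θt ft : Fam d m n E F}
    (hθ : IsProjectible S 1 θ θt) (hf : IsProjectible S 0 f ft) :
    restrictTM (koszul S θt ft) = weakKoszul S θ f := by
  funext p
  have h1 := hθ.isForm.hasType p
  have h2 := hf.isForm.hasType p
  have e1 : θ p = restrict onTM (θt p) := (congrFun hθ.extends_form p).symm
  have e2 : f p = restrict onTM (ft p) := (congrFun hf.extends_form p).symm
  rw [weakKoszul, restrictTM, restrictTM, koszul_eq hS h1 h2,
    koszul_eq hS (e1 ▸ h1.restrict onTM) (e2 ▸ h2.restrict onTM), e1, e2]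
  exact restrict_binary_congr (hS.hasType p 2) h1 h2 (h1.restrict onTM) (h2.restrict onTM)
    (fun A => (restrict_onTM_pd_vel h1 A).symm) fun A => (restrict_onTM_pdPos h2 A).symm

variable [IsManifold 𝓘(ℝ, Model d) ∞ M]
  [ContMDiffVectorBundle ∞ (Model m) E 𝓘(ℝ, Model d)]
  [ContMDiffVectorBundle ∞ (Model n) F 𝓘(ℝ, Model d)]

theorem koszul_isProjectible (hS : IsMasterFunction T R P S) {θ f θt ft : Fam d m n E F}
    (hθ : IsProjectible S 1 θ θt) (hf : IsProjectible S 0 f ft) :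
    IsProjectible S 0 (weakKoszul S θ f) (koszul S θt ft) := by
  have hk : koszul S θt ft = fun p => (locCalc m n _).br ((locCalc m n _).br
      ((locCalc m n _).br (canonDelta m n _) (S p 2)) (θt p)) (ft p) :=
    funext fun p => koszul_eq hS (hθ.isForm.hasType p) (hf.isForm.hasType p)
  have hF : IsForm 0 (-0) (koszul S θt ft) := by
    rw [hk]
    exact (IsForm.br_br_lift (hS.isFunction.compatible 2) (fun p => hS.hasType p 2) hθ.isForm
      hf.isForm).congr rfl (by ring)
  refine ⟨hF, weakKoszul_eq hS hθ hf, fun p => ?_⟩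
  rw [Qhat, unary_lift_eq (hS.hasType p 1) (hF.hasType p), hk]
  have h1 := hθ.cocycle p
  have h2 := hf.cocycle p
  rw [Qhat, unary_lift_eq (hS.hasType p 1) (hθ.isForm.hasType p)] at h1
  rw [Qhat, unary_lift_eq (hS.hasType p 1) (hf.isForm.hasType p)] at h2
  exact SuperPoisson.br_br_br_eq_zero (hS.hasType p 1).br_canonDelta.par (hS.hasType p 2).br_canonDelta.par
    (hθ.isForm.hasType p).par (hS.br_one_two p) h1 h2

theorem lieDeriv_koszul_isExact (hS : IsMasterFunction T R P S) (hV : IsEvolution S X V)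
    {θ f θt ft : Fam d m n E F} (hθ : IsProjectible S 1 θ θt) (hf : IsProjectible S 0 f ft)
    (hθV : IsExact S 1 (-1) (evolution V θt)) (hfV : IsExact S 0 0 (evolution V ft)) :
    IsExact S 0 0 (lieDeriv V (koszul S θt ft)) := by
  obtain ⟨σ, hσ, eσ⟩ := hθV
  obtain ⟨ρ, hρ, eρ⟩ := hfV
  have hA := (IsForm.br_br_lift (hV.isFunction.compatible 2) (fun p => hV.hasType p 2) hθ.isForm
    hf.isForm).congr (k' := 0) (l' := 0 - 1) rfl (by ring)
  have hB := (IsForm.br_br_lift (hS.isFunction.compatible 2) (fun p => hS.hasType p 2) hσ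
    hf.isForm).congr (k' := 0) (l' := 0 - 1) rfl (by ring)
  have hC := (IsForm.br_br_lift (hS.isFunction.compatible 2) (fun p => hS.hasType p 2) hθ.isForm
    hρ).congr (k' := 0) (l' := 0 - 1) rfl (by ring)
  -- The primitive of `br_derivation`: the homotopy `{{Γ₂, θ̃}, f̃}` corrected by the primitives `σ`
  -- and `ρ` of the two evolutions. The overall minus is that of `𝓛_V`.
  have hτ := ((hA.add hB.neg).add hC).neg
  refine ⟨_, hτ, funext fun p => ?_⟩
  have hG := (koszul_isProjectible hS hθ hf).isForm.hasType p
  have tθ := hθ.isForm.hasType p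
  have tf := hf.isForm.hasType p
  rw [lieDeriv, evolution, Qhat, unary_lift_eq (hV.hasType p 1) hG,
    unary_lift_eq (hS.hasType p 1) (hτ.hasType p), SuperPoisson.br_neg_right, neg_inj,
    koszul_eq hS tθ tf, ← sub_eq_add_neg]
  have h1 := hθ.cocycle p
  have h2 := hf.cocycle p
  have h3 := congrFun eσ p
  have h4 := congrFun eρ p
  rw [Qhat, unary_lift_eq (hS.hasType p 1) tθ] at h1
  rw [Qhat, unary_lift_eq (hS.hasType p 1) tf] at h2
  rw [Qhat, evolution, unary_lift_eq (hS.hasType p 1) (hσ.hasType p),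
    unary_lift_eq (hV.hasType p 1) tθ] at h3
  rw [Qhat, evolution, unary_lift_eq (hS.hasType p 1) (hρ.hasType p),
    unary_lift_eq (hV.hasType p 1) tf] at h4
  exact SuperPoisson.br_derivation (hS.hasType p 1).br_canonDelta.par (hS.hasType p 2).br_canonDelta.par
    (hV.hasType p 1).br_canonDelta.par (hV.hasType p 2).br_canonDelta.par tθ.par
    -- `σ` has ghost number `-1 - 1 = -2`, hence is even.
    ((hσ.hasType p).par.congr (by decide)) (hS.br_one_two p) (hV.br_one_two hS p) h1 h2 h3 h4

end gaugeSystem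

end WeakKoszul

end

theorem mainTheorem7 {d m n : ℕ}
    {M : Type*} [TopologicalSpace M] [ChartedSpace (WeakKoszul.Model d) M]
    [IsManifold 𝓘(ℝ, WeakKoszul.Model d) ∞ M]
    {E : M → Type*} [TopologicalSpace (Bundle.TotalSpace (WeakKoszul.Model m) E)]
    [∀ x, TopologicalSpace (E x)] [FiberBundle (WeakKoszul.Model m) E]
    [∀ x, AddCommGroup (E x)] [∀ x, Module ℝ (E x)] [VectorBundle ℝ (WeakKoszul.Model m) E]
    [ContMDiffVectorBundle ∞ (WeakKoszul.Model m) E 𝓘(ℝ, WeakKoszul.Model d)]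
    {F : M → Type*} [TopologicalSpace (Bundle.TotalSpace (WeakKoszul.Model n) F)]
    [∀ x, TopologicalSpace (F x)] [FiberBundle (WeakKoszul.Model n) F]
    [∀ x, AddCommGroup (F x)] [∀ x, Module ℝ (F x)] [VectorBundle ℝ (WeakKoszul.Model n) F]
    [ContMDiffVectorBundle ∞ (WeakKoszul.Model n) F 𝓘(ℝ, WeakKoszul.Model d)]
    -- the gauge system, the weak Poisson bivector and the dynamics on `M`
    (T : ∀ x, E x) (R : ∀ x, F x →ₗ[ℝ] TangentSpace 𝓘(ℝ, WeakKoszul.Model d) x)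
    (P : ∀ x : M, (TangentSpace 𝓘(ℝ, WeakKoszul.Model d) x →L[ℝ] ℝ) →ₗ[ℝ]
      (TangentSpace 𝓘(ℝ, WeakKoszul.Model d) x →L[ℝ] ℝ) →ₗ[ℝ] ℝ)
    (hP : ∀ x a b, P x a b = -P x b a)
    (X : ∀ x : M, TangentSpace 𝓘(ℝ, WeakKoszul.Model d) x)
    -- the master function and the extension of `X`
    (S V : WeakKoszul.FormalFam d m n E F)
    (hS : WeakKoszul.IsMasterFunction T R P S) (hV : WeakKoszul.IsEvolution S X V)
    -- a projectible `1`-form `θ` and a projectible function `f` on `M`, with their extensions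
    (θ f θt ft : WeakKoszul.Fam d m n E F)
    (hθ : WeakKoszul.IsProjectible S 1 θ θt) (hf : WeakKoszul.IsProjectible S 0 f ft)
    (hθV : WeakKoszul.IsExact S 1 (-1) (WeakKoszul.evolution V θt))
    (hfV : WeakKoszul.IsExact S 0 0 (WeakKoszul.evolution V ft)) :
    WeakKoszul.IsProjectible S 0 (WeakKoszul.weakKoszul S θ f) (WeakKoszul.koszul S θt ft) ∧
    WeakKoszul.IsExact S 0 0 (WeakKoszul.lieDeriv V (WeakKoszul.koszul S θt ft)) ∧
    WeakKoszul.IsObservable T R (WeakKoszul.weakKoszul S θ f) ∧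
    WeakKoszul.IsIntegralOfMotion T X (WeakKoszul.weakKoszul S θ f) := by
  have h1 := WeakKoszul.koszul_isProjectible hS hθ hf
  have h2 := WeakKoszul.lieDeriv_koszul_isExact hS hV hθ hf hθV hfV
  refine ⟨h1, h2, ?_, ?_⟩
  -- The function on `M` is replaced by the restriction of its cocycle extension, whose terms in `η`
  -- and `c` carry the information.
  · rw [← h1.extends_form]
    exact WeakKoszul.isObservable_of_cocycle hS (fun p => h1.isForm.hasType p) h1.cocycle
  · rw [← h1.extends_form]
    exact WeakKoszul.isIntegralOfMotion_of_exact hS hV (fun p => h1.isForm.hasType p) h2
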